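/- **Setting.** Let $K\ge 1$ source–destination pairs $(S_i,D_i)$ and one roadside unit (RSU) be located in the plane at $\mathbf x_{S,i},\mathbf x_{D,i},\mathbf x_R$ (with $\mathbf x_{S,i}\ne\mathbf x_{D,i}$, $\mathbf x_{S,i}\neq\mathbf x_R$, $\mathbf x_R\ne\mathbf x_{D,i}$). Let $P_s,P_r,N_0>0$, $\alpha_1,\alpha_2\in\mathbb R$, $0<p_0<1$, $\delta,\tau_R,\tau_C>0$, $\tau_1=\tau_R+\tau_C<\tau_d$, $\tau_{d,1}=\tau_d-\tau_1$. Channel access proceeds in independent, identically distributed rounds. In a round, in each slot every source independently sends an RTS with probability $p_0$, until exactly one source $w$ (the winner) sends; idle slots last $\delta$, collisions $\tau_R$, the successful slot $\tau_R+\tau_C$. The mean duration of this contention is $$\tau_o=\tau_R+\tau_C+\frac{(1-p_0)^K\delta+\big(1-(1-p_0)^K-Kp_0(1-p_0)^{K-1}\big)\tau_R}{Kp_0(1-p_0)^{K-1}} .$$ In each round the SNRs $\gamma_i,\gamma_{1,i},\gamma_{2,i}$ of the links $S_i\to D_i$, $S_i\to R$, $R\to D_i$ are independent (also of the contention) and exponentially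 distributed with means $\sigma_i^2=P_s\|\mathbf x_{S,i}-\mathbf x_{D,i}\|^{-\alpha_1}/N_0$, $P_s\|\mathbf x_{S,i}-\mathbf x_R\|^{-\alpha_2}/N_0$, $P_r\|\mathbf x_R-\mathbf x_{D,i}\|^{-\alpha_2}/N_0$. The received SNR of the RSU-aided transmission is taken, in the approximation $\frac{\gamma_1\gamma_2}{\gamma_1+\gamma_2+1}\approx\min\{\gamma_1,\gamma_2\}$, as $\gamma_r=\gamma_w+\min\{\gamma_{1,w},\gamma_{2,w}\}$. Put $R_d(\gamma)=\log_2(1+\gamma)$ and $R_r(\gamma_r)=\tfrac12\log_2(1+\gamma_r)$. After each contention the winner, its contention time and its SNR $\gamma=\gamma_w$ are observed, and one decides to *stop* (transmit $Y=\tau_dR_d$ bits over the V2V link), to *re-contend*, or to *probe the RSU*. In the last case $\gamma_{1,w},\gamma_{2,w}$ are observed, and one decides to *stop* (transmit $Y=\tau_{d,1}\max\{R_d,R_r\}$ bits) or to *re-contend*. Decisions depend measurably on what has been observed so far. The total time $T$ is the sum of all contention times, of $\tau_1$ for every probing in a round before the last one, and of $\tau_d$. A strategy is feasible if it stops almost surely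 and $\mathbb E[T]<\infty$; its throughput is $\mathbb E[Y]/\mathbb E[T]$, and $\lambda^*$ is the supremum of the throughputs of feasible strategies. For $\gamma,\lambda\ge0$ let $$\hat W_i(\gamma,\lambda)=\tfrac{\tau_{d,1}}{2\ln2}\Big(e^{-c_i(\Omega-\gamma)}\ln(\Omega+1)+e^{c_i(1+\gamma)}\mathrm E_1\big(c_i(\Omega+1)\big)\Big)+\tau_{d,1}\Big(\mathbb I[R_d(\gamma)>\lambda]\,(R_d(\gamma)-\lambda)F_i(\gamma^2+\gamma)+\lambda F_i(\Omega-\gamma)\Big)-\lambda\tau_d,$$ where $\Omega=\max\{4^\lambda-1,\gamma^2+2\gamma\}$, $c_i=N_0\big(P_s^{-1}\|\mathbf x_{S,i}-\mathbf x_R\|^{\alpha_2}+P_r^{-1}\|\mathbf x_R-\mathbf x_{D,i}\|^{\alpha_2}\big)$, $F_i(x)=1-e^{-c_ix}$ and $\mathrm E_1(x)=\int_x^\infty e^{-t}t^{-1}dt$. Let $\hat{\mathcal H}$ be the strategy: after a contention won by $i$ with V2V SNR $\gamma$, stop if $\tau_dR_d-\lambda^*\tau_d\ge\max\{\hat W_i(\gamma,\lambda^*),0\}$;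 re-contend if $\tau_dR_d-\lambda^*\tau_d<0$ and $\hat W_i(\gamma,\lambda^*)<0$; otherwise probe the RSU, and then stop iff $\max\{R_d,R_r\}\ge\lambda^*$ (otherwise re-contend). **Theorem.** 0. $0<\lambda^*<\infty$, and $\mathbb E[Y]<\infty$ for every feasible strategy. 1. (Thresholds.) For all $i$ and $\lambda\ge0$ (in particular $\lambda=\lambda^*$) there are unique $\zeta_i,\eta_i\ge0$ such that for all $\gamma\ge0$: $\hat W_i(\gamma,\lambda)\ge0$ if $\gamma\ge\zeta_i$ and $\hat W_i(\gamma,\lambda)<0$ if $\gamma<\zeta_i$; $\hat W_i(\gamma,\lambda)\le\tau_d(\log_2(1+\gamma)-\lambda)$ if $\gamma\ge\eta_i$ and $\hat W_i(\gamma,\lambda)>\tau_d(\log_2(1+\gamma)-\lambda)$ if $\gamma<\eta_i$. Moreover $\hat W_i(\eta_i,\lambda)=\tau_d(\log_2(1+\eta_i)-\lambda)$; and $\hat W_i(\zeta_i,\lambda)=0$ if $\hat W_i(0,\lambda)\le0$, while $\zeta_i=0$ if $\hat W_i(0,\lambda)>0$. 2. (Pure threshold strategy.) With $\zeta_i,\eta_i$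 taken at $\lambda=\lambda^*$, consider the strategy: after a contention won by $i$ with V2V SNR $\gamma$, stop if $\gamma\ge\eta_i$; re-contend if $\gamma<\zeta_i$; otherwise probe the RSU. (If both conditions hold, $\eta_i\le\gamma<\zeta_i$, stop if $\gamma\ge2^{\lambda^*}-1$ and re-contend otherwise.) After probing, stop iff $\max\{\gamma,\sqrt{1+\gamma_r}-1\}\ge2^{\lambda^*}-1$, and re-contend otherwise; here $\sqrt{1+\gamma_r}-1$ is the V2V SNR that gives the same rate as the RSU-aided transmission. For every pair $i$ and all $\gamma_r\ge\gamma\ge0$, its decisions coincide with those of $\hat{\mathcal H}$. Both strategies are feasible and attain the maximal throughput $\lambda^*$. 3. (Algorithm.) For $\lambda\ge0$ let $\zeta_i,\eta_i$ be the thresholds at $\lambda$, and put $$\Lambda_i(\lambda)=\frac1{\sigma_i^2}\int_{\zeta_i}^{\eta_i}\hat W_i(x,\lambda)e^{-x/\sigma_i^2}dx+\frac{\tau_d}{\sigma_i^2}\int_{\eta_i}^\infty(\log_2(1+x)-\lambda)e^{-x/\sigma_i^2}dx$$ if $\hat W_i(2^\lambda-1,\lambda)>0$, and $\Lambda_i(\lambda)=\frac{\tau_d}{\sigma_i^2}\int_{2^\lambda-1}^\infty(\log_2(1+x)-\lambda)e^{-x/\sigma_i^2}dx$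 otherwise. Let $\Delta(\lambda)=\frac1K\sum_{i=1}^K\Lambda_i(\lambda)-\lambda\tau_o$, $\lambda_0=0$ and $\lambda_{l+1}=\lambda_l+\alpha_l\Delta(\lambda_l)$, where $\varepsilon>0$ and $\varepsilon\le\alpha_l\le\frac{2-\varepsilon}{\tau_o+\tau_d}$ for all $l$. Then $\lambda_l\to\lambda^*$. The algorithm that stops at the first $l$ with $|\Delta(\lambda_l)|<\varepsilon$ and returns $\lambda_l$ terminates, and its output satisfies $|\lambda_l-\lambda^*|<\varepsilon/\tau_o$. If moreover $\alpha_l\le\frac1{\tau_o+\tau_d}$ for all $l$, then $\Delta(\lambda_l)\ge0$ for all $l$ (so that the tests $|\Delta|<\varepsilon$ and $\Delta<\varepsilon$ agree). -/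

import Mathlib

open MeasureTheory ProbabilityTheory Filter Topology

noncomputable section

namespace VANET

/-! ### The network -/

/-- A snapshot of the network: `K` source-destination pairs and one roadside unit (RSU) in the plane,
transmission powers, noise power, path loss exponents, the probability `p0` of sending an RTS in a
slot, the durations of an idle slot, of an RTS and of a CTS, and the maximal transmission
duration `τd`. -/
structure Network (K : ℕ) where
  xS : Fin K → EuclideanSpace ℝ (Fin 2)
  xD : Fin K → EuclideanSpace ℝ (Fin 2)
  xR : EuclideanSpace ℝ (Fin 2)
  Ps : ℝ
  Pr : ℝ
  N0 : ℝ
  α₁ : ℝ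
  α₂ : ℝ
  p0 : ℝ
  δ : ℝ
  τR : ℝ
  τC : ℝ
  τd : ℝ
  xS_ne_xD : ∀ i, xS i ≠ xD i
  xS_ne_xR : ∀ i, xS i ≠ xR
  xR_ne_xD : ∀ i, xR ≠ xD i
  Ps_pos : 0 < Ps
  Pr_pos : 0 < Pr
  N0_pos : 0 < N0
  p0_pos : 0 < p0
  p0_lt_one : p0 < 1
  δ_pos : 0 < δ
  τR_pos : 0 < τR
  τC_pos : 0 < τC
  probe_lt_τd : τR + τC < τd

variable {K : ℕ}

namespace Network

/-- Duration of probing the RSU. -/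
def τ1 (N : Network K) : ℝ := N.τR + N.τC

/-- Time left for data transmission after probing the RSU. -/
def τd1 (N : Network K) : ℝ := N.τd - N.τ1

/-- Probability that exactly one source sends an RTS in a slot. -/
def pSucc (N : Network K) : ℝ := K * N.p0 * (1 - N.p0) ^ (K - 1)

/-- Mean duration of a channel contention. -/
def τo (N : Network K) : ℝ :=
  N.τR + N.τC + (1 - N.p0) ^ K * N.δ / N.pSucc
    + (1 - (1 - N.p0) ^ K - N.pSucc) * N.τR / N.pSucc

/-- Mean SNR of the V2V link of pair `i`. -/
def meanV2V (N : Network K) (i : Fin K) : ℝ := N.Ps * dist (N.xS i) (N.xD i) ^ (-N.α₁) / N.N0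

/-- Mean SNR of the link from source `i` to the RSU. -/
def meanSR (N : Network K) (i : Fin K) : ℝ := N.Ps * dist (N.xS i) N.xR ^ (-N.α₂) / N.N0

/-- Mean SNR of the link from the RSU to destination `i`. -/
def meanRD (N : Network K) (i : Fin K) : ℝ := N.Pr * dist N.xR (N.xD i) ^ (-N.α₂) / N.N0

/-- The rate of the exponential law of the minimum of the two RSU link SNRs of pair `i`. -/
def c (N : Network K) (i : Fin K) : ℝ :=
  N.N0 * (N.Ps⁻¹ * dist (N.xS i) N.xR ^ N.α₂ + N.Pr⁻¹ * dist N.xR (N.xD i) ^ N.α₂)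

end Network

/-! ### Rates and the closed form of the probing value -/

/-- Achievable rate of the V2V link at SNR `γ`. -/
def rateD (γ : ℝ) : ℝ := Real.logb 2 (1 + γ)

/-- Achievable rate of the RSU-aided transmission (two hops, half of the time each) at received
SNR `γr`. -/
def rateR (γr : ℝ) : ℝ := 1 / 2 * Real.logb 2 (1 + γr)

/-- Received SNR of the RSU-aided transmission, with `γ₁ γ₂ / (γ₁ + γ₂ + 1)` approximated by
`min γ₁ γ₂`. -/
def relaySNR (γ : ℝ) (p : ℝ × ℝ) : ℝ := γ + min p.1 p.2

/-- The exponential integral. -/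
def expIntegralE1 (x : ℝ) : ℝ := ∫ t in Set.Ioi x, Real.exp (-t) / t

/-- The quantity `Ω` of the closed form. -/
def Om (γ lam : ℝ) : ℝ := max ((4 : ℝ) ^ lam - 1) (γ ^ 2 + 2 * γ)

open Classical in
/-- The closed form `Ŵ_i(γ, λ)` of the expected net reward, at price `lam` per unit of time, of
probing the RSU when pair `i` has won with V2V SNR `γ`. -/
def What (N : Network K) (i : Fin K) (γ lam : ℝ) : ℝ :=
  N.τd1 / (2 * Real.log 2) *
      (Real.exp (-N.c i * (Om γ lam - γ)) * Real.log (Om γ lam + 1)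
        + Real.exp (N.c i * (1 + γ)) * expIntegralE1 (N.c i * (Om γ lam + 1)))
    + N.τd1 *
      ((if lam < rateD γ then
          (rateD γ - lam) * (1 - Real.exp (-N.c i * (γ ^ 2 + γ))) else 0)
        + lam * (1 - Real.exp (-N.c i * (Om γ lam - γ))))
    - lam * N.τd

/-! ### One contention round -/

/-- Exactly one source sends an RTS in the slot. -/
def SlotSuccess (s : Fin K → Bool) : Prop := ∃! i, s i = true

/-- Index of the first slot in which exactly one source sends an RTS. -/
def firstSuccess (s : ℕ → Fin K → Bool) : ℕ := sInf {n | SlotSuccess (s n)}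

open Classical in
/-- The winner of the contention (`0` in the null event that no slot is successful). -/
def winner [NeZero K] (s : ℕ → Fin K → Bool) : Fin K :=
  if h : SlotSuccess (s (firstSuccess s)) then h.choose else 0

open Classical in
/-- Duration of the contention: idle slots last `δ`, collisions `τR`, the successful slot
`τR + τC`. -/
def contentionTime (N : Network K) (s : ℕ → Fin K → Bool) : ℝ :=
  ∑ n ∈ Finset.range (firstSuccess s), (if ∀ i, s n i = false then N.δ else N.τR)
    + (N.τR + N.τC)

/-- Sample space of one round: who sends an RTS in each slot, and for each pair the SNRs of the links
source-destination, source-RSU, RSU-destination. -/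
abbrev Round (K : ℕ) : Type := (ℕ → Fin K → Bool) × (Fin K → ℝ × ℝ × ℝ)

/-- Law of the RTS decision of one source in one slot. -/
def slotLaw (N : Network K) : Measure Bool :=
  bernoulliMeasure true false ⟨N.p0, N.p0_pos.le, N.p0_lt_one.le⟩

/-- Law of the three SNRs of pair `i`. -/
def snrLaw (N : Network K) (i : Fin K) : Measure (ℝ × ℝ × ℝ) :=
  (expMeasure (N.meanV2V i)⁻¹).prod
    ((expMeasure (N.meanSR i)⁻¹).prod (expMeasure (N.meanRD i)⁻¹))

/-- Law of one round: all sources and slots are independent, and so are all links. -/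
def roundLaw (N : Network K) : Measure (Round K) :=
  (Measure.infinitePi fun _ : ℕ => Measure.pi fun _ : Fin K => slotLaw N).prod
    (Measure.pi fun i => snrLaw N i)

/-- Law of the sequence of rounds, which are independent and identically distributed. -/
def law (N : Network K) : Measure (ℕ → Round K) :=
  Measure.infinitePi fun _ : ℕ => roundLaw N

theorem isProbabilityMeasure_slotLaw (N : Network K) : IsProbabilityMeasure (slotLaw N) := by
  unfold slotLaw; infer_instance

theorem isProbabilityMeasure_snrLaw (N : Network K) (i : Fin K) :
    IsProbabilityMeasure (snrLaw N i) := by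
  have h1 := dist_pos.2 (N.xS_ne_xD i)
  have h2 := dist_pos.2 (N.xS_ne_xR i)
  have h3 := dist_pos.2 (N.xR_ne_xD i)
  have := N.Ps_pos
  have := N.Pr_pos
  have := N.N0_pos
  have := isProbabilityMeasure_expMeasure (r := (N.meanV2V i)⁻¹) (by
    unfold Network.meanV2V; positivity)
  have := isProbabilityMeasure_expMeasure (r := (N.meanSR i)⁻¹) (by
    unfold Network.meanSR; positivity)
  have := isProbabilityMeasure_expMeasure (r := (N.meanRD i)⁻¹) (by
    unfold Network.meanRD; positivity)
  unfold snrLaw; infer_instance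

theorem isProbabilityMeasure_roundLaw (N : Network K) : IsProbabilityMeasure (roundLaw N) := by
  have := isProbabilityMeasure_slotLaw N
  have := isProbabilityMeasure_snrLaw N
  unfold roundLaw; infer_instance

theorem isProbabilityMeasure_law (N : Network K) : IsProbabilityMeasure (law N) := by
  have := isProbabilityMeasure_roundLaw N
  unfold law; infer_instance

/-- What is known after a successful contention: the winner, the contention time and the winner's
V2V SNR. -/
abbrev FirstObs (K : ℕ) : Type := Fin K × ℝ × ℝ

def firstObs [NeZero K] (N : Network K) (r : Round K) : FirstObs K :=
  (winner r.1, contentionTime N r.1, (r.2 (winner r.1)).1)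

/-- What is found by probing: the SNRs of the two RSU links of the winner. -/
def probeObs [NeZero K] (r : Round K) : ℝ × ℝ := (r.2 (winner r.1)).2

/-- What is known about a past round: the first observation, whether the RSU was probed, and, if it
was, the SNRs of the RSU links (`0` otherwise). -/
abbrev PastObs (K : ℕ) : Type := FirstObs K × Bool × (ℝ × ℝ)

/-! ### Strategies -/

/-- The decisions after a contention: to stop and transmit over the V2V link, to re-contend, or to
probe the RSU. -/
inductive Decision : Type
  | transmit
  | recontend
  | probe

/-- A strategy. `first n h o` is the decision after the contention of round `n`, given what is known
about the previous rounds and the first observation `o`; if it is to probe, `second n h o p` says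
whether to stop (otherwise: re-contend) after the RSU link SNRs `p` have been observed. -/
structure Strategy (K : ℕ) where
  first : (n : ℕ) → (Fin n → PastObs K) → FirstObs K → Decision
  second : (n : ℕ) → (Fin n → PastObs K) → FirstObs K → ℝ × ℝ → Prop

namespace Strategy

variable [NeZero K]

open Classical in
/-- What a user of the strategy `S` knows about the first `n` rounds. -/
def history (N : Network K) (S : Strategy K) (ω : ℕ → Round K) : (n : ℕ) → (Fin n → PastObs K)
  | 0 => Fin.elim0
  | n + 1 =>
      Fin.snoc (α := fun _ => PastObs K) (history N S ω n)
        (if S.first n (history N S ω n) (firstObs N (ω n)) = Decision.probe then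
          (firstObs N (ω n), true, probeObs (ω n))
        else (firstObs N (ω n), false, (0, 0)))

/-- The first decision in round `n`. -/
def decision (N : Network K) (S : Strategy K) (ω : ℕ → Round K) (n : ℕ) : Decision :=
  S.first n (history N S ω n) (firstObs N (ω n))

/-- The strategy stops in round `n` (if it has not stopped earlier), before or after probing. -/
def StopsAt (N : Network K) (S : Strategy K) (ω : ℕ → Round K) (n : ℕ) : Prop :=
  decision N S ω n = Decision.transmit ∨
    (decision N S ω n = Decision.probe ∧
      S.second n (history N S ω n) (firstObs N (ω n)) (probeObs (ω n)))

/-- The round in which the strategy stops. -/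
def stopRound (N : Network K) (S : Strategy K) (ω : ℕ → Round K) : ℕ :=
  sInf {n | StopsAt N S ω n}

open Classical in
/-- Amount of data transmitted. -/
def reward (N : Network K) (S : Strategy K) (ω : ℕ → Round K) : ℝ :=
  let n := stopRound N S ω
  let γ := (firstObs N (ω n)).2.2
  if decision N S ω n = Decision.transmit then N.τd * rateD γ
  else N.τd1 * max (rateD γ) (rateR (relaySNR γ (probeObs (ω n))))

open Classical in
/-- Total time: all contentions, the probings before the last round, and `τd` for the last round
(which includes its probing, if any). -/
def cost (N : Network K) (S : Strategy K) (ω : ℕ → Round K) : ℝ :=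
  let n := stopRound N S ω
  ∑ l ∈ Finset.range (n + 1), (firstObs N (ω l)).2.1
    + ∑ l ∈ Finset.range n, (if decision N S ω l = Decision.probe then N.τ1 else 0)
    + N.τd

/-- A feasible strategy decides measurably, stops almost surely and takes finite expected time. -/
structure Feasible (N : Network K) (S : Strategy K) : Prop where
  measurable_first : ∀ n d, MeasurableSet
    {x : (Fin n → PastObs K) × FirstObs K | S.first n x.1 x.2 = d}
  measurable_second : ∀ n, MeasurableSet
    {x : (Fin n → PastObs K) × FirstObs K × (ℝ × ℝ) | S.second n x.1 x.2.1 x.2.2}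
  stops : ∀ᵐ ω ∂(law N), ∃ n, StopsAt N S ω n
  integrable_cost : Integrable (cost N S) (law N)

/-- Average throughput of a strategy. -/
def throughput (N : Network K) (S : Strategy K) : ℝ :=
  (∫ ω, reward N S ω ∂(law N)) / (∫ ω, cost N S ω ∂(law N))

end Strategy

/-- The maximal average throughput `λ*`. -/
def maxThroughput [NeZero K] (N : Network K) : ℝ :=
  sSup {x | ∃ S : Strategy K, S.Feasible N ∧ x = S.throughput N}

/-! ### The strategy built on the closed form -/

open Classical in
/-- First decision of the strategy built on `Ŵ`: compare the immediate reward `τd R_d - λ τd` with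
the value of probing and with the value `0` of re-contending. -/
def hatFirst (N : Network K) (lam : ℝ) (i : Fin K) (γ : ℝ) : Decision :=
  if max (What N i γ lam) 0 ≤ N.τd * rateD γ - lam * N.τd then Decision.transmit
  else if N.τd * rateD γ - lam * N.τd < 0 ∧ What N i γ lam < 0 then Decision.recontend
  else Decision.probe

/-- Second decision of the strategy built on `Ŵ`: stop iff `max {R_d, R_r} ≥ λ`. -/
def hatSecond (lam γ γr : ℝ) : Prop := lam ≤ max (rateD γ) (rateR γr)

def hatStrategy (N : Network K) (lam : ℝ) : Strategy K where
  first _ _ o := hatFirst N lam o.1 o.2.2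
  second _ _ o p := hatSecond lam o.2.2 (relaySNR o.2.2 p)

/-! ### Thresholds and the pure threshold strategy -/

/-- `z` separates negative from nonnegative values of `Ŵ_i(·, lam)` on `[0, ∞)`. -/
def IsRecontendThreshold (N : Network K) (i : Fin K) (lam z : ℝ) : Prop :=
  0 ≤ z ∧ ∀ γ, 0 ≤ γ →
    (z ≤ γ → 0 ≤ What N i γ lam) ∧ (γ < z → What N i γ lam < 0)

/-- `h` separates, on `[0, ∞)`, the SNRs at which `Ŵ_i(·, lam)` exceeds the immediate reward of the
V2V link from those at which it does not. -/
def IsStopThreshold (N : Network K) (i : Fin K) (lam h : ℝ) : Prop :=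
  0 ≤ h ∧ ∀ γ, 0 ≤ γ →
    (h ≤ γ → What N i γ lam ≤ N.τd * rateD γ - lam * N.τd) ∧
    (γ < h → N.τd * rateD γ - lam * N.τd < What N i γ lam)

/-- The threshold `ζ_i` at price `lam`. -/
def zeta (N : Network K) (lam : ℝ) (i : Fin K) : ℝ :=
  sInf {γ | 0 ≤ γ ∧ 0 ≤ What N i γ lam}

/-- The threshold `η_i` at price `lam`. -/
def eta (N : Network K) (lam : ℝ) (i : Fin K) : ℝ :=
  sInf {γ | 0 ≤ γ ∧ What N i γ lam ≤ N.τd * rateD γ - lam * N.τd}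

open Classical in
/-- First decision of the pure threshold strategy: stop if `γ ≥ η`, re-contend if `γ < ζ`, otherwise
probe. If both conditions hold (possible only if `η < ζ`), probing is of no use and the decision
is made by the single threshold `2 ^ λ - 1`. -/
def ptdFirst (lam ζ η γ : ℝ) : Decision :=
  if η ≤ γ ∧ γ < ζ then
    (if (2 : ℝ) ^ lam - 1 ≤ γ then Decision.transmit else Decision.recontend)
  else if η ≤ γ then Decision.transmit
  else if γ < ζ then Decision.recontend
  else Decision.probe

/-- Second decision of the pure threshold strategy. The number `√(1 + γr) - 1` is the V2V SNR
which gives the same rate as the RSU-aided transmission at received SNR `γr`. -/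
def ptdSecond (lam γ γr : ℝ) : Prop := (2 : ℝ) ^ lam - 1 ≤ max γ (√(1 + γr) - 1)

def ptdStrategy (lam : ℝ) (ζ η : Fin K → ℝ) : Strategy K where
  first _ _ o := ptdFirst lam (ζ o.1) (η o.1) o.2.2
  second _ _ o p := ptdSecond lam o.2.2 (relaySNR o.2.2 p)

/-! ### The iterative algorithm -/

open Classical in
/-- The quantity `Λ_i(lam)` computed by the algorithm. -/
def Lam (N : Network K) (lam : ℝ) (i : Fin K) : ℝ :=
  if 0 < What N i ((2 : ℝ) ^ lam - 1) lam then
    1 / N.meanV2V i *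
        (∫ x in zeta N lam i..eta N lam i, What N i x lam * Real.exp (-x / N.meanV2V i))
      + N.τd / N.meanV2V i *
        (∫ x in Set.Ioi (eta N lam i), (rateD x - lam) * Real.exp (-x / N.meanV2V i))
  else
    N.τd / N.meanV2V i *
      (∫ x in Set.Ioi ((2 : ℝ) ^ lam - 1), (rateD x - lam) * Real.exp (-x / N.meanV2V i))

/-- The increment `Δ` at `lam`. -/
def increment (N : Network K) (lam : ℝ) : ℝ := 1 / (K : ℝ) * ∑ i, Lam N lam i - lam * N.τo

/-- The iterates `λ_l` for step sizes `α l`. -/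
def iterate (N : Network K) (α : ℕ → ℝ) : ℕ → ℝ
  | 0 => 0
  | l + 1 => iterate N α l + α l * increment N (iterate N α l)

/-- `x` is the output of the loop: the first iterate at which `|Δ| < ε`. -/
def IsOutput (N : Network K) (α : ℕ → ℝ) (ε x : ℝ) : Prop :=
  ∃ n, x = iterate N α n ∧ |increment N (iterate N α n)| < ε ∧
    ∀ m < n, ε ≤ |increment N (iterate N α m)|

end VANET

end

noncomputable section

namespace VANET

/-! ### Exponential laws -/

/-! Maximizing a ratio E[Y]/E[T] is turned into a family of one-round problems by charging a price
`lam` per unit of time. Given the first observation, the best net value of a round is the largest of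
three numbers: transmit now, probe, or re-contend with value 0 (`stageValue`). Its mean minus the
price of a contention is `increment N lam`. Every round of every strategy, conditionally on the
past, has mean net value at most this number (`integral_round_le`), with equality for the strategy
that always picks the largest option (`integral_round_eq`). Summing over the rounds by Wald's
argument, at a price with zero increment one gets E[Y] - lam E[T] ≤ 0 in general and = 0 for the
greedy strategies. So such a root is the maximal throughput and is attained
(`Feasible.throughput_le`, `AgreesWithHat.throughput_eq`).

The value of probing is explicit because the smaller of two independent exponential SNRs is again
exponential. With `Z` of that law, integration by parts gives `What` = τd1 E max(R_d, R_r(γ + Z), λ)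
- λ τd (`probeRate_eq`, `What_eq`). This form yields the thresholds: the expectation increases
strictly in γ, but more slowly than R_d does, since R_r(γ + z) - R_d(γ) decreases in γ
(`rateR_sub_rateD_anti`). Hence both `What` and its deficit against immediate transmission are
strictly increasing and continuous, and each changes sign once. Cutting the integral of the
three-way maximum at the sign changes identifies `Lam` with the mean stage value (`Lam_eq`).

For the algorithm, raising the price lowers the stage value at a rate between 0 and τd. The
increment therefore decreases with secant slopes between τo and τo + τd in absolute value
(`le_increment_sub`, `increment_sub_le`). This gives a root, makes each iteration step a contraction
towards it, and bounds the error by |Δ|/τo. -/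

theorem expMeasure_eq_withDensity (r : ℝ) : expMeasure r =
    (volume.restrict (Set.Ioi 0)).withDensity
      (fun x => ENNReal.ofReal (r * Real.exp (-(r * x)))) := by
  have h : expMeasure r = volume.withDensity (exponentialPDF r) := rfl
  rw [h, Measure.restrict_congr_set Ioi_ae_eq_Ici, ← withDensity_indicator measurableSet_Ici]
  congr 1
  ext x
  rw [exponentialPDF_eq, Set.indicator_apply]
  by_cases hx : 0 ≤ x <;> simp [hx]

theorem integral_expMeasure {r : ℝ} (hr : 0 < r) (f : ℝ → ℝ) :
    ∫ x, f x ∂(expMeasure r) = ∫ x in Set.Ioi 0, r * Real.exp (-(r * x)) * f x := by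
  rw [expMeasure_eq_withDensity, integral_withDensity_eq_integral_toReal_smul]
  · refine integral_congr_ae (Eventually.of_forall fun x => ?_)
    simp only [smul_eq_mul]
    rw [ENNReal.toReal_ofReal (by positivity)]
  · fun_prop
  · exact Eventually.of_forall fun x => ENNReal.ofReal_lt_top

theorem integrable_expMeasure_iff {r : ℝ} (hr : 0 < r) (f : ℝ → ℝ) :
    Integrable f (expMeasure r) ↔
      IntegrableOn (fun x => r * Real.exp (-(r * x)) * f x) (Set.Ioi 0) := by
  rw [expMeasure_eq_withDensity, integrable_withDensity_iff_integrable_smul']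
  · refine integrable_congr (Eventually.of_forall fun x => ?_)
    simp only [smul_eq_mul]
    rw [ENNReal.toReal_ofReal (by positivity)]
  · fun_prop
  · exact Eventually.of_forall fun x => ENNReal.ofReal_lt_top

theorem ae_pos_expMeasure (r : ℝ) : ∀ᵐ x ∂(expMeasure r), 0 < x := by
  rw [expMeasure_eq_withDensity]
  exact (withDensity_absolutelyContinuous _ _).ae_le (ae_restrict_mem measurableSet_Ioi)

theorem integrable_id_expMeasure {r : ℝ} (hr : 0 < r) :
    Integrable (fun x => x) (expMeasure r) := by
  rw [integrable_expMeasure_iff hr]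
  -- Half of the exponential decay absorbs the linear factor: r x ≤ 2 exp(r x / 2).
  have h := (exp_neg_integrableOn_Ioi 0 (half_pos hr)).const_mul 2
  refine h.mono' (by fun_prop) ?_
  filter_upwards [ae_restrict_mem measurableSet_Ioi] with x hx
  have hx : 0 < x := hx
  have h1 : r / 2 * x ≤ Real.exp (r / 2 * x) := by
    have := Real.add_one_le_exp (r / 2 * x); linarith
  have h2 : Real.exp (-(r * x)) = Real.exp (-(r / 2) * x) * Real.exp (-(r / 2) * x) := by
    rw [← Real.exp_add]; ring_nf
  have h3 : Real.exp (r / 2 * x) * Real.exp (-(r / 2) * x) = 1 := by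
    rw [← Real.exp_add]; simp
  have hp := Real.exp_pos (-(r / 2) * x)
  rw [Real.norm_of_nonneg (by positivity), h2]
  nlinarith [mul_le_mul_of_nonneg_right h1 hp.le]

theorem expMeasure_Ioi {r : ℝ} (hr : 0 < r) {x : ℝ} (hx : 0 ≤ x) :
    expMeasure r (Set.Ioi x) = ENNReal.ofReal (Real.exp (-(r * x))) := by
  have := isProbabilityMeasure_expMeasure hr
  have h := cdf_expMeasure_eq hr x
  rw [if_pos hx, cdf_eq_real] at h
  have h2 := prob_compl_eq_one_sub (μ := expMeasure r) (measurableSet_Iic (a := x))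
  rw [Set.compl_Iic] at h2
  rw [h2, ← ofReal_measureReal, h, ← ENNReal.ofReal_one, ← ENNReal.ofReal_sub]
  · congr 1; ring
  · have : Real.exp (-(r * x)) ≤ 1 := Real.exp_le_one_iff.2 (by nlinarith)
    linarith

/-- Tail probabilities of independent variables multiply under `min`, and exponential tails multiply
by adding rates. This reduces the two RSU links to one variable. -/
theorem map_min_expMeasure {a b : ℝ} (ha : 0 < a) (hb : 0 < b) :
    ((expMeasure a).prod (expMeasure b)).map (fun p => min p.1 p.2) = expMeasure (a + b) := by
  have hab : 0 < a + b := by positivity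
  have := isProbabilityMeasure_expMeasure ha
  have := isProbabilityMeasure_expMeasure hb
  have := isProbabilityMeasure_expMeasure hab
  have hm : Measurable (fun p : ℝ × ℝ => min p.1 p.2) := measurable_fst.min measurable_snd
  have := Measure.isProbabilityMeasure_map (μ := (expMeasure a).prod (expMeasure b)) hm.aemeasurable
  have key : ∀ x, (((expMeasure a).prod (expMeasure b)).map (fun p => min p.1 p.2)) (Set.Ioi x)
      = expMeasure a (Set.Ioi x) * expMeasure b (Set.Ioi x) := by
    intro x
    rw [Measure.map_apply hm measurableSet_Ioi, ← Measure.prod_prod]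
    congr 1
    ext p; simp
  -- The exponential tail formula is valid only at nonnegative points; below zero all tails equal 1.
  have one : ∀ r : ℝ, 0 < r → ∀ x < 0, expMeasure r (Set.Ioi x) = 1 := by
    intro r hr x hx
    have := isProbabilityMeasure_expMeasure hr
    rw [prob_compl_eq_zero_iff measurableSet_Ioi |>.symm]
    exact mem_ae_iff.1 ((ae_pos_expMeasure r).mono fun y hy => hx.trans hy)
  refine Measure.ext_of_Iic _ _ fun x => ?_
  rw [← Set.compl_Ioi, prob_compl_eq_one_sub measurableSet_Ioi,
    prob_compl_eq_one_sub measurableSet_Ioi, key]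
  congr 1
  rcases lt_or_ge x 0 with hx | hx
  · simp [one, ha, hb, hab, hx]
  · rw [expMeasure_Ioi ha hx, expMeasure_Ioi hb hx, expMeasure_Ioi hab hx,
      ← ENNReal.ofReal_mul (Real.exp_pos _).le, ← Real.exp_add]
    congr 2; ring

/-! ### Rates -/

theorem half_lt_log_two : (1 : ℝ) / 2 < Real.log 2 := by
  have := Real.log_two_gt_d9; linarith

theorem rateD_nonneg {γ : ℝ} (h : 0 ≤ γ) : 0 ≤ rateD γ :=
  Real.logb_nonneg (by norm_num) (by linarith)

theorem rateR_nonneg {x : ℝ} (h : 0 ≤ x) : 0 ≤ rateR x :=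
  mul_nonneg (by norm_num) (rateD_nonneg h)

theorem rateD_lt_rateD {x y : ℝ} (hx : 0 ≤ x) (h : x < y) : rateD x < rateD y :=
  Real.logb_lt_logb (by norm_num) (by linarith) (by linarith)

theorem rateD_le_rateD {x y : ℝ} (hx : 0 ≤ x) (h : x ≤ y) : rateD x ≤ rateD y :=
  Real.logb_le_logb_of_le (by norm_num) (by linarith) (by linarith)

theorem rateR_lt_rateR {x y : ℝ} (hx : 0 ≤ x) (h : x < y) : rateR x < rateR y :=
  mul_lt_mul_of_pos_left (rateD_lt_rateD hx h) (by norm_num)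

theorem rateR_le_rateR {x y : ℝ} (hx : 0 ≤ x) (h : x ≤ y) : rateR x ≤ rateR y :=
  mul_le_mul_of_nonneg_left (rateD_le_rateD hx h) (by norm_num)

/-- Crude linear bound, used for integrability; 2 exceeds 1 / log 2. -/
theorem rateD_le_two_mul {x : ℝ} (hx : 0 ≤ x) : rateD x ≤ 2 * x := by
  have h := half_lt_log_two
  unfold rateD Real.logb
  rw [div_le_iff₀ (by linarith)]
  have := Real.log_le_sub_one_of_pos (show 0 < 1 + x by linarith)
  nlinarith

theorem rateR_le_self {x : ℝ} (hx : 0 ≤ x) : rateR x ≤ x := by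
  have := rateD_le_two_mul hx
  unfold rateD at this; unfold rateR; linarith

theorem measurable_rateD : Measurable rateD := by
  unfold rateD Real.logb; fun_prop

theorem measurable_rateR : Measurable rateR := by
  unfold rateR Real.logb; fun_prop

theorem continuousOn_rateD : ContinuousOn rateD (Set.Ici 0) := by
  unfold rateD Real.logb
  refine ContinuousOn.div_const (ContinuousOn.log (by fun_prop) fun x hx => ?_) _
  have : (0 : ℝ) ≤ x := hx
  positivity

theorem tendsto_rateD_atTop : Tendsto rateD atTop atTop :=
  (Real.tendsto_logb_atTop (by norm_num)).comp (tendsto_atTop_add_const_left _ _ tendsto_id)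

theorem le_rateD_iff {lam γ : ℝ} (hγ : -1 < γ) : lam ≤ rateD γ ↔ (2 : ℝ) ^ lam - 1 ≤ γ := by
  unfold rateD
  rw [Real.le_logb_iff_rpow_le (by norm_num) (by linarith)]
  constructor <;> intro h <;> linarith

theorem rateD_lt_iff {lam γ : ℝ} (hγ : -1 < γ) : rateD γ < lam ↔ γ < (2 : ℝ) ^ lam - 1 := by
  rw [← not_le, le_rateD_iff hγ, not_le]

theorem le_rateR_iff {lam x : ℝ} (hx : -1 < x) : lam ≤ rateR x ↔ (4 : ℝ) ^ lam - 1 ≤ x := by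
  have h : rateR x = 1 / 2 * rateD x := rfl
  have h4 : (4 : ℝ) ^ lam = 2 ^ (2 * lam) := by
    rw [Real.rpow_mul (by norm_num)]; norm_num
  rw [h4, ← le_rateD_iff hx, h]
  constructor <;> intro h <;> linarith

theorem rateR_sub_rateD {γ z : ℝ} (hγ : 0 ≤ γ) (hz : 0 ≤ z) :
    rateR (γ + z) - rateD γ = 1 / 2 * Real.logb 2 ((1 + γ + z) / (1 + γ) ^ 2) := by
  unfold rateR rateD
  rw [Real.logb_div (by positivity) (by positivity), Real.logb_pow, ← add_assoc]
  push_cast; ring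

/-- Relaying gains less when the direct link is better: inside the logarithm, the denominator (1 +
γ)² outgrows the numerator 1 + γ + z. The single crossing behind the stop threshold rests on this.
-/
theorem rateR_sub_rateD_anti {γ γ' z : ℝ} (hγ : 0 ≤ γ) (h : γ ≤ γ') (hz : 0 ≤ z) :
    rateR (γ' + z) - rateD γ' ≤ rateR (γ + z) - rateD γ := by
  have h' : 0 ≤ γ' := hγ.trans h
  rw [rateR_sub_rateD hγ hz, rateR_sub_rateD h' hz]
  refine mul_le_mul_of_nonneg_left (Real.logb_le_logb_of_le (by norm_num) (by positivity) ?_)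
    (by norm_num)
  rw [div_le_div_iff₀ (by positivity) (by positivity)]
  have e1 : 1 + γ ≤ 1 + γ' := by linarith
  have e2 : (1 + γ) * (1 + γ) ≤ (1 + γ) * (1 + γ') := by gcongr
  have e3 : (1 + γ) * (1 + γ) ≤ (1 + γ') * (1 + γ') := by gcongr
  nlinarith [mul_nonneg hz (sub_nonneg.2 e3), mul_nonneg (sub_nonneg.2 e1)
    (show 0 ≤ (1 + γ) * (1 + γ') by positivity)]

/-! ### The expected rate available after probing -/

/-- The mean of the maximum of `lam`, of the V2V rate at SNR `γ` and of the RSU-aided rate, when the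
minimum of the two RSU link SNRs is exponential of rate `c`. -/
def probeRate (c γ lam : ℝ) : ℝ :=
  ∫ z, max (max (rateD γ) (rateR (γ + z))) lam ∂(expMeasure c)

theorem integrable_probeRate {c : ℝ} (hc : 0 < c) {γ : ℝ} (hγ : 0 ≤ γ) (lam : ℝ) :
    Integrable (fun z => max (max (rateD γ) (rateR (γ + z))) lam) (expMeasure c) := by
  have := isProbabilityMeasure_expMeasure hc
  refine Integrable.sup (Integrable.sup (integrable_const _) ?_) (integrable_const _)
  refine ((integrable_const γ).add (integrable_id_expMeasure hc)).mono'
    (measurable_rateR.comp (by fun_prop)).aestronglyMeasurable ?_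
  filter_upwards [ae_pos_expMeasure c] with z hz
  have : 0 ≤ γ + z := by positivity
  rw [Real.norm_of_nonneg (rateR_nonneg this)]
  exact rateR_le_self this

theorem probeRate_mono {c : ℝ} (hc : 0 < c) {γ γ' : ℝ} (hγ : 0 ≤ γ) (h : γ ≤ γ') (lam : ℝ) :
    probeRate c γ lam ≤ probeRate c γ' lam := by
  refine integral_mono_ae (integrable_probeRate hc hγ _)
    (integrable_probeRate hc (hγ.trans h) _) ?_
  filter_upwards [ae_pos_expMeasure c] with z hz
  have := rateD_le_rateD hγ h
  have := rateR_le_rateR (show 0 ≤ γ + z by positivity) (show γ + z ≤ γ' + z by linarith)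
  gcongr

/-- Strictness comes from large `z`: there the RSU-aided rate is the maximum and grows strictly with
γ, and the exponential law charges every such tail. -/
theorem probeRate_lt {c : ℝ} (hc : 0 < c) {γ γ' : ℝ} (hγ : 0 ≤ γ) (h : γ < γ') (lam : ℝ) :
    probeRate c γ lam < probeRate c γ' lam := by
  rw [← sub_pos]
  unfold probeRate
  rw [← integral_sub (integrable_probeRate hc (hγ.trans h.le) _) (integrable_probeRate hc hγ _),
    integral_pos_iff_support_of_nonneg_ae]
  · set m := max (rateD γ) lam
    have hsub : Set.Ioi (max ((4 : ℝ) ^ m - 1) 0) ⊆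
        Function.support (fun z => max (max (rateD γ') (rateR (γ' + z))) lam
          - max (max (rateD γ) (rateR (γ + z))) lam) := by
      intro z hz
      obtain ⟨h1, h2⟩ := max_lt_iff.1 (Set.mem_Ioi.1 hz)
      have h3 : m ≤ rateR (γ + z) := (le_rateR_iff (by linarith)).2 (by linarith)
      have h4 := rateR_lt_rateR (show 0 ≤ γ + z by linarith) (show γ + z < γ' + z by linarith)
      have h5 : max (max (rateD γ) (rateR (γ + z))) lam = rateR (γ + z) := by
        rw [max_eq_right ((le_max_left _ _).trans h3), max_eq_left ((le_max_right _ _).trans h3)]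
      have h6 := (le_max_right (rateD γ') (rateR (γ' + z))).trans (le_max_left _ lam)
      rw [Function.mem_support, h5]
      linarith
    refine (measure_mono hsub).trans_lt' ?_
    rw [expMeasure_Ioi hc (le_max_right _ _)]
    simp [Real.exp_pos]
  · filter_upwards [ae_pos_expMeasure c] with z hz
    have := rateD_le_rateD hγ h.le
    have := rateR_le_rateR (show 0 ≤ γ + z by positivity) (show γ + z ≤ γ' + z by linarith)
    rw [Pi.zero_apply, sub_nonneg]
    gcongr
  · exact (integrable_probeRate hc (hγ.trans h.le) _).sub (integrable_probeRate hc hγ _)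

theorem rateD_le_probeRate {c : ℝ} (hc : 0 < c) {γ : ℝ} (hγ : 0 ≤ γ) (lam : ℝ) :
    rateD γ ≤ probeRate c γ lam := by
  have := isProbabilityMeasure_expMeasure hc
  have h := integral_mono (μ := expMeasure c) (integrable_const (rateD γ))
    (integrable_probeRate hc hγ lam)
    (fun z => (le_max_left _ _).trans (le_max_left _ _))
  simpa [probeRate] using h

/-- Passing from γ to γ' raises each of the three arguments of the maximum by at most R_d(γ') -
R_d(γ): the V2V rate by exactly that, the RSU-aided rate by `rateR_sub_rateD_anti`, the constant by
nothing. -/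
theorem probeRate_sub_rateD_anti {c : ℝ} (hc : 0 < c) {γ γ' : ℝ} (hγ : 0 ≤ γ) (h : γ ≤ γ')
    (lam : ℝ) : probeRate c γ' lam - rateD γ' ≤ probeRate c γ lam - rateD γ := by
  have := isProbabilityMeasure_expMeasure hc
  have key := integral_mono_ae (μ := expMeasure c)
    (integrable_probeRate hc (hγ.trans h) lam)
    ((integrable_probeRate hc hγ lam).add (integrable_const (rateD γ' - rateD γ))) (by
      filter_upwards [ae_pos_expMeasure c] with z hz
      have h1 := rateD_le_rateD hγ h
      have h2 := rateR_sub_rateD_anti hγ h hz.le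
      simp only [Pi.add_apply]
      refine max_le (max_le ?_ ?_) ?_
      · have := (le_max_left (rateD γ) (rateR (γ + z))).trans (le_max_left _ lam); linarith
      · have := (le_max_right (rateD γ) (rateR (γ + z))).trans (le_max_left _ lam); linarith
      · have := le_max_right (max (rateD γ) (rateR (γ + z))) lam; linarith)
  rw [integral_add' (integrable_probeRate hc hγ lam) (integrable_const _)] at key
  simp only [integral_const, probReal_univ, one_smul] at key
  unfold probeRate; linarith

theorem probeRate_price_mono {c : ℝ} (hc : 0 < c) {γ : ℝ} (hγ : 0 ≤ γ) {lam lam' : ℝ}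
    (h : lam ≤ lam') : probeRate c γ lam ≤ probeRate c γ lam' :=
  integral_mono (integrable_probeRate hc hγ _) (integrable_probeRate hc hγ _)
    fun _ => max_le_max le_rfl h

theorem probeRate_price_le {c : ℝ} (hc : 0 < c) {γ : ℝ} (hγ : 0 ≤ γ) {lam lam' : ℝ}
    (h : lam ≤ lam') : probeRate c γ lam' ≤ probeRate c γ lam + (lam' - lam) := by
  have := isProbabilityMeasure_expMeasure hc
  have key := integral_mono (μ := expMeasure c) (integrable_probeRate hc hγ lam')
    ((integrable_probeRate hc hγ lam).add (integrable_const (lam' - lam))) (fun z => by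
      simp only [Pi.add_apply]
      refine max_le ?_ ?_
      · have := le_max_left (max (rateD γ) (rateR (γ + z))) lam; linarith
      · have := le_max_right (max (rateD γ) (rateR (γ + z))) lam; linarith)
  rw [integral_add' (integrable_probeRate hc hγ lam) (integrable_const _)] at key
  simpa [probeRate] using key

/-- Increments of `probeRate` lie between 0 and those of `rateD`, so continuity is inherited from
`rateD` by squeezing, without a limit under the integral. -/
theorem continuousOn_probeRate {c : ℝ} (hc : 0 < c) (lam : ℝ) :
    ContinuousOn (fun γ => probeRate c γ lam) (Set.Ici 0) := by
  intro x hx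
  have key : ∀ y ∈ Set.Ici (0 : ℝ),
      dist (probeRate c y lam) (probeRate c x lam) ≤ dist (rateD y) (rateD x) := by
    intro y hy
    rw [Real.dist_eq, Real.dist_eq]
    rcases le_total x y with h | h
    · have h1 := probeRate_mono hc hx h lam
      have h2 := probeRate_sub_rateD_anti hc hx h lam
      have h3 := rateD_le_rateD hx h
      rw [abs_of_nonneg (by linarith), abs_of_nonneg (by linarith)]; linarith
    · have h1 := probeRate_mono hc hy h lam
      have h2 := probeRate_sub_rateD_anti hc hy h lam
      have h3 := rateD_le_rateD hy h
      rw [abs_of_nonpos (by linarith), abs_of_nonpos (by linarith)]; linarith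
  have hcont := continuousOn_rateD x hx
  rw [ContinuousWithinAt, tendsto_iff_dist_tendsto_zero] at hcont ⊢
  exact squeeze_zero' (Eventually.of_forall fun _ => dist_nonneg)
    (eventually_mem_nhdsWithin.mono key) hcont

/-! ### The closed form -/

theorem setIntegral_Ioi_comp_add (f : ℝ → ℝ) (a b : ℝ) :
    ∫ x in Set.Ioi a, f (x + b) = ∫ x in Set.Ioi (a + b), f x := by
  rw [← integral_indicator measurableSet_Ioi, ← integral_indicator measurableSet_Ioi,
    ← integral_add_right_eq_self (fun x => Set.indicator (Set.Ioi (a + b)) f x) b]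
  congr 1
  ext x
  simp [Set.indicator_apply]

/-- Substitution t = c (z + 1 + γ); the exponential prefactor undoes the shift. -/
theorem expIntegralE1_mul {c : ℝ} (hc : 0 < c) (γ a : ℝ) :
    Real.exp (c * (1 + γ)) * expIntegralE1 (c * (a + (1 + γ)))
      = ∫ z in Set.Ioi a, Real.exp (-(c * z)) / (1 + γ + z) := by
  have h1 := integral_comp_mul_left_Ioi (fun t => Real.exp (-t) / t) (a + (1 + γ)) hc
  have h2 : expIntegralE1 (c * (a + (1 + γ)))
      = c * ∫ x in Set.Ioi (a + (1 + γ)), Real.exp (-(c * x)) / (c * x) := by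
    rw [h1, smul_eq_mul, mul_inv_cancel_left₀ hc.ne']; rfl
  rw [h2, ← setIntegral_Ioi_comp_add (fun x => Real.exp (-(c * x)) / (c * x)), ← mul_assoc,
    ← integral_const_mul]
  refine integral_congr_ae (Eventually.of_forall fun z => ?_)
  have h3 : Real.exp (-(c * z)) = Real.exp (c * (1 + γ)) * Real.exp (-(c * (z + (1 + γ)))) := by
    rw [← Real.exp_add]; ring_nf
  simp only [h3]
  rw [show 1 + γ + z = z + (1 + γ) by ring]
  -- At a vanishing denominator both sides are 0 by the convention for division.
  rcases eq_or_ne (z + (1 + γ)) 0 with h0 | h0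
  · simp [h0]
  · field_simp

theorem integrableOn_exp_div {c : ℝ} (hc : 0 < c) {γ a : ℝ} (hγ : 0 ≤ γ) (ha : 0 ≤ a) :
    IntegrableOn (fun z => Real.exp (-(c * z)) / (1 + γ + z)) (Set.Ioi a) := by
  have h := exp_neg_integrableOn_Ioi a hc
  refine h.mono' (Measurable.aestronglyMeasurable (by fun_prop)) ?_
  filter_upwards [ae_restrict_mem measurableSet_Ioi] with z hz
  have hz : a < z := hz
  have h0 : 0 < 1 + γ + z := by linarith
  rw [Real.norm_of_nonneg (by positivity), div_le_iff₀ h0, neg_mul]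
  have := Real.exp_pos (-(c * z))
  nlinarith

theorem tendsto_rateR_mul_exp {c : ℝ} (hc : 0 < c) {γ : ℝ} (hγ : 0 ≤ γ) (m : ℝ) :
    Tendsto (fun z => -((rateR (γ + z) - m) * Real.exp (-(c * z)))) atTop (𝓝 0) := by
  have hl : Tendsto (fun z => c * z) atTop atTop := tendsto_id.const_mul_atTop hc
  have h0 := (Real.tendsto_pow_mul_exp_neg_atTop_nhds_zero 0).comp hl
  have h1 := (Real.tendsto_pow_mul_exp_neg_atTop_nhds_zero 1).comp hl
  have hg : Tendsto (fun z => (γ + |m|) * ((c * z) ^ 0 * Real.exp (-(c * z)))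
      + c⁻¹ * ((c * z) ^ 1 * Real.exp (-(c * z)))) atTop (𝓝 0) := by
    simpa using (h0.const_mul (γ + |m|)).add (h1.const_mul c⁻¹)
  refine squeeze_zero_norm' ?_ hg
  filter_upwards [eventually_ge_atTop 0] with z hz
  have hr := rateR_le_self (show 0 ≤ γ + z by positivity)
  have hr0 := rateR_nonneg (show 0 ≤ γ + z by positivity)
  rw [norm_neg, norm_mul, Real.norm_of_nonneg (Real.exp_pos _).le, Real.norm_eq_abs]
  have h2 : |rateR (γ + z) - m| ≤ γ + |m| + z := by
    rw [abs_le]; constructor <;> linarith [le_abs_self m, neg_abs_le m]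
  have h3 : (γ + |m|) * ((c * z) ^ 0 * Real.exp (-(c * z)))
      + c⁻¹ * ((c * z) ^ 1 * Real.exp (-(c * z))) = (γ + |m| + z) * Real.exp (-(c * z)) := by
    field_simp
  rw [h3]
  exact mul_le_mul_of_nonneg_right h2 (Real.exp_pos _).le

/-- The boundary term of the integration by parts: its derivative is the difference of the two
integrands to be compared. -/
theorem hasDerivAt_rateR_mul_exp (c m : ℝ) {γ z : ℝ} (h : 0 < 1 + γ + z) :
    HasDerivAt (fun z => -((rateR (γ + z) - m) * Real.exp (-(c * z))))
      (c * Real.exp (-(c * z)) * (rateR (γ + z) - m)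
        - 1 / (2 * Real.log 2) * (Real.exp (-(c * z)) / (1 + γ + z))) z := by
  have h1 : HasDerivAt (fun z : ℝ => 1 + (γ + z)) 1 z :=
    ((hasDerivAt_id z).const_add γ).const_add 1
  have h2 := ((h1.log (by linarith : (1 + (γ + z)) ≠ 0)).div_const (Real.log 2)).const_mul (1 / 2)
  have h3 : HasDerivAt (fun z : ℝ => Real.exp (-(c * z))) (Real.exp (-(c * z)) * -(c * 1)) z :=
    (((hasDerivAt_id z).const_mul c).neg).exp
  have h4 := ((h2.sub_const m).mul h3).neg
  refine h4.congr_deriv ?_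
  have hlog : Real.log 2 ≠ 0 := by have := half_lt_log_two; linarith
  unfold rateR Real.logb
  simp only [← add_assoc]
  field_simp
  ring

/-- Integration by parts. The hypothesis `hm` kills the boundary term at `a`, and exponential decay
kills the one at infinity. -/
theorem integral_Ioi_rateR_sub {c : ℝ} (hc : 0 < c) {γ a : ℝ} (hγ : 0 ≤ γ) (ha : 0 ≤ a) {m : ℝ}
    (hm : rateR (γ + a) = m) :
    ∫ z in Set.Ioi a, c * Real.exp (-(c * z)) * (rateR (γ + z) - m)
      = 1 / (2 * Real.log 2) * ∫ z in Set.Ioi a, Real.exp (-(c * z)) / (1 + γ + z) := by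
  have := isProbabilityMeasure_expMeasure hc
  have hI : IntegrableOn (fun z => c * Real.exp (-(c * z)) * (rateR (γ + z) - m)) (Set.Ioi a) := by
    refine IntegrableOn.mono_set ?_ (Set.Ioi_subset_Ioi ha)
    rw [← integrable_expMeasure_iff hc]
    refine Integrable.sub ?_ (integrable_const _)
    refine ((integrable_const γ).add (integrable_id_expMeasure hc)).mono'
      (measurable_rateR.comp (by fun_prop)).aestronglyMeasurable ?_
    filter_upwards [ae_pos_expMeasure c] with z hz
    have : 0 ≤ γ + z := by positivity
    rw [Real.norm_of_nonneg (rateR_nonneg this)]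
    exact rateR_le_self this
  have hJ := (integrableOn_exp_div hc hγ ha).const_mul (1 / (2 * Real.log 2))
  have key := integral_Ioi_of_hasDerivAt_of_tendsto' (a := a)
    (fun z hz => hasDerivAt_rateR_mul_exp c m (γ := γ)
      (by have : a ≤ z := hz; linarith)) (hI.sub hJ) (tendsto_rateR_mul_exp hc hγ m)
  rw [integral_sub hI hJ, hm, integral_const_mul] at key
  linarith

/-- This is the meaning of Ω: the received SNR from which the RSU-aided rate is the best option. The
value γ² + 2γ matches R_d because 1 + γ² + 2γ = (1 + γ)², and 4^λ - 1 matches λ. -/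
theorem rateR_eq_max (γ lam : ℝ) (hγ : 0 ≤ γ) : rateR (Om γ lam) = max (rateD γ) lam := by
  have h4 : (0 : ℝ) < 4 ^ lam := by positivity
  have hΩ : -1 < Om γ lam :=
    (show (-1 : ℝ) < γ ^ 2 + 2 * γ by nlinarith).trans_le (le_max_right _ _)
  have hd : rateR (γ ^ 2 + 2 * γ) = rateD γ := by
    unfold rateR rateD
    rw [show 1 + (γ ^ 2 + 2 * γ) = (1 + γ) ^ 2 by ring, Real.logb_pow]; push_cast; ring
  have hl : rateR ((4 : ℝ) ^ lam - 1) = lam := by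
    unfold rateR
    rw [show (1 : ℝ) + (4 ^ lam - 1) = 4 ^ lam by ring,
      Real.logb_rpow_eq_mul_logb_of_pos (by norm_num),
      show (4 : ℝ) = 2 ^ 2 by norm_num, Real.logb_pow, Real.logb_self_eq_one (by norm_num)]
    push_cast; ring
  unfold Om
  rcases le_total ((4 : ℝ) ^ lam - 1) (γ ^ 2 + 2 * γ) with h | h
  · rw [max_eq_right h, hd, max_eq_left]
    rw [← hd, le_rateR_iff (by nlinarith)]; exact h
  · rw [max_eq_left h, hl, max_eq_right]
    rw [← hd, ← hl]
    exact rateR_le_rateR (by nlinarith) h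

theorem le_Om (γ lam : ℝ) (hγ : 0 ≤ γ) : γ ≤ Om γ lam :=
  (show γ ≤ γ ^ 2 + 2 * γ by nlinarith).trans (le_max_right _ _)

/-- The maximum exceeds m = max(R_d, λ) only for z beyond Ω - γ, so the mean excess is a tail
integral, which integration by parts turns into E₁. -/
theorem probeRate_eq {c : ℝ} (hc : 0 < c) {γ : ℝ} (hγ : 0 ≤ γ) (lam : ℝ) :
    probeRate c γ lam = max (rateD γ) lam + 1 / (2 * Real.log 2) *
      (Real.exp (c * (1 + γ)) * expIntegralE1 (c * (Om γ lam + 1))) := by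
  have := isProbabilityMeasure_expMeasure hc
  set m := max (rateD γ) lam with hm
  set a := Om γ lam - γ with ha
  have ha0 : 0 ≤ a := sub_nonneg.2 (le_Om γ lam hγ)
  have hma : rateR (γ + a) = m := by
    rw [ha, add_sub_cancel, rateR_eq_max γ lam hγ]
  have hE := expIntegralE1_mul hc γ a
  rw [show a + (1 + γ) = Om γ lam + 1 by rw [ha]; ring] at hE
  rw [hE, ← integral_Ioi_rateR_sub hc hγ ha0 hma]
  have h1 : probeRate c γ lam - m
      = ∫ z, (max (max (rateD γ) (rateR (γ + z))) lam - m) ∂(expMeasure c) := by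
    rw [integral_sub (integrable_probeRate hc hγ lam) (integrable_const _)]
    simp [probeRate]
  have h2 : ∫ z, (max (max (rateD γ) (rateR (γ + z))) lam - m) ∂(expMeasure c)
      = ∫ z in Set.Ioi a, c * Real.exp (-(c * z)) * (rateR (γ + z) - m) := by
    rw [integral_expMeasure hc, ← integral_indicator measurableSet_Ioi,
      ← integral_indicator measurableSet_Ioi]
    refine integral_congr_ae (Eventually.of_forall fun z => ?_)
    simp only [Set.indicator_apply, Set.mem_Ioi]
    have hmm : max (max (rateD γ) (rateR (γ + z))) lam = max m (rateR (γ + z)) := by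
      rw [max_right_comm]
    rw [hmm]
    by_cases hz : a < z
    · have h3 : m ≤ rateR (γ + z) := by
        rw [← hma]; exact rateR_le_rateR (by positivity) (by linarith)
      rw [if_pos hz, if_pos (ha0.trans_lt hz), max_eq_right h3]
    · rw [if_neg hz]
      split_ifs with h0
      · have h3 : rateR (γ + z) ≤ m := by
          rw [← hma]; exact rateR_le_rateR (by positivity) (by linarith)
        rw [max_eq_left h3, sub_self, mul_zero]
      · rfl
  rw [← h2, ← h1]; ring

/-! ### Positivity of the network constants -/

namespace Network

variable {K : ℕ} (N : Network K) (i : Fin K)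

theorem τ1_pos : 0 < N.τ1 := add_pos N.τR_pos N.τC_pos

theorem τd1_pos : 0 < N.τd1 := sub_pos.2 N.probe_lt_τd

theorem τd_eq : N.τd = N.τ1 + N.τd1 := by unfold τd1; ring

theorem τd_pos : 0 < N.τd := by rw [N.τd_eq]; exact add_pos N.τ1_pos N.τd1_pos

theorem meanV2V_pos : 0 < N.meanV2V i := by
  have h1 := dist_pos.2 (N.xS_ne_xD i)
  have := N.Ps_pos
  have := N.N0_pos
  unfold meanV2V; positivity

theorem meanSR_pos : 0 < N.meanSR i := by
  have h1 := dist_pos.2 (N.xS_ne_xR i)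
  have := N.Ps_pos
  have := N.N0_pos
  unfold meanSR; positivity

theorem meanRD_pos : 0 < N.meanRD i := by
  have h1 := dist_pos.2 (N.xR_ne_xD i)
  have := N.Pr_pos
  have := N.N0_pos
  unfold meanRD; positivity

theorem c_eq : N.c i = (N.meanSR i)⁻¹ + (N.meanRD i)⁻¹ := by
  have h2 := dist_pos.2 (N.xS_ne_xR i)
  have h3 := dist_pos.2 (N.xR_ne_xD i)
  unfold c meanSR meanRD
  rw [Real.rpow_neg h2.le, Real.rpow_neg h3.le]
  have := N.Ps_pos.ne'
  have := N.Pr_pos.ne'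
  have := N.N0_pos.ne'
  have := (Real.rpow_pos_of_pos h2 N.α₂).ne'
  have := (Real.rpow_pos_of_pos h3 N.α₂).ne'
  field_simp

theorem c_pos : 0 < N.c i := by
  rw [c_eq]; have := N.meanSR_pos i; have := N.meanRD_pos i; positivity

end Network

theorem What_eq {K : ℕ} (N : Network K) (i : Fin K) {γ : ℝ} (hγ : 0 ≤ γ) (lam : ℝ) :
    What N i γ lam = N.τd1 * probeRate (N.c i) γ lam - lam * N.τd := by
  have hlog : Real.log 2 ≠ 0 := by have := half_lt_log_two; linarith
  have hr := rateR_eq_max γ lam hγ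
  have hlogΩ : Real.log (Om γ lam + 1) = 2 * Real.log 2 * max (rateD γ) lam := by
    rw [← hr]; unfold rateR Real.logb
    rw [add_comm 1]; field_simp
  rw [probeRate_eq (N.c_pos i) hγ, What, hlogΩ]
  congr 1
  -- If R_d > λ, then Ω = γ² + 2γ and the two exponents in the closed form coincide; so in both
  -- branches the bracket is max(R_d, λ) times the probability that the RSU does not help. The
  -- logarithmic term supplies the complementary probability.
  have hterm : (if lam < rateD γ then
          (rateD γ - lam) * (1 - Real.exp (-N.c i * (γ ^ 2 + γ))) else 0)
        + lam * (1 - Real.exp (-N.c i * (Om γ lam - γ)))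
      = max (rateD γ) lam * (1 - Real.exp (-N.c i * (Om γ lam - γ))) := by
    split_ifs with h
    · have h1 : (2 : ℝ) ^ lam - 1 < γ := by
        by_contra hcon
        have := rateD_lt_iff (lam := lam) (γ := γ) (by linarith)
        have h3 := (le_rateD_iff (lam := lam) (γ := γ) (by linarith))
        rcases lt_or_eq_of_le (not_lt.1 hcon) with h4 | h4
        · exact absurd (this.2 h4) h.asymm.elim
        · have h5 : rateD γ = lam := by
            unfold rateD; rw [h4]; rw [add_sub_cancel, Real.logb_rpow (by norm_num) (by norm_num)]
          linarith
      have h2 : Om γ lam = γ ^ 2 + 2 * γ := by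
        unfold Om
        rw [max_eq_right]
        have h4 : (4 : ℝ) ^ lam = 2 ^ lam * 2 ^ lam := by
          rw [← Real.mul_rpow (by norm_num) (by norm_num)]; norm_num
        have : (0 : ℝ) < 2 ^ lam := by positivity
        nlinarith
      rw [h2, max_eq_left h.le, show γ ^ 2 + 2 * γ - γ = γ ^ 2 + γ by ring]
      ring
    · rw [max_eq_right (not_lt.1 h)]; ring
  rw [hterm]
  field_simp
  ring

variable {K : ℕ}

/-! ### Thresholds -/

/-- Either `f` is already nonnegative at 0, or the intermediate value theorem gives a zero, which
strict monotonicity makes the least point with `0 ≤ f`. -/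
theorem isLeast_threshold {f : ℝ → ℝ} (hc : ContinuousOn f (Set.Ici 0))
    (hm : StrictMonoOn f (Set.Ici 0)) (hex : ∃ x, 0 ≤ x ∧ 0 ≤ f x) :
    ∃ z, IsLeast {x | 0 ≤ x ∧ 0 ≤ f x} z ∧ (f 0 ≤ 0 → f z = 0) := by
  rcases le_or_gt 0 (f 0) with h0 | h0
  · exact ⟨0, ⟨⟨le_rfl, h0⟩, fun x hx => hx.1⟩, fun h => le_antisymm h h0⟩
  · obtain ⟨x, hx, hfx⟩ := hex
    obtain ⟨z, hz, hfz⟩ := intermediate_value_Icc hx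
      (hc.mono (fun y hy => hy.1)) (⟨h0.le, hfx⟩ : (0 : ℝ) ∈ Set.Icc (f 0) (f x))
    refine ⟨z, ⟨⟨hz.1, hfz.ge⟩, fun y hy => ?_⟩, fun _ => hfz⟩
    by_contra hlt
    have := hm hy.1 hz.1 (not_le.1 hlt)
    linarith [hy.2]

theorem threshold_spec {f : ℝ → ℝ} (hc : ContinuousOn f (Set.Ici 0))
    (hm : StrictMonoOn f (Set.Ici 0)) (hex : ∃ x, 0 ≤ x ∧ 0 ≤ f x) {z : ℝ}
    (hz : z = sInf {x | 0 ≤ x ∧ 0 ≤ f x}) :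
    0 ≤ z ∧ (∀ γ, 0 ≤ γ → (z ≤ γ → 0 ≤ f γ) ∧ (γ < z → f γ < 0)) ∧
      (f 0 ≤ 0 → f z = 0) ∧ (0 < f 0 → z = 0) := by
  obtain ⟨y, hy, hy0⟩ := isLeast_threshold hc hm hex
  rw [hy.csInf_eq] at hz
  subst hz
  refine ⟨hy.1.1, fun γ hγ => ⟨fun h => hy.1.2.trans (hm.monotoneOn hy.1.1 hγ h), fun h => ?_⟩,
    hy0, fun h => le_antisymm (hy.2 ⟨le_rfl, h.le⟩) hy.1.1⟩
  by_contra hcon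
  exact absurd (hy.2 ⟨hγ, not_lt.1 hcon⟩) (not_le.2 h)

theorem continuousOn_What (N : Network K) (i : Fin K) (lam : ℝ) :
    ContinuousOn (fun γ => What N i γ lam) (Set.Ici 0) := by
  refine ContinuousOn.congr (f := fun γ => N.τd1 * probeRate (N.c i) γ lam - lam * N.τd) ?_
    fun γ hγ => What_eq N i hγ lam
  exact ((continuousOn_probeRate (N.c_pos i) lam).const_mul N.τd1).sub continuousOn_const

theorem strictMonoOn_What (N : Network K) (i : Fin K) (lam : ℝ) :
    StrictMonoOn (fun γ => What N i γ lam) (Set.Ici 0) := by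
  intro x hx y hy h
  have := mul_lt_mul_of_pos_left (probeRate_lt (N.c_pos i) hx h lam) N.τd1_pos
  simp only [What_eq N i hx, What_eq N i hy]
  linarith

theorem exists_What_nonneg (N : Network K) (i : Fin K) (lam : ℝ) :
    ∃ x, 0 ≤ x ∧ 0 ≤ What N i x lam := by
  obtain ⟨x, hx0, hx⟩ := ((eventually_ge_atTop 0).and
    (tendsto_rateD_atTop.eventually_ge_atTop (lam * N.τd / N.τd1))).exists
  refine ⟨x, hx0, ?_⟩
  rw [What_eq N i hx0]
  have h1 := rateD_le_probeRate (N.c_pos i) hx0 lam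
  have h2 := (div_le_iff₀ N.τd1_pos).1 (hx.trans h1)
  linarith

theorem continuousOn_transmit_sub_What (N : Network K) (i : Fin K) (lam : ℝ) :
    ContinuousOn (fun γ => N.τd * rateD γ - lam * N.τd - What N i γ lam) (Set.Ici 0) :=
  ((continuousOn_rateD.const_mul N.τd).sub continuousOn_const).sub (continuousOn_What N i lam)

/-- The price cancels, leaving τ1 R_d - τd1 (`probeRate` - R_d): a strictly increasing term minus a
nonincreasing one. -/
theorem strictMonoOn_transmit_sub_What (N : Network K) (i : Fin K) (lam : ℝ) :
    StrictMonoOn (fun γ => N.τd * rateD γ - lam * N.τd - What N i γ lam) (Set.Ici 0) := by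
  intro x hx y hy h
  have h1 := mul_le_mul_of_nonneg_left
    (probeRate_sub_rateD_anti (N.c_pos i) hx h.le lam) N.τd1_pos.le
  have h2 := mul_lt_mul_of_pos_left (rateD_lt_rateD hx h) N.τ1_pos
  simp only [What_eq N i hx, What_eq N i hy]
  rw [N.τd_eq]
  linarith

theorem exists_What_le_transmit (N : Network K) (i : Fin K) (lam : ℝ) :
    ∃ x, 0 ≤ x ∧ 0 ≤ N.τd * rateD x - lam * N.τd - What N i x lam := by
  obtain ⟨x, hx0, hx⟩ := ((eventually_ge_atTop 0).and
    (tendsto_rateD_atTop.eventually_ge_atTop (N.τd1 * probeRate (N.c i) 0 lam / N.τ1))).exists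
  refine ⟨x, hx0, ?_⟩
  rw [What_eq N i hx0]
  have h1 := mul_le_mul_of_nonneg_left
    (probeRate_sub_rateD_anti (N.c_pos i) le_rfl hx0 lam) N.τd1_pos.le
  have h2 := (div_le_iff₀ N.τ1_pos).1 hx
  have h3 : rateD 0 = 0 := by simp [rateD]
  rw [h3] at h1
  rw [N.τd_eq]
  linarith

/-- With a useless V2V link, probing beats transmitting at every price because E₁ is positive. Hence
the stop threshold is always a genuine zero and never a boundary case, unlike the re-contend
threshold. -/
theorem What_zero_gt_transmit (N : Network K) (i : Fin K) (lam : ℝ) :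
    N.τd * rateD 0 - lam * N.τd - What N i 0 lam < 0 := by
  have h0 : rateD 0 = 0 := by simp [rateD]
  rw [What_eq N i le_rfl, h0]
  have hm : max (rateD 0) lam < probeRate (N.c i) 0 lam := by
    rw [probeRate_eq (N.c_pos i) le_rfl]
    have hlog : 0 < Real.log 2 := by have := half_lt_log_two; linarith
    have hpos : 0 < Om 0 lam + 1 := by have := le_Om 0 lam le_rfl; linarith
    have hE : 0 < expIntegralE1 (N.c i * (Om 0 lam + 1)) := by
      have hx : 0 < N.c i * (Om 0 lam + 1) := mul_pos (N.c_pos i) hpos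
      have h1 : IntegrableOn (fun t => Real.exp (-t) / t)
          (Set.Ioi (N.c i * (Om 0 lam + 1))) := by
        refine ((exp_neg_integrableOn_Ioi (N.c i * (Om 0 lam + 1)) one_pos).const_mul
          (N.c i * (Om 0 lam + 1))⁻¹).mono' (Measurable.aestronglyMeasurable (by fun_prop)) ?_
        filter_upwards [ae_restrict_mem measurableSet_Ioi] with t ht
        have ht : N.c i * (Om 0 lam + 1) < t := ht
        have ht0 := hx.trans ht
        rw [Real.norm_of_nonneg (by positivity), neg_one_mul, div_eq_inv_mul]
        gcongr
      refine (setIntegral_pos_iff_support_of_nonneg_ae ?_ h1).2 ?_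
      · filter_upwards [ae_restrict_mem measurableSet_Ioi] with t ht
        have ht0 : 0 < t := hx.trans ht
        simp only [Pi.zero_apply]; positivity
      · have : Function.support (fun t => Real.exp (-t) / t) ∩ Set.Ioi (N.c i * (Om 0 lam + 1))
            = Set.Ioi (N.c i * (Om 0 lam + 1)) := by
          refine Set.inter_eq_right.2 fun t ht => ?_
          have ht0 : 0 < t := hx.trans ht
          rw [Function.mem_support]; positivity
        rw [this]; simp
    have : 0 < 1 / (2 * Real.log 2) *
      (Real.exp (N.c i * (1 + 0)) * expIntegralE1 (N.c i * (Om 0 lam + 1))) := by positivity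
    linarith
  have h1 : 0 < probeRate (N.c i) 0 lam := by
    have := (le_max_left (rateD 0) lam).trans_lt hm
    rwa [h0] at this
  have := mul_pos N.τd1_pos h1
  linarith

theorem zeta_spec (N : Network K) (lam : ℝ) (i : Fin K) :
    IsRecontendThreshold N i lam (zeta N lam i) ∧
    (What N i 0 lam ≤ 0 → What N i (zeta N lam i) lam = 0) ∧
    (0 < What N i 0 lam → zeta N lam i = 0) := by
  obtain ⟨h1, h2, h3, h4⟩ := threshold_spec (continuousOn_What N i lam) (strictMonoOn_What N i lam)
    (exists_What_nonneg N i lam) (z := zeta N lam i) rfl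
  exact ⟨⟨h1, h2⟩, h3, h4⟩

theorem eta_spec (N : Network K) (lam : ℝ) (i : Fin K) :
    IsStopThreshold N i lam (eta N lam i) ∧
    What N i (eta N lam i) lam = N.τd * (rateD (eta N lam i) - lam) := by
  obtain ⟨h1, h2, h3, h4⟩ := threshold_spec (continuousOn_transmit_sub_What N i lam)
    (strictMonoOn_transmit_sub_What N i lam) (exists_What_le_transmit N i lam)
    (z := eta N lam i) (by simp only [eta, sub_nonneg])
  refine ⟨⟨h1, fun γ hγ => ⟨fun h => sub_nonneg.1 ((h2 γ hγ).1 h),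
    fun h => sub_neg.1 ((h2 γ hγ).2 h)⟩⟩, ?_⟩
  have := h3 (What_zero_gt_transmit N i lam).le
  linarith

theorem IsRecontendThreshold.unique {N : Network K} {i : Fin K} {lam z z' : ℝ}
    (h : IsRecontendThreshold N i lam z) (h' : IsRecontendThreshold N i lam z') : z = z' := by
  have key : ∀ {a b : ℝ}, IsRecontendThreshold N i lam a → IsRecontendThreshold N i lam b →
      ¬ a < b := fun ha hb hab =>
    absurd ((hb.2 _ ha.1).2 hab) (not_lt.2 ((ha.2 _ ha.1).1 le_rfl))
  exact le_antisymm (not_lt.1 (key h' h)) (not_lt.1 (key h h'))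

theorem IsStopThreshold.unique {N : Network K} {i : Fin K} {lam z z' : ℝ}
    (h : IsStopThreshold N i lam z) (h' : IsStopThreshold N i lam z') : z = z' := by
  have key : ∀ {a b : ℝ}, IsStopThreshold N i lam a → IsStopThreshold N i lam b →
      ¬ a < b := fun ha hb hab =>
    absurd ((hb.2 _ ha.1).2 hab) (not_lt.2 ((ha.2 _ ha.1).1 le_rfl))
  exact le_antisymm (not_lt.1 (key h' h)) (not_lt.1 (key h h'))

/-! ### The threshold decisions -/

/-- The position of γ relative to η and ζ fixes the order of transmitting against probing and of
probing against 0. This settles the decision except where η ≤ γ < ζ. -/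
theorem ptdFirst_eq_hatFirst (N : Network K) (i : Fin K) (lam : ℝ) {γ : ℝ} (hγ : 0 ≤ γ) :
    ptdFirst lam (zeta N lam i) (eta N lam i) γ = hatFirst N lam i γ := by
  have hζ := (zeta_spec N lam i).1.2 γ hγ
  have hη := (eta_spec N lam i).1.2 γ hγ
  have hr := le_rateD_iff (lam := lam) (γ := γ) (by linarith)
  have hτ := N.τd_pos
  have hr' : lam ≤ rateD γ ↔ 0 ≤ N.τd * rateD γ - lam * N.τd := by
    constructor <;> intro h <;> nlinarith
  rw [hr] at hr'
  unfold ptdFirst hatFirst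
  simp only [max_le_iff]
  rcases le_or_gt (eta N lam i) γ with h1 | h1 <;> rcases le_or_gt (zeta N lam i) γ with h2 | h2
  · have a1 := hη.1 h1
    have a2 := hζ.1 h2
    rw [if_neg (fun h => not_lt.2 h2 h.2), if_pos h1, if_pos ⟨a1, a2.trans a1⟩]
  · have a1 := hη.1 h1
    have a2 := hζ.2 h2
    -- Probing is negative and no better than transmitting here, so only the sign of the
    -- transmission value matters; it changes at 2^λ - 1.
    rw [if_pos ⟨h1, h2⟩]
    by_cases h : (2 : ℝ) ^ lam - 1 ≤ γ
    · rw [if_pos h, if_pos ⟨a1, hr'.1 h⟩]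
    · have h3 := fun hh => h (hr'.2 hh)
      rw [if_neg h, if_neg (fun hh => h3 hh.2), if_pos ⟨not_le.1 h3, a2⟩]
  · have a1 := hη.2 h1
    have a2 := hζ.1 h2
    rw [if_neg (fun h => not_lt.2 h2 h.2), if_neg (not_le.2 h1), if_neg (not_lt.2 h2),
      if_neg (fun h => not_le.2 a1 h.1), if_neg (fun h => not_lt.2 a2 h.2)]
  · have a1 := hη.2 h1
    have a2 := hζ.2 h2
    rw [if_neg (fun h => not_le.2 h1 h.1), if_neg (not_le.2 h1), if_pos h2,
      if_neg (fun h => not_le.2 a1 h.1), if_pos ⟨a1.trans a2, a2⟩]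

theorem ptdSecond_iff_hatSecond (lam : ℝ) {γ γr : ℝ} (hγ : 0 ≤ γ) (h : 0 ≤ γr) :
    ptdSecond lam γ γr ↔ hatSecond lam γ γr := by
  unfold ptdSecond hatSecond
  rw [le_max_iff, le_max_iff, le_rateD_iff (by linarith), le_rateR_iff (by linarith)]
  refine or_congr Iff.rfl ?_
  have h2 : (0 : ℝ) < 2 ^ lam := by positivity
  have h4 : (4 : ℝ) ^ lam = (2 ^ lam) ^ 2 := by
    rw [sq, ← Real.mul_rpow (by norm_num) (by norm_num)]; norm_num
  rw [sub_le_sub_iff_right, Real.le_sqrt' h2, h4]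
  constructor <;> intro h <;> linarith

/-! ### The value of one stage -/

/-- The lower limit is moved into the indicator of a jointly measurable set, so that measurability
of parametric integrals applies. -/
theorem measurable_expIntegralE1 : Measurable expIntegralE1 := by
  have h : StronglyMeasurable (fun p : ℝ × ℝ =>
      Set.indicator {p : ℝ × ℝ | p.1 < p.2} (fun p => Real.exp (-p.2) / p.2) p) := by
    refine (StronglyMeasurable.indicator ?_ (measurableSet_lt measurable_fst measurable_snd))
    exact Measurable.stronglyMeasurable (by fun_prop)
  have h2 := (StronglyMeasurable.integral_prod_right (ν := volume) (f := fun x t : ℝ =>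
    Set.indicator {p : ℝ × ℝ | p.1 < p.2} (fun p => Real.exp (-p.2) / p.2) (x, t)) h).measurable
  convert h2 using 2 with x
  rw [expIntegralE1, ← integral_indicator measurableSet_Ioi]
  rfl

theorem measurable_What (N : Network K) (i : Fin K) (lam : ℝ) :
    Measurable (fun γ => What N i γ lam) := by
  have hΩ : Measurable (fun γ => Om γ lam) := by unfold Om; fun_prop
  have hE := measurable_expIntegralE1
  have hD := measurable_rateD
  unfold What
  refine Measurable.sub (Measurable.add (by fun_prop) (Measurable.const_mul
    (Measurable.add (Measurable.ite (measurableSet_lt measurable_const hD) ?_ ?_) ?_) _))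
    measurable_const
  all_goals fun_prop

/-- The optimal net value, at price `lam`, of the round after pair `i` has won with SNR `γ`. -/
def stageValue (N : Network K) (lam : ℝ) (i : Fin K) (γ : ℝ) : ℝ :=
  max (max (N.τd * rateD γ - lam * N.τd) (What N i γ lam)) 0

/-- The mean of `stageValue` over the SNR of the V2V link. -/
def meanStageValue (N : Network K) (lam : ℝ) (i : Fin K) : ℝ :=
  ∫ γ, stageValue N lam i γ ∂(expMeasure (N.meanV2V i)⁻¹)

theorem integrable_rateD {r : ℝ} (hr : 0 < r) : Integrable rateD (expMeasure r) := by
  refine ((integrable_id_expMeasure hr).const_mul 2).mono'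
    measurable_rateD.aestronglyMeasurable ?_
  filter_upwards [ae_pos_expMeasure r] with x hx
  rw [Real.norm_of_nonneg (rateD_nonneg hx.le)]
  exact rateD_le_two_mul hx.le

theorem integrable_transmit (N : Network K) {r : ℝ} (hr : 0 < r) (lam : ℝ) :
    Integrable (fun γ => N.τd * rateD γ - lam * N.τd) (expMeasure r) := by
  have := isProbabilityMeasure_expMeasure hr
  exact ((integrable_rateD hr).const_mul _).sub (integrable_const _)

theorem integrable_What (N : Network K) {r : ℝ} (hr : 0 < r) (lam : ℝ) (i : Fin K) :
    Integrable (fun γ => What N i γ lam) (expMeasure r) := by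
  have := isProbabilityMeasure_expMeasure hr
  refine (((integrable_rateD hr).const_mul N.τd1).add (integrable_const
    (N.τd1 * probeRate (N.c i) 0 lam + |lam * N.τd|))).mono'
    (measurable_What N i lam).aestronglyMeasurable ?_
  filter_upwards [ae_pos_expMeasure r] with x hx
  have h0 : rateD 0 = 0 := by simp [rateD]
  have h1 := mul_le_mul_of_nonneg_left
    (probeRate_sub_rateD_anti (N.c_pos i) le_rfl hx.le lam) N.τd1_pos.le
  have h2 := (rateD_nonneg hx.le).trans (rateD_le_probeRate (N.c_pos i) hx.le lam)
  have h3 := mul_nonneg N.τd1_pos.le h2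
  rw [h0] at h1
  rw [What_eq N i hx.le, Real.norm_eq_abs, abs_le, Pi.add_apply]
  have h4 := neg_abs_le (lam * N.τd)
  have h5 := le_abs_self (lam * N.τd)
  have h6 := mul_nonneg N.τd1_pos.le (rateD_nonneg hx.le)
  have h7 := mul_nonneg N.τd1_pos.le
    (h0.ge.trans (rateD_le_probeRate (N.c_pos i) le_rfl lam))
  constructor <;> linarith

theorem integrable_stageValue (N : Network K) {r : ℝ} (hr : 0 < r) (lam : ℝ) (i : Fin K) :
    Integrable (stageValue N lam i) (expMeasure r) := by
  have := isProbabilityMeasure_expMeasure hr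
  exact ((integrable_transmit N hr lam).sup (integrable_What N hr lam i)).sup (integrable_const 0)

theorem stageValue_nonneg (N : Network K) (lam : ℝ) (i : Fin K) (γ : ℝ) :
    0 ≤ stageValue N lam i γ := le_max_right _ _

/-- A price rise d costs τd d when transmitting. When probing it costs at least τ1 d, since
`probeRate` recovers at most d over the time τd1. -/
theorem stageValue_anti (N : Network K) {lam lam' : ℝ} (h : lam ≤ lam') (i : Fin K) {γ : ℝ}
    (hγ : 0 ≤ γ) : stageValue N lam' i γ ≤ stageValue N lam i γ := by
  have h1 := mul_le_mul_of_nonneg_left (probeRate_price_le (N.c_pos i) hγ h) N.τd1_pos.le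
  have h2 := mul_nonneg (sub_nonneg.2 h) N.τ1_pos.le
  have h3 := mul_nonneg (sub_nonneg.2 h) N.τd_pos.le
  have h4 := N.τd_eq
  unfold stageValue
  rw [What_eq N i hγ, What_eq N i hγ]
  refine max_le_max (max_le_max (by linarith) ?_) le_rfl
  rw [h4]; linarith

/-- No option loses more than τd per unit of price, because `probeRate` does not decrease with the
price. -/
theorem stageValue_le (N : Network K) {lam lam' : ℝ} (h : lam ≤ lam') (i : Fin K) {γ : ℝ}
    (hγ : 0 ≤ γ) : stageValue N lam i γ ≤ stageValue N lam' i γ + N.τd * (lam' - lam) := by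
  have h1 := mul_le_mul_of_nonneg_left (probeRate_price_mono (N.c_pos i) hγ h) N.τd1_pos.le
  have h3 := mul_nonneg N.τd_pos.le (sub_nonneg.2 h)
  have hl := le_max_left (max (N.τd * rateD γ - lam' * N.τd) (What N i γ lam')) 0
  have hr := le_max_right (max (N.τd * rateD γ - lam' * N.τd) (What N i γ lam')) 0
  have hl1 := (le_max_left (N.τd * rateD γ - lam' * N.τd) (What N i γ lam')).trans hl
  have hl2 := (le_max_right (N.τd * rateD γ - lam' * N.τd) (What N i γ lam')).trans hl
  unfold stageValue
  refine max_le (max_le (by linarith) ?_) (by linarith)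
  have e1 := What_eq N i hγ lam
  have e2 := What_eq N i hγ lam'
  linarith

theorem meanStageValue_anti (N : Network K) {lam lam' : ℝ} (h : lam ≤ lam') (i : Fin K) :
    meanStageValue N lam' i ≤ meanStageValue N lam i := by
  have hr := inv_pos.2 (N.meanV2V_pos i)
  refine integral_mono_ae (integrable_stageValue N hr _ i) (integrable_stageValue N hr _ i) ?_
  filter_upwards [ae_pos_expMeasure _] with γ hγ
  exact stageValue_anti N h i hγ.le

theorem meanStageValue_le (N : Network K) {lam lam' : ℝ} (h : lam ≤ lam') (i : Fin K) :
    meanStageValue N lam i ≤ meanStageValue N lam' i + N.τd * (lam' - lam) := by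
  have hr := inv_pos.2 (N.meanV2V_pos i)
  have := isProbabilityMeasure_expMeasure hr
  have key := integral_mono_ae (integrable_stageValue N hr lam i)
    ((integrable_stageValue N hr lam' i).add (integrable_const (N.τd * (lam' - lam)))) (by
      filter_upwards [ae_pos_expMeasure _] with γ hγ
      exact stageValue_le N h i hγ.le)
  rw [integral_add' (integrable_stageValue N hr lam' i) (integrable_const _)] at key
  simpa [meanStageValue] using key

theorem meanStageValue_zero_pos (N : Network K) (i : Fin K) : 0 < meanStageValue N 0 i := by
  have hr := inv_pos.2 (N.meanV2V_pos i)
  have := isProbabilityMeasure_expMeasure hr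
  refine (integral_pos_iff_support_of_nonneg (stageValue_nonneg N 0 i)
    (integrable_stageValue N hr 0 i)).2 ?_
  have h1 : ∀ᵐ γ ∂(expMeasure (N.meanV2V i)⁻¹), γ ∈ Function.support (stageValue N 0 i) := by
    filter_upwards [ae_pos_expMeasure _] with γ hγ
    have h2 : 0 < rateD γ := by
      have := rateD_lt_rateD le_rfl hγ; simpa [rateD] using this
    have h3 := mul_pos N.τd_pos h2
    have h4 := (le_max_left (N.τd * rateD γ - 0 * N.τd) (What N i γ 0)).trans (le_max_left _ 0)
    rw [Function.mem_support]
    refine ne_of_gt (lt_of_lt_of_le ?_ h4)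
    linarith
  have h5 : Function.support (stageValue N 0 i) =ᵐ[expMeasure (N.meanV2V i)⁻¹] Set.univ :=
    eventuallyEq_univ.2 h1
  rw [measure_congr h5]
  simp

theorem integral_indicator_expMeasure {r : ℝ} (hr : 0 < r) {S : Set ℝ} (hS : MeasurableSet S)
    (hS0 : S ⊆ Set.Ioi 0) (f : ℝ → ℝ) :
    ∫ x, S.indicator f x ∂(expMeasure r) = ∫ x in S, r * Real.exp (-(r * x)) * f x := by
  rw [integral_expMeasure hr, ← integral_indicator measurableSet_Ioi, ← integral_indicator hS]
  congr 1
  ext x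
  simp only [Set.indicator_apply]
  by_cases h : x ∈ S
  · simp [h, hS0 h]
  · simp [h]

/-- Transmission has value 0 exactly at g = 2^λ - 1, so the sign of `What` at g tells whether
probing is ever strictly the best option. The case split in `Lam` records this. -/
theorem Lam_eq (N : Network K) {lam : ℝ} (hlam : 0 ≤ lam) (i : Fin K) :
    Lam N lam i = meanStageValue N lam i := by
  have hσ := N.meanV2V_pos i
  have hr := inv_pos.2 hσ
  set g : ℝ := (2 : ℝ) ^ lam - 1 with hg
  have hg0 : 0 ≤ g := sub_nonneg.2 (Real.one_le_rpow (by norm_num) hlam)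
  have hrate : rateD g = lam := by
    unfold rateD; rw [hg, add_sub_cancel, Real.logb_rpow (by norm_num) (by norm_num)]
  have hexp : ∀ x, (N.meanV2V i)⁻¹ * Real.exp (-((N.meanV2V i)⁻¹ * x))
      = 1 / N.meanV2V i * Real.exp (-x / N.meanV2V i) := by
    intro x; rw [one_div, inv_mul_eq_div (N.meanV2V i) x, neg_div]
  have hζ := (zeta_spec N lam i).1
  have hη := (eta_spec N lam i).1
  have hmono := strictMonoOn_What N i lam
  have hτ := N.τd_pos
  unfold Lam meanStageValue
  split_ifs with h
  · have h1 : zeta N lam i ≤ g := by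
      by_contra hcon
      exact absurd ((hζ.2 g hg0).2 (not_le.1 hcon)) (not_lt.2 h.le)
    have h2 : g < eta N lam i := by
      by_contra hcon
      have := (hη.2 g hg0).1 (not_lt.1 hcon)
      rw [hrate] at this
      linarith
    have hle := h1.trans h2.le
    -- Since ζ ≤ g < η, the maximum is 0 up to ζ, the value of probing between ζ and η, and that of
    -- transmitting beyond η.
    have hV : ∀ᵐ x ∂(expMeasure (N.meanV2V i)⁻¹), stageValue N lam i x =
        (Set.Ioc (zeta N lam i) (eta N lam i)).indicator (fun x => What N i x lam) x
        + (Set.Ioi (eta N lam i)).indicator (fun x => N.τd * rateD x - lam * N.τd) x := by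
      filter_upwards [ae_pos_expMeasure _] with x hx
      unfold stageValue
      rcases le_or_gt x (zeta N lam i) with hx1 | hx1
      · have a1 : What N i x lam ≤ 0 := by
          rcases lt_or_eq_of_le hx1 with h3 | h3
          · exact ((hζ.2 x hx.le).2 h3).le
          · rcases le_or_gt (What N i 0 lam) 0 with h4 | h4
            · rw [h3, (zeta_spec N lam i).2.1 h4]
            · have := (zeta_spec N lam i).2.2 h4; linarith
        have a2 : rateD x ≤ lam := hrate ▸ rateD_le_rateD hx.le (hx1.trans h1)
        rw [Set.indicator_of_notMem (fun hh => not_lt.2 hx1 hh.1),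
          Set.indicator_of_notMem (Set.notMem_Ioi.2 (hx1.trans hle)), max_eq_right, add_zero]
        exact max_le (by nlinarith) a1
      · have b1 := (hζ.2 x hx.le).1 hx1.le
        rcases le_or_gt x (eta N lam i) with hx2 | hx2
        · have b2 : N.τd * rateD x - lam * N.τd ≤ What N i x lam := by
            rcases lt_or_eq_of_le hx2 with h3 | h3
            · exact ((hη.2 x hx.le).2 h3).le
            · rw [h3, (eta_spec N lam i).2]; linarith
          rw [Set.indicator_of_mem (Set.mem_Ioc.2 ⟨hx1, hx2⟩),
            Set.indicator_of_notMem (Set.notMem_Ioi.2 hx2), max_eq_right b2, max_eq_left b1,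
            add_zero]
        · have b2 := (hη.2 x hx.le).1 hx2.le
          rw [Set.indicator_of_notMem (fun hh => not_le.2 hx2 hh.2),
            Set.indicator_of_mem (Set.mem_Ioi.2 hx2),
            max_eq_left b2, max_eq_left (b1.trans b2), zero_add]
    rw [integral_congr_ae hV, integral_add
        ((integrable_What N hr lam i).indicator measurableSet_Ioc)
        ((integrable_transmit N hr lam).indicator measurableSet_Ioi),
      integral_indicator_expMeasure hr measurableSet_Ioc
        (fun x hx => hζ.1.trans_lt hx.1),
      integral_indicator_expMeasure hr measurableSet_Ioi (fun x hx => hη.1.trans_lt hx),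
      intervalIntegral.integral_of_le hle, ← integral_const_mul, ← integral_const_mul]
    congr 1
    · congr 1; ext x; rw [hexp]; ring
    · congr 1; ext x; rw [hexp]; ring
  · have hW := not_lt.1 h
    -- Now probing is at most 0 up to g. Transmission minus probing is nonnegative at g and
    -- increasing, so beyond g transmission dominates.
    have hV : ∀ᵐ x ∂(expMeasure (N.meanV2V i)⁻¹), stageValue N lam i x =
        (Set.Ioi g).indicator (fun x => N.τd * rateD x - lam * N.τd) x := by
      filter_upwards [ae_pos_expMeasure _] with x hx
      unfold stageValue
      rcases le_or_gt x g with hx1 | hx1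
      · have a1 : What N i x lam ≤ 0 := (hmono.monotoneOn hx.le hg0 hx1).trans hW
        have a2 : rateD x ≤ lam := hrate ▸ rateD_le_rateD hx.le hx1
        rw [Set.indicator_of_notMem (Set.notMem_Ioi.2 hx1), max_eq_right]
        exact max_le (by nlinarith) a1
      · have b1 := strictMonoOn_transmit_sub_What N i lam hg0 hx.le hx1
        simp only [hrate] at b1
        have b2 := mul_le_mul_of_nonneg_left (rateD_le_rateD hg0 hx1.le) hτ.le
        rw [hrate] at b2
        have b3 : What N i x lam ≤ N.τd * rateD x - lam * N.τd := by linarith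
        have b4 : 0 ≤ max (N.τd * rateD x - lam * N.τd) (What N i x lam) :=
          le_max_of_le_left (by linarith)
        rw [Set.indicator_of_mem (Set.mem_Ioi.2 hx1), max_eq_left b4,
          max_eq_left b3]
    rw [integral_congr_ae hV,
      integral_indicator_expMeasure hr measurableSet_Ioi (fun x hx => hg0.trans_lt hx),
      ← integral_const_mul]
    congr 1; ext x; rw [hexp]; ring

/-! ### The increment -/

theorem Network.pSucc_pos [NeZero K] (N : Network K) : 0 < N.pSucc := by
  have := N.p0_pos
  have := sub_pos.2 N.p0_lt_one
  have : (0 : ℝ) < K := by exact_mod_cast NeZero.pos K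
  unfold pSucc; positivity

/-- The collision probability is nonnegative: 1 - q^K = p0 (1 + q + ... + q^(K-1)) with q = 1 - p0,
and each summand is at least q^(K-1). -/
theorem Network.pSucc_le (N : Network K) : N.pSucc ≤ 1 - (1 - N.p0) ^ K := by
  have h0 := N.p0_pos
  have h1 := sub_pos.2 N.p0_lt_one
  have hg := mul_neg_geom_sum (1 - N.p0) K
  have hle : K • (1 - N.p0) ^ (K - 1) ≤ ∑ j ∈ Finset.range K, (1 - N.p0) ^ j := by
    have := Finset.card_nsmul_le_sum (Finset.range K) (fun j => (1 - N.p0) ^ j)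
      ((1 - N.p0) ^ (K - 1)) fun j hj => ?_
    · rwa [Finset.card_range] at this
    exact pow_le_pow_of_le_one h1.le (by linarith)
      (Nat.le_sub_one_of_lt (by simpa using hj))
  rw [nsmul_eq_mul] at hle
  rw [← hg, sub_sub_cancel]
  unfold pSucc
  nlinarith [mul_le_mul_of_nonneg_left hle h0.le]

theorem Network.τo_pos [NeZero K] (N : Network K) : 0 < N.τo := by
  have h1 := N.pSucc_pos
  have h2 := sub_nonneg.2 N.pSucc_le
  have h3 := sub_pos.2 N.p0_lt_one
  have := N.τR_pos
  have := N.τC_pos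
  have := N.δ_pos
  unfold τo; positivity

theorem increment_eq (N : Network K) {lam : ℝ} (hlam : 0 ≤ lam) :
    increment N lam = 1 / (K : ℝ) * ∑ i, meanStageValue N lam i - lam * N.τo := by
  unfold increment
  simp only [Lam_eq N hlam]

theorem le_increment_sub [NeZero K] (N : Network K) {lam lam' : ℝ} (h0 : 0 ≤ lam)
    (h : lam ≤ lam') : N.τo * (lam' - lam) ≤ increment N lam - increment N lam' := by
  rw [increment_eq N h0, increment_eq N (h0.trans h)]
  have h1 := Finset.sum_le_sum fun i (_ : i ∈ Finset.univ) => meanStageValue_anti N h i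
  have h2 := mul_le_mul_of_nonneg_left h1 (by positivity : (0 : ℝ) ≤ 1 / (K : ℝ))
  linarith

theorem increment_sub_le [NeZero K] (N : Network K) {lam lam' : ℝ} (h0 : 0 ≤ lam)
    (h : lam ≤ lam') :
    increment N lam - increment N lam' ≤ (N.τo + N.τd) * (lam' - lam) := by
  rw [increment_eq N h0, increment_eq N (h0.trans h)]
  have hK : (K : ℝ) ≠ 0 := by exact_mod_cast NeZero.ne K
  have h1 := Finset.sum_le_sum fun i (_ : i ∈ Finset.univ) => meanStageValue_le N h i
  have h2 := mul_le_mul_of_nonneg_left h1 (by positivity : (0 : ℝ) ≤ 1 / (K : ℝ))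
  rw [Finset.sum_add_distrib, mul_add, Finset.sum_const, Finset.card_univ, Fintype.card_fin,
    nsmul_eq_mul, ← mul_assoc (1 / (K : ℝ)), one_div_mul_cancel hK, one_mul] at h2
  linarith

/-- Positive at price 0 and falling at rate at least τo, the increment is at most 0 at b = Δ(0)/τo.
It is Lipschitz, so it vanishes in between. -/
theorem exists_increment_eq_zero [NeZero K] (N : Network K) :
    ∃ lam, 0 < lam ∧ increment N lam = 0 := by
  have hτ := N.τo_pos
  have hK : (0 : ℝ) < K := by exact_mod_cast NeZero.pos K
  have h0 : 0 < increment N 0 := by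
    rw [increment_eq N le_rfl, zero_mul, sub_zero]
    exact mul_pos (by positivity) (Finset.sum_pos (fun i _ => meanStageValue_zero_pos N i)
      Finset.univ_nonempty)
  set b := increment N 0 / N.τo
  have hb : 0 ≤ b := by positivity
  have hb1 := le_increment_sub N le_rfl hb
  rw [sub_zero, mul_div_cancel₀ _ hτ.ne'] at hb1
  have hcont : ContinuousOn (increment N) (Set.Icc 0 b) := by
    have hL : 0 ≤ N.τo + N.τd := add_nonneg hτ.le N.τd_pos.le
    refine LipschitzOnWith.continuousOn (K := ⟨_, hL⟩) (LipschitzOnWith.of_dist_le_mul ?_)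
    have key : ∀ x y, 0 ≤ x → x ≤ y →
        dist (increment N x) (increment N y) ≤ (N.τo + N.τd) * dist x y := by
      intro x y hx hxy
      have h1 := le_increment_sub N hx hxy
      have h2 := mul_nonneg hτ.le (sub_nonneg.2 hxy)
      rw [Real.dist_eq, abs_of_nonneg (by linarith), dist_comm, Real.dist_eq,
        abs_of_nonneg (sub_nonneg.2 hxy)]
      exact increment_sub_le N hx hxy
    intro x hx y hy
    rcases le_total x y with h | h
    · exact key x y hx.1 h
    · rw [dist_comm, dist_comm x]; exact key y x hy.1 h
  obtain ⟨z, hz, hz0⟩ := intermediate_value_Icc' hb hcont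
    (⟨by linarith, h0.le⟩ : (0 : ℝ) ∈ Set.Icc (increment N b) (increment N 0))
  refine ⟨z, lt_of_le_of_ne hz.1 ?_, hz0⟩
  rintro rfl
  exact h0.ne' hz0

/-! ### The iterative algorithm -/

theorem abs_sub_mul_le_abs_increment [NeZero K] (N : Network K) {L x : ℝ} (hL : 0 < L)
    (hroot : increment N L = 0) (hx : 0 ≤ x) : N.τo * |x - L| ≤ |increment N x| := by
  rcases le_total x L with h | h
  · have h1 := le_increment_sub N hx h
    rw [hroot, sub_zero] at h1
    rw [abs_of_nonpos (by linarith), neg_sub]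
    exact h1.trans (le_abs_self _)
  · have h1 := le_increment_sub N hL.le h
    rw [hroot, zero_sub] at h1
    rw [abs_of_nonneg (by linarith)]
    exact h1.trans (neg_le_abs _)

theorem abs_increment_le [NeZero K] (N : Network K) {L x : ℝ} (hL : 0 < L)
    (hroot : increment N L = 0) (hx : 0 ≤ x) :
    |increment N x| ≤ (N.τo + N.τd) * |x - L| := by
  have hτ := N.τo_pos
  rcases le_total x L with h | h
  · have h1 := le_increment_sub N hx h
    have h2 := increment_sub_le N hx h
    rw [hroot, sub_zero] at h1 h2
    have h3 := mul_nonneg hτ.le (sub_nonneg.2 h)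
    rw [abs_of_nonpos (by linarith : x - L ≤ 0), neg_sub, abs_of_nonneg (by linarith)]
    exact h2
  · have h1 := le_increment_sub N hL.le h
    have h2 := increment_sub_le N hL.le h
    rw [hroot, zero_sub] at h1 h2
    have h3 := mul_nonneg hτ.le (sub_nonneg.2 h)
    rw [abs_of_nonneg (by linarith : 0 ≤ x - L), abs_of_nonpos (by linarith)]
    exact h2

/-- With s the absolute secant slope between x and L, the new error is (1 - a s)(x - L). Since τo ≤
s ≤ τo + τd, the bounds on the step give ε τo ≤ a s ≤ 2 - ε; the two entries of the maximum are
these two ends. -/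
theorem abs_step_le [NeZero K] (N : Network K) {L x ε a : ℝ} (hL : 0 < L)
    (hroot : increment N L = 0) (hx : 0 ≤ x) (hε : 0 < ε) (ha : ε ≤ a)
    (ha' : a ≤ (2 - ε) / (N.τo + N.τd)) :
    |x + a * increment N x - L| ≤ max (1 - ε * N.τo) (1 - ε) * |x - L| := by
  have hτ := N.τo_pos
  have hb : 0 < N.τo + N.τd := add_pos hτ N.τd_pos
  rw [le_div_iff₀ hb] at ha'
  have m1 := le_max_left (1 - ε * N.τo) (1 - ε)
  have m2 := le_max_right (1 - ε * N.τo) (1 - ε)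
  set ρ := max (1 - ε * N.τo) (1 - ε)
  have ha0 : 0 ≤ a := hε.le.trans ha
  rcases le_total x L with h | h
  · have h1 := le_increment_sub N hx h
    have h2 := increment_sub_le N hx h
    rw [hroot, sub_zero] at h1 h2
    have hd := sub_nonneg.2 h
    have h3 := mul_le_mul_of_nonneg_left h1 ha0
    have h4 := mul_le_mul_of_nonneg_left h2 ha0
    have h5 := mul_le_mul_of_nonneg_right ha' hd
    have h6 := mul_le_mul_of_nonneg_right ha (mul_nonneg hτ.le hd)
    have h7 := mul_le_mul_of_nonneg_right m1 hd
    have h8 := mul_le_mul_of_nonneg_right m2 hd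
    rw [abs_of_nonpos (by linarith : x - L ≤ 0), neg_sub, abs_le]
    constructor <;> linarith
  · have h1 := le_increment_sub N hL.le h
    have h2 := increment_sub_le N hL.le h
    rw [hroot, zero_sub] at h1 h2
    have hd := sub_nonneg.2 h
    have h3 := mul_le_mul_of_nonneg_left h1 ha0
    have h4 := mul_le_mul_of_nonneg_left h2 ha0
    have h5 := mul_le_mul_of_nonneg_right ha' hd
    have h6 := mul_le_mul_of_nonneg_right ha (mul_nonneg hτ.le hd)
    have h7 := mul_le_mul_of_nonneg_right m1 hd
    have h8 := mul_le_mul_of_nonneg_right m2 hd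
    rw [abs_of_nonneg (by linarith : 0 ≤ x - L), abs_le]
    constructor <;> linarith

theorem iterate_bound [NeZero K] (N : Network K) {L ε : ℝ} {α : ℕ → ℝ} (hL : 0 < L)
    (hroot : increment N L = 0) (hε : 0 < ε)
    (hα : ∀ l, ε ≤ α l ∧ α l ≤ (2 - ε) / (N.τo + N.τd)) :
    ∃ ρ : ℝ, 0 ≤ ρ ∧ ρ < 1 ∧
      ∀ l, 0 ≤ iterate N α l ∧ |iterate N α l - L| ≤ ρ ^ l * L := by
  have hτ := N.τo_pos
  have hb : 0 < N.τo + N.τd := add_pos hτ N.τd_pos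
  have h0 := (le_div_iff₀ hb).1 ((hα 0).1.trans (hα 0).2)
  -- A negative ratio would mean ε τo > 1 and ε > 1, contradicting ε (τo + τd) ≤ 2 - ε, which holds
  -- because the range of admissible steps is nonempty.
  have hρ0 : 0 ≤ max (1 - ε * N.τo) (1 - ε) := by
    by_contra hcon
    obtain ⟨c1, c2⟩ := max_lt_iff.1 (not_le.1 hcon)
    nlinarith [mul_pos hε N.τd_pos]
  have hρ1 : max (1 - ε * N.τo) (1 - ε) < 1 :=
    max_lt (by nlinarith [mul_pos hε hτ]) (by linarith)
  refine ⟨_, hρ0, hρ1, fun l => ?_⟩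
  induction l with
  | zero => simp [iterate, abs_of_pos hL]
  | succ l ih =>
    have h1 := abs_step_le N hL hroot ih.1 hε (hα l).1 (hα l).2
    have h2 : |iterate N α (l + 1) - L| ≤ max (1 - ε * N.τo) (1 - ε) ^ (l + 1) * L := by
      refine h1.trans ?_
      rw [pow_succ']
      nlinarith [mul_le_mul_of_nonneg_left ih.2 hρ0]
    -- The initial error is L, so contraction keeps the iterates in [0, 2L]. Nonnegativity is
    -- carried along because the slope bounds require it.
    have h3 : max (1 - ε * N.τo) (1 - ε) ^ (l + 1) * L ≤ L :=
      mul_le_of_le_one_left hL.le (pow_le_one₀ hρ0 hρ1.le)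
    have h4 := (abs_le.1 (h2.trans h3)).1
    exact ⟨by linarith, h2⟩

theorem algorithm_spec [NeZero K] (N : Network K) {L ε : ℝ} {α : ℕ → ℝ} (hL : 0 < L)
    (hroot : increment N L = 0) (hε : 0 < ε)
    (hα : ∀ l, ε ≤ α l ∧ α l ≤ (2 - ε) / (N.τo + N.τd)) :
    Tendsto (iterate N α) atTop (𝓝 L) ∧
      (∃ x, IsOutput N α ε x) ∧
      (∀ x, IsOutput N α ε x → |x - L| < ε / N.τo) ∧
      ((∀ l, α l ≤ 1 / (N.τo + N.τd)) → ∀ l, 0 ≤ increment N (iterate N α l)) := by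
  have hτ := N.τo_pos
  have hb : 0 < N.τo + N.τd := add_pos hτ N.τd_pos
  obtain ⟨ρ, hρ0, hρ1, hit⟩ := iterate_bound N hL hroot hε hα
  have hlim : Tendsto (fun l => ρ ^ l * L) atTop (𝓝 0) := by
    simpa using (tendsto_pow_atTop_nhds_zero_of_lt_one hρ0 hρ1).mul_const L
  have habs : Tendsto (fun l => |iterate N α l - L|) atTop (𝓝 0) :=
    squeeze_zero (fun _ => abs_nonneg _) (fun l => (hit l).2) hlim
  refine ⟨?_, ?_, ?_, ?_⟩
  · rw [tendsto_iff_dist_tendsto_zero]; exact habs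
  · have hinc : Tendsto (fun l => |increment N (iterate N α l)|) atTop (𝓝 0) :=
      squeeze_zero (fun _ => abs_nonneg _) (fun l => abs_increment_le N hL hroot (hit l).1)
        (by simpa using habs.const_mul (N.τo + N.τd))
    have hex := (hinc.eventually_lt_const hε).exists
    classical
    exact ⟨_, Nat.find hex, rfl, Nat.find_spec hex,
      fun m hm => not_lt.1 (Nat.find_min hex hm)⟩
  · rintro x ⟨n, rfl, hn, -⟩
    rw [lt_div_iff₀ hτ, mul_comm]
    exact (abs_sub_mul_le_abs_increment N hL hroot (hit n).1).trans_lt hn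
  · intro hα1
    -- With steps at most 1/(τo + τd) the factor 1 - a s is nonnegative: the iterates never
    -- overshoot, and left of the root the increment is nonnegative.
    have hle : ∀ l, iterate N α l ≤ L := by
      intro l
      induction l with
      | zero => exact hL.le
      | succ l ih =>
        have h1 := increment_sub_le N (hit l).1 ih
        rw [hroot, sub_zero] at h1
        have h2 := mul_le_mul_of_nonneg_left h1 (hε.le.trans (hα l).1)
        have h3 := (le_div_iff₀ hb).1 (hα1 l)
        have h4 := mul_le_mul_of_nonneg_right h3 (sub_nonneg.2 ih)
        have h5 : iterate N α (l + 1)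
            = iterate N α l + α l * increment N (iterate N α l) := rfl
        linarith
    intro l
    have h1 := le_increment_sub N (hit l).1 (hle l)
    have h2 := mul_nonneg hτ.le (sub_nonneg.2 (hle l))
    linarith

/-! ### Probability measure instances -/

instance instIsProbabilityMeasureSlotLaw (N : Network K) : IsProbabilityMeasure (slotLaw N) :=
  isProbabilityMeasure_slotLaw N

instance instIsProbabilityMeasureSnrLaw (N : Network K) (i : Fin K) :
    IsProbabilityMeasure (snrLaw N i) := isProbabilityMeasure_snrLaw N i

instance instIsProbabilityMeasureRoundLaw (N : Network K) : IsProbabilityMeasure (roundLaw N) :=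
  isProbabilityMeasure_roundLaw N

instance instIsProbabilityMeasureLaw (N : Network K) : IsProbabilityMeasure (law N) :=
  isProbabilityMeasure_law N

/-! ### Sequences of independent experiments -/

/-- The sequences whose first `n` terms lie in `U`. -/
def firstIn {X : Type*} (U : Set X) (n : ℕ) : Set (ℕ → X) := {s | ∀ m < n, s m ∈ U}

theorem firstIn_eq_pi {X : Type*} (U : Set X) (n : ℕ) :
    firstIn U n = Set.pi (Finset.range n : Finset ℕ) fun _ => U := by
  ext s; simp [firstIn, Set.mem_pi]

section Sequences

variable {X : Type*} [MeasurableSpace X] (μ : Measure X) [IsProbabilityMeasure μ]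

/-- Resampling one coordinate by an independent copy does not change the product law. All uses of
independence between slots or between rounds go through this: whatever ignores coordinate `n` is
unaffected, while that coordinate becomes a separate integration variable. -/
theorem measurePreserving_update_infinitePi (n : ℕ) :
    MeasurePreserving (fun p : (ℕ → X) × X => Function.update p.1 n p.2)
      ((Measure.infinitePi fun _ : ℕ => μ).prod μ) (Measure.infinitePi fun _ : ℕ => μ) := by
  have hm : Measurable (fun p : (ℕ → X) × X => Function.update p.1 n p.2) := measurable_update'
  refine ⟨hm, Measure.eq_infinitePi _ fun s t ht => ?_⟩
  rw [Measure.map_apply hm (MeasurableSet.pi s.countable_toSet fun i _ => ht i)]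
  by_cases hn : n ∈ s
  · have : (fun p : (ℕ → X) × X => Function.update p.1 n p.2) ⁻¹' (Set.pi s t)
        = (Set.pi (s.erase n : Finset ℕ) t) ×ˢ t n := by
      ext p
      simp only [Set.mem_preimage, Set.mem_pi, Set.mem_prod, Finset.mem_coe, Finset.mem_erase]
      constructor
      · intro h
        refine ⟨fun i hi => ?_, by simpa using h n hn⟩
        simpa [Function.update_of_ne hi.1] using h i hi.2
      · rintro ⟨h1, h2⟩ i hi
        rcases eq_or_ne i n with rfl | hne
        · simpa using h2
        · simpa [Function.update_of_ne hne] using h1 i ⟨hne, hi⟩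
    rw [this, Measure.prod_prod, Measure.infinitePi_pi _ fun i _ => ht i,
      Finset.prod_erase_mul _ _ hn]
  · have : (fun p : (ℕ → X) × X => Function.update p.1 n p.2) ⁻¹' (Set.pi s t)
        = (Set.pi s t) ×ˢ Set.univ := by
      ext p
      simp only [Set.mem_preimage, Set.mem_pi, Set.mem_prod, Finset.mem_coe, Set.mem_univ, and_true]
      refine forall₂_congr fun i hi => ?_
      rw [Function.update_of_ne (show i ≠ n from fun h => hn (h ▸ hi))]
    rw [this, Measure.prod_prod, Measure.infinitePi_pi _ fun i _ => ht i, measure_univ, mul_one]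

theorem lintegral_indicator_mul_eval {A : Set (ℕ → X)} (hA : MeasurableSet A) {h : X → ENNReal}
    (hh : Measurable h) (n : ℕ) (hAn : ∀ s x, Function.update s n x ∈ A ↔ s ∈ A) :
    ∫⁻ s, A.indicator 1 s * h (s n) ∂(Measure.infinitePi fun _ : ℕ => μ)
      = (Measure.infinitePi fun _ : ℕ => μ) A * ∫⁻ x, h x ∂μ := by
  have hm1 : Measurable (A.indicator (1 : (ℕ → X) → ENNReal)) := measurable_one.indicator hA
  rw [← (measurePreserving_update_infinitePi μ n).lintegral_comp
    (f := fun s => A.indicator 1 s * h (s n)) (by fun_prop), ← lintegral_indicator_one hA,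
    ← lintegral_prod_mul (by fun_prop) (by fun_prop)]
  refine lintegral_congr fun p => ?_
  simp only [Function.update_self]
  congr 1
  by_cases hp : p.1 ∈ A
  · rw [Set.indicator_of_mem hp, Set.indicator_of_mem ((hAn _ _).2 hp)]; rfl
  · rw [Set.indicator_of_notMem hp, Set.indicator_of_notMem fun h => hp ((hAn _ _).1 h)]

theorem measurableSet_firstIn {U : Set X} (hU : MeasurableSet U) (n : ℕ) :
    MeasurableSet (firstIn U n) := by
  rw [firstIn_eq_pi]
  exact MeasurableSet.pi (Finset.countable_toSet _) fun _ _ => hU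

theorem measure_firstIn {U : Set X} (hU : MeasurableSet U) (n : ℕ) :
    (Measure.infinitePi fun _ : ℕ => μ) (firstIn U n) = μ U ^ n := by
  rw [firstIn_eq_pi, Measure.infinitePi_pi _ fun _ _ => hU]; simp

/-- Reaching trial n depends only on the earlier trials and has probability μ(U)^n; the geometric
series sums to 1/μ(Uᶜ). -/
theorem lintegral_tsum_firstIn {U : Set X} (hU : MeasurableSet U) {h : X → ENNReal}
    (hh : Measurable h) :
    ∫⁻ s, ∑' n, (firstIn U n).indicator 1 s * h (s n) ∂(Measure.infinitePi fun _ : ℕ => μ)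
      = (μ Uᶜ)⁻¹ * ∫⁻ x, h x ∂μ := by
  have hm : ∀ n, Measurable ((firstIn U n).indicator (1 : (ℕ → X) → ENNReal)) := fun n =>
    measurable_one.indicator (measurableSet_firstIn hU n)
  have hm2 : ∀ n, AEMeasurable (fun s => (firstIn U n).indicator 1 s * h (s n))
      (Measure.infinitePi fun _ : ℕ => μ) := fun n =>
    ((hm n).mul (hh.comp (measurable_pi_apply n))).aemeasurable
  rw [lintegral_tsum hm2]
  have key : ∀ n, ∫⁻ s, (firstIn U n).indicator 1 s * h (s n)
      ∂(Measure.infinitePi fun _ : ℕ => μ) = μ U ^ n * ∫⁻ x, h x ∂μ := by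
    intro n
    rw [lintegral_indicator_mul_eval μ (measurableSet_firstIn hU n) hh n, measure_firstIn μ hU]
    intro s x
    refine forall₂_congr fun m hm => ?_
    rw [Function.update_of_ne hm.ne]
  simp only [key]
  rw [ENNReal.tsum_mul_right, ENNReal.tsum_geometric, prob_compl_eq_one_sub hU]

theorem ae_exists_notMem {U : Set X} (hU : MeasurableSet U) (h : μ U < 1) :
    ∀ᵐ s ∂(Measure.infinitePi fun _ : ℕ => μ), ∃ n, s n ∉ U := by
  have h0 : (Measure.infinitePi fun _ : ℕ => μ) {s | ¬ ∃ n, s n ∉ U} = 0 := by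
    refine le_antisymm (ge_of_tendsto' (ENNReal.tendsto_pow_atTop_nhds_zero_of_lt_one h)
      fun n => ?_) zero_le
    rw [← measure_firstIn μ hU n]
    refine measure_mono fun s hs m _ => ?_
    by_contra hcon
    exact hs ⟨m, hcon⟩
  exact h0

end Sequences

theorem Measurable.apply_nat {α β : Type*} [MeasurableSpace α] [MeasurableSpace β]
    {F : ℕ → α → β} (hF : ∀ n, Measurable (F n)) {f : α → ℕ} (hf : Measurable f) :
    Measurable fun a => F (f a) a :=
  (measurable_from_prod_countable_right (f := fun p : ℕ × α => F p.1 p.2) hF).comp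
    (hf.prodMk measurable_id)

/-! ### The contention -/

/-- The slots without success. -/
def failSet (K : ℕ) : Set (Fin K → Bool) := {s | ¬ SlotSuccess s}

theorem firstSuccess_spec {s : ℕ → Fin K → Bool} (h : ∃ n, s n ∉ failSet K) :
    s (firstSuccess s) ∉ failSet K ∧ ∀ m < firstSuccess s, s m ∈ failSet K := by
  have hne : {n | SlotSuccess (s n)}.Nonempty := h.imp fun n hn => not_not.1 hn
  exact ⟨not_not.2 (Nat.sInf_mem hne), fun m hm => Nat.notMem_of_lt_sInf hm⟩

theorem mem_firstIn_failSet_iff {s : ℕ → Fin K → Bool} (h : ∃ n, s n ∉ failSet K) (n : ℕ) :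
    s ∈ firstIn (failSet K) n ↔ n ≤ firstSuccess s := by
  obtain ⟨h1, h2⟩ := firstSuccess_spec h
  constructor
  · intro hs
    by_contra hcon
    exact h1 (hs _ (not_le.1 hcon))
  · exact fun hn m hm => h2 m (hm.trans_le hn)

theorem measurable_firstSuccess : Measurable (firstSuccess (K := K)) := by
  refine measurable_to_countable' fun n => ?_
  have hs : ∀ m, MeasurableSet {s : ℕ → Fin K → Bool | SlotSuccess (s m)} := fun m =>
    (measurable_pi_apply (X := fun _ : ℕ => Fin K → Bool) m)
      (MeasurableSet.of_discrete (s := {x | SlotSuccess x}))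
  -- The second set accounts for the convention `sInf ∅ = 0`: sequences without success are sent to
  -- 0.
  have : firstSuccess (K := K) ⁻¹' {n} =
      ({s | SlotSuccess (s n)} ∩ ⋂ m ∈ Finset.range n, {s | SlotSuccess (s m)}ᶜ)
      ∪ ({s | n = 0} ∩ ⋂ m, {s | SlotSuccess (s m)}ᶜ) := by
    ext s
    simp only [Set.mem_preimage, Set.mem_singleton_iff, Set.mem_union, Set.mem_inter_iff,
      Set.mem_ofPred_eq, Set.mem_iInter, Finset.mem_range, Set.mem_compl_iff]
    by_cases h : ∃ n, s n ∉ failSet K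
    · obtain ⟨h1, h2⟩ := firstSuccess_spec h
      constructor
      · rintro rfl
        exact Or.inl ⟨not_not.1 h1, h2⟩
      · rintro (⟨h3, h4⟩ | ⟨-, h4⟩)
        · refine le_antisymm (not_lt.1 fun hlt => h2 _ hlt h3)
            (not_lt.1 fun hlt => h4 _ hlt (not_not.1 h1))
        · exact absurd (not_not.1 h1) (h4 _)
    · have hall : ∀ m, ¬ SlotSuccess (s m) := fun m hm => h ⟨m, not_not.2 hm⟩
      have h0 : firstSuccess s = 0 := by
        unfold firstSuccess
        rw [Nat.sInf_eq_zero]; right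
        ext m; simpa using hall m
      rw [h0]
      constructor
      · rintro rfl; exact Or.inr ⟨rfl, hall⟩
      · rintro (⟨h3, -⟩ | ⟨h3, -⟩)
        · exact absurd h3 (hall n)
        · exact h3.symm
  rw [this]
  refine ((hs n).inter (Finset.measurableSet_biInter _ fun m _ => (hs m).compl)).union
    (MeasurableSet.const _ |>.inter (MeasurableSet.iInter fun m => (hs m).compl))

open Classical in
/-- The source which sends alone in a slot. -/
def slotWinner [NeZero K] (s : Fin K → Bool) : Fin K :=
  if h : SlotSuccess s then h.choose else 0

theorem winner_eq [NeZero K] (s : ℕ → Fin K → Bool) :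
    winner s = slotWinner (s (firstSuccess s)) := rfl

theorem measurable_winner [NeZero K] : Measurable (winner (K := K)) := by
  simp only [funext winner_eq]
  exact Measurable.apply_nat (F := fun n (s : ℕ → Fin K → Bool) => slotWinner (s n))
    (fun n => (measurable_of_countable slotWinner).comp (measurable_pi_apply n))
    measurable_firstSuccess

open Classical in
/-- The duration of an unsuccessful slot. -/
def slotTime (N : Network K) (x : Fin K → Bool) : ℝ := if ∀ i, x i = false then N.δ else N.τR

theorem slotTime_nonneg (N : Network K) (x : Fin K → Bool) : 0 ≤ slotTime N x := by
  unfold slotTime; split_ifs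
  exacts [N.δ_pos.le, N.τR_pos.le]

theorem contentionTime_eq (N : Network K) (s : ℕ → Fin K → Bool) :
    contentionTime N s = ∑ n ∈ Finset.range (firstSuccess s), slotTime N (s n) + N.τ1 := rfl

theorem measurable_contentionTime (N : Network K) : Measurable (contentionTime N) := by
  simp only [funext (contentionTime_eq N)]
  refine (Measurable.apply_nat
    (F := fun n (s : ℕ → Fin K → Bool) => ∑ m ∈ Finset.range n, slotTime N (s m))
    (fun n => Finset.measurable_sum _ fun m _ =>
      (measurable_of_countable (slotTime N)).comp (measurable_pi_apply m))
    measurable_firstSuccess).add_const _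

theorem τ1_le_contentionTime (N : Network K) (s : ℕ → Fin K → Bool) :
    N.τ1 ≤ contentionTime N s := by
  rw [contentionTime_eq]
  exact le_add_of_nonneg_left (Finset.sum_nonneg fun n _ => slotTime_nonneg N _)

/-- The slot in which only source `i` sends. -/
def onlySends (i : Fin K) : Fin K → Bool := fun j => decide (j = i)

theorem slotSuccess_iff (x : Fin K → Bool) : SlotSuccess x ↔ ∃ i, x = onlySends i := by
  constructor
  · rintro ⟨i, hi, hu⟩
    refine ⟨i, funext fun j => ?_⟩
    rcases eq_or_ne j i with rfl | hne
    · simpa [onlySends] using hi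
    · have : x j ≠ true := fun h => hne (hu j h)
      simpa [onlySends, hne] using this
  · rintro ⟨i, rfl⟩
    exact ⟨i, by simp [onlySends], fun j hj => by simpa [onlySends] using hj⟩

theorem onlySends_injective : Function.Injective (onlySends (K := K)) := by
  intro i j h
  have := congrFun h i
  simpa [onlySends] using this

theorem slotWinner_onlySends [NeZero K] (i : Fin K) : slotWinner (onlySends i) = i := by
  have h : SlotSuccess (onlySends i) := (slotSuccess_iff _).2 ⟨i, rfl⟩
  unfold slotWinner
  rw [dif_pos h]
  exact h.unique h.choose_spec.1 (by simp [onlySends])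

theorem eq_onlySends_slotWinner [NeZero K] {x : Fin K → Bool} (h : SlotSuccess x) :
    x = onlySends (slotWinner x) := by
  obtain ⟨i, rfl⟩ := (slotSuccess_iff x).1 h
  rw [slotWinner_onlySends]

/-- Law of the RTS decisions in one slot. -/
abbrev slotsLaw (N : Network K) : Measure (Fin K → Bool) := Measure.pi fun _ : Fin K => slotLaw N

theorem slotLaw_true (N : Network K) : slotLaw N {true} = ENNReal.ofReal N.p0 := by
  have : (slotLaw N).real {true} = N.p0 := by
    unfold slotLaw
    exact bernoulliMeasure_real_apply_of_mem_of_notMem _ (measurableSet_singleton _) rfl (by simp)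
  rw [← this, ofReal_measureReal]

theorem slotLaw_false (N : Network K) : slotLaw N {false} = ENNReal.ofReal (1 - N.p0) := by
  have : (slotLaw N).real {false} = 1 - N.p0 := by
    unfold slotLaw
    exact bernoulliMeasure_real_apply_of_notMem_of_mem _ (measurableSet_singleton _) (by simp) rfl
  rw [← this, ofReal_measureReal]

theorem slotsLaw_idle (N : Network K) :
    slotsLaw N {fun _ => false} = ENNReal.ofReal ((1 - N.p0) ^ K) := by
  have := sub_pos.2 N.p0_lt_one
  rw [Measure.pi_singleton]
  simp only [slotLaw_false, Finset.prod_const, Finset.card_univ, Fintype.card_fin]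
  rw [ENNReal.ofReal_pow this.le]

theorem slotsLaw_onlySends (N : Network K) (i : Fin K) :
    slotsLaw N {onlySends i} = ENNReal.ofReal (N.p0 * (1 - N.p0) ^ (K - 1)) := by
  have := sub_pos.2 N.p0_lt_one
  rw [Measure.pi_singleton, ← Finset.mul_prod_erase _ _ (Finset.mem_univ i)]
  have h1 : slotLaw N {onlySends i i} = ENNReal.ofReal N.p0 := by
    simp [onlySends, slotLaw_true]
  have h2 : ∀ j ∈ Finset.univ.erase i, slotLaw N {onlySends i j} = ENNReal.ofReal (1 - N.p0) := by
    intro j hj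
    simp [onlySends, (Finset.mem_erase.1 hj).1, slotLaw_false]
  rw [h1, Finset.prod_congr rfl h2, Finset.prod_const, Finset.card_erase_of_mem (Finset.mem_univ i),
    Finset.card_univ, Fintype.card_fin, ENNReal.ofReal_mul N.p0_pos.le, ENNReal.ofReal_pow this.le]

theorem slotsLaw_success (N : Network K) : slotsLaw N (failSet K)ᶜ = ENNReal.ofReal N.pSucc := by
  have hset : (failSet K)ᶜ = ⋃ i ∈ (Finset.univ : Finset (Fin K)), {onlySends i} := by
    ext x
    simp [failSet, slotSuccess_iff, eq_comm]
  rw [hset, measure_biUnion_finset]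
  · simp only [slotsLaw_onlySends, Finset.sum_const, Finset.card_univ, Fintype.card_fin]
    rw [Network.pSucc, nsmul_eq_mul, mul_assoc, ENNReal.ofReal_mul (Nat.cast_nonneg K),
      ENNReal.ofReal_natCast]
  · intro i _ j _ hij
    rw [Function.onFun, Set.disjoint_singleton]
    exact fun h => hij (onlySends_injective h)
  · exact fun i _ => measurableSet_singleton _

theorem measurableSet_failSet : MeasurableSet (failSet K) := .of_discrete

theorem slotsLaw_fail_lt_one [NeZero K] (N : Network K) : slotsLaw N (failSet K) < 1 := by
  have h1 := slotsLaw_success N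
  refine lt_of_le_of_ne prob_le_one fun h => ?_
  rw [prob_compl_eq_one_sub measurableSet_failSet, h, tsub_self] at h1
  exact (ENNReal.ofReal_pos.2 N.pSucc_pos).ne h1

/-- Law of the RTS decisions in one round. -/
abbrev contentionLaw (N : Network K) : Measure (ℕ → Fin K → Bool) :=
  Measure.infinitePi fun _ : ℕ => slotsLaw N

theorem ae_exists_success [NeZero K] (N : Network K) :
    ∀ᵐ s ∂(contentionLaw N), ∃ n, s n ∉ failSet K :=
  ae_exists_notMem (slotsLaw N) measurableSet_failSet (slotsLaw_fail_lt_one N)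

/-- Winning is written as a series over slots, of which only the first successful one contributes.
The geometric sum gives p0 (1 - p0)^(K-1) / `pSucc` = 1/K. -/
theorem contentionLaw_winner [NeZero K] (N : Network K) (i : Fin K) :
    contentionLaw N (winner ⁻¹' {i}) = ENNReal.ofReal (1 / K) := by
  have hK : (0 : ℝ) < K := by exact_mod_cast NeZero.pos K
  have h1 := sub_pos.2 N.p0_lt_one
  have h0 := N.p0_pos
  rw [← lintegral_indicator_one (measurable_winner (measurableSet_singleton i))]
  have hae : ∀ᵐ s ∂(contentionLaw N), (winner ⁻¹' {i}).indicator 1 s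
      = ∑' n, (firstIn (failSet K) n).indicator (1 : (ℕ → Fin K → Bool) → ENNReal) s
        * ({onlySends i} : Set (Fin K → Bool)).indicator (1 : (Fin K → Bool) → ENNReal) (s n) := by
    filter_upwards [ae_exists_success N] with s hs
    obtain ⟨hs1, hs2⟩ := firstSuccess_spec hs
    rw [tsum_eq_single (firstSuccess s)]
    · rw [Set.indicator_of_mem ((mem_firstIn_failSet_iff hs _).2 le_rfl), Pi.one_apply, one_mul]
      have hsucc : SlotSuccess (s (firstSuccess s)) := not_not.1 hs1
      have heq := eq_onlySends_slotWinner hsucc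
      by_cases hw : winner s = i
      · rw [Set.indicator_of_mem (by exact hw), Set.indicator_of_mem]
        · rfl
        · rw [Set.mem_singleton_iff, heq, ← winner_eq, hw]
      · rw [Set.indicator_of_notMem (by exact hw), Set.indicator_of_notMem]
        rw [Set.mem_singleton_iff, heq, ← winner_eq]
        exact fun h => hw (onlySends_injective h)
    · intro n hn
      rcases lt_or_gt_of_ne hn with hlt | hgt
      · rw [Set.indicator_of_notMem (s := {onlySends i}), mul_zero]
        intro h
        exact hs2 n hlt ((slotSuccess_iff _).2 ⟨i, h⟩)
      · rw [Set.indicator_of_notMem, zero_mul]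
        rw [mem_firstIn_failSet_iff hs]; exact not_le.2 hgt
  rw [lintegral_congr_ae hae, lintegral_tsum_firstIn _ measurableSet_failSet (by fun_prop),
    lintegral_indicator_one (measurableSet_singleton _), slotsLaw_success, slotsLaw_onlySends,
    ← ENNReal.ofReal_inv_of_pos N.pSucc_pos, ← ENNReal.ofReal_mul (inv_pos.2 N.pSucc_pos).le]
  congr 1
  unfold Network.pSucc
  have : (1 - N.p0) ^ (K - 1) ≠ 0 := by positivity
  field_simp

theorem lintegral_slotTime [NeZero K] (N : Network K) :
    ∫⁻ x, (failSet K).indicator (fun x => ENNReal.ofReal (slotTime N x)) x ∂(slotsLaw N)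
      = ENNReal.ofReal ((1 - N.p0) ^ K * N.δ + (1 - (1 - N.p0) ^ K - N.pSucc) * N.τR) := by
  have h1 := sub_pos.2 N.p0_lt_one
  set I : Set (Fin K → Bool) := {fun _ => false}
  have hI : MeasurableSet I := measurableSet_singleton _
  have hIf : I ⊆ failSet K := by
    rintro x rfl ⟨i, hi, -⟩
    simp at hi
  have hsplit : ∀ x, (failSet K).indicator (fun x => ENNReal.ofReal (slotTime N x)) x
      = I.indicator (fun _ => ENNReal.ofReal N.δ) x
        + (failSet K \ I).indicator (fun _ => ENNReal.ofReal N.τR) x := by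
    intro x
    by_cases hx : x ∈ I
    · have hx' : ∀ i, x i = false := fun i => by rw [Set.mem_singleton_iff.1 hx]
      rw [Set.indicator_of_mem (hIf hx), Set.indicator_of_mem hx,
        Set.indicator_of_notMem (fun h => h.2 hx), add_zero, slotTime, if_pos hx']
    · have hx' : ¬ ∀ i, x i = false := fun h => hx (funext h)
      rw [Set.indicator_of_notMem hx, zero_add]
      by_cases hf : x ∈ failSet K
      · rw [Set.indicator_of_mem hf, Set.indicator_of_mem (Set.mem_sdiff_of_mem hf hx), slotTime,
          if_neg hx']
      · rw [Set.indicator_of_notMem hf, Set.indicator_of_notMem fun h => hf h.1]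
  have hfail : slotsLaw N (failSet K) = ENNReal.ofReal (1 - N.pSucc) := by
    have := prob_compl_eq_one_sub (μ := slotsLaw N) (measurableSet_failSet (K := K)).compl
    rw [compl_compl, slotsLaw_success] at this
    rw [this, ENNReal.ofReal_sub _ N.pSucc_pos.le, ENNReal.ofReal_one]
  have h2 := N.pSucc_le
  have h3 : (0 : ℝ) ≤ (1 - N.p0) ^ K := by positivity
  have hdiff : slotsLaw N (failSet K \ I) = ENNReal.ofReal (1 - (1 - N.p0) ^ K - N.pSucc) := by
    rw [measure_sdiff hIf hI.nullMeasurableSet (measure_ne_top _ _), hfail, slotsLaw_idle,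
      ← ENNReal.ofReal_sub _ h3]
    congr 1; ring
  simp only [hsplit]
  rw [lintegral_add_left (measurable_const.indicator hI), lintegral_indicator hI,
    lintegral_indicator (measurableSet_failSet.diff hI), setLIntegral_const, setLIntegral_const,
    slotsLaw_idle, hdiff, ← ENNReal.ofReal_mul N.δ_pos.le, ← ENNReal.ofReal_mul N.τR_pos.le,
    ← ENNReal.ofReal_add (mul_nonneg N.δ_pos.le h3)
      (mul_nonneg N.τR_pos.le (by linarith))]
  congr 1; ring

/-- The random-length sum becomes a full series of slots reached and failed, so that
`lintegral_tsum_firstIn` applies. -/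
theorem lintegral_contentionTime [NeZero K] (N : Network K) :
    ∫⁻ s, ENNReal.ofReal (contentionTime N s) ∂(contentionLaw N) = ENNReal.ofReal N.τo := by
  have hae : ∀ᵐ s ∂(contentionLaw N), ENNReal.ofReal (contentionTime N s)
      = ENNReal.ofReal N.τ1
        + ∑' n, (firstIn (failSet K) n).indicator (1 : (ℕ → Fin K → Bool) → ENNReal) s
        * (failSet K).indicator (fun x => ENNReal.ofReal (slotTime N x)) (s n) := by
    filter_upwards [ae_exists_success N] with s hs
    obtain ⟨hs1, hs2⟩ := firstSuccess_spec hs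
    rw [contentionTime_eq, add_comm, ENNReal.ofReal_add N.τ1_pos.le
      (Finset.sum_nonneg fun n _ => slotTime_nonneg N _),
      ENNReal.ofReal_sum_of_nonneg fun n _ => slotTime_nonneg N _]
    congr 1
    rw [tsum_eq_sum (s := Finset.range (firstSuccess s))]
    · refine Finset.sum_congr rfl fun n hn => ?_
      have hn := Finset.mem_range.1 hn
      rw [Set.indicator_of_mem ((mem_firstIn_failSet_iff hs _).2 hn.le), Pi.one_apply, one_mul,
        Set.indicator_of_mem (hs2 n hn)]
    · intro n hn
      rcases lt_or_eq_of_le (not_lt.1 (fun h => hn (Finset.mem_range.2 h))) with hgt | heq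
      · rw [Set.indicator_of_notMem, zero_mul]
        rw [mem_firstIn_failSet_iff hs]; exact not_le.2 hgt
      -- The successful slot is reached too, but its duration is in τ1; the indicator of `failSet`
      -- removes it from the series.
      · rw [Set.indicator_of_notMem (s := failSet K), mul_zero]
        rw [← heq]; exact hs1
  have h1 := sub_pos.2 N.p0_lt_one
  have h3 : (0 : ℝ) ≤ (1 - N.p0) ^ K := by positivity
  have h4 := mul_nonneg h3 N.δ_pos.le
  have h5 := mul_nonneg (sub_nonneg.2 N.pSucc_le) N.τR_pos.le
  have hq := N.pSucc_pos
  rw [lintegral_congr_ae hae, lintegral_add_left measurable_const,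
    lintegral_tsum_firstIn _ measurableSet_failSet (by fun_prop), lintegral_slotTime,
    slotsLaw_success, lintegral_const, measure_univ, mul_one,
    ← ENNReal.ofReal_inv_of_pos hq, ← ENNReal.ofReal_mul (inv_pos.2 hq).le,
    ← ENNReal.ofReal_add N.τ1_pos.le (mul_nonneg (inv_pos.2 hq).le (add_nonneg h4 h5))]
  congr 1
  unfold Network.τo Network.τ1
  field_simp
  ring

theorem contentionTime_nonneg (N : Network K) (s : ℕ → Fin K → Bool) : 0 ≤ contentionTime N s :=
  N.τ1_pos.le.trans (τ1_le_contentionTime N s)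

theorem integrable_contentionTime [NeZero K] (N : Network K) :
    Integrable (contentionTime N) (contentionLaw N) := by
  refine (lintegral_ofReal_ne_top_iff_integrable (measurable_contentionTime N).aestronglyMeasurable
    (Eventually.of_forall (contentionTime_nonneg N))).1 ?_
  rw [lintegral_contentionTime]
  exact ENNReal.ofReal_ne_top

theorem integral_contentionTime [NeZero K] (N : Network K) :
    ∫ s, contentionTime N s ∂(contentionLaw N) = N.τo := by
  rw [integral_eq_lintegral_of_nonneg_ae (Eventually.of_forall (contentionTime_nonneg N))
    (measurable_contentionTime N).aestronglyMeasurable, lintegral_contentionTime,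
    ENNReal.toReal_ofReal N.τo_pos.le]

theorem integral_winner [NeZero K] (N : Network K) (f : Fin K → ℝ) :
    ∫ s, f (winner s) ∂(contentionLaw N) = 1 / (K : ℝ) * ∑ i, f i := by
  have := Measure.isProbabilityMeasure_map (μ := contentionLaw N)
    (measurable_winner (K := K)).aemeasurable
  rw [← integral_map (f := f) measurable_winner.aemeasurable
    (measurable_of_countable f).aestronglyMeasurable, integral_fintype .of_finite, Finset.mul_sum]
  refine Finset.sum_congr rfl fun i _ => ?_
  rw [measureReal_def, Measure.map_apply measurable_winner (measurableSet_singleton i),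
    contentionLaw_winner, ENNReal.toReal_ofReal (by positivity), smul_eq_mul]

/-! ### Reward and cost of one round -/

open Classical in
/-- The data transmitted in a round with first decision `d` and second decision `q`. -/
def stopReward (N : Network K) (d : Decision) (q : Prop) (γ : ℝ) (p : ℝ × ℝ) : ℝ :=
  if d = Decision.transmit then N.τd * rateD γ
  else if d = Decision.probe ∧ q then N.τd1 * max (rateD γ) (rateR (relaySNR γ p))
  else 0

open Classical in
/-- The time spent after the contention in a round with first decision `d` and second
decision `q`. -/
def stopCost (N : Network K) (d : Decision) (q : Prop) : ℝ :=
  if d = Decision.transmit then N.τd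
  else if d = Decision.probe ∧ q then N.τd
  else if d = Decision.probe then N.τ1
  else 0

theorem stopCost_nonneg (N : Network K) (d : Decision) (q : Prop) : 0 ≤ stopCost N d q := by
  unfold stopCost
  split_ifs
  exacts [N.τd_pos.le, N.τd_pos.le, N.τ1_pos.le, le_rfl]

theorem stopCost_le (N : Network K) (d : Decision) (q : Prop) : stopCost N d q ≤ N.τd := by
  have h := N.probe_lt_τd.le
  unfold stopCost
  split_ifs
  exacts [le_rfl, le_rfl, h, N.τd_pos.le]

/-- A bound independent of the decisions, so that one integrable function dominates the rewards of
all strategies. -/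
theorem abs_stopReward_le (N : Network K) (d : Decision) (q : Prop) (γ : ℝ) (p : ℝ × ℝ) :
    |stopReward N d q γ p| ≤ N.τd * (|rateD γ| + |rateR (relaySNR γ p)|) := by
  have h0 := N.τd_pos
  have h1 := N.τd1_pos
  have h2 : N.τd1 ≤ N.τd := by rw [N.τd_eq]; linarith [N.τ1_pos]
  have ha := abs_nonneg (rateD γ)
  have hb := abs_nonneg (rateR (relaySNR γ p))
  unfold stopReward
  split_ifs
  · rw [abs_mul, abs_of_pos h0]
    exact mul_le_mul_of_nonneg_left (by linarith) h0.le
  · rw [abs_mul, abs_of_pos h1]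
    refine mul_le_mul h2 ?_ (abs_nonneg _) h0.le
    exact (abs_max_le_max_abs_abs).trans (max_le (by linarith) (by linarith))
  · rw [abs_zero]; positivity

theorem measurable_relaySNR : Measurable fun x : ℝ × ℝ × ℝ => relaySNR x.1 x.2 := by
  unfold relaySNR; fun_prop

section Measurability

variable {α : Type*} [MeasurableSpace α] {D : α → Decision} {q : α → Prop}

theorem measurable_stopReward (N : Network K) (hD : ∀ d, MeasurableSet {a | D a = d})
    (hq : MeasurableSet {a | q a}) {γ : α → ℝ} {p : α → ℝ × ℝ} (hγ : Measurable γ)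
    (hp : Measurable p) : Measurable fun a => stopReward N (D a) (q a) (γ a) (p a) := by
  have hr : Measurable fun a => rateR (relaySNR (γ a) (p a)) :=
    measurable_rateR.comp (measurable_relaySNR.comp (hγ.prodMk hp))
  have hd := measurable_rateD.comp hγ
  unfold stopReward
  exact Measurable.ite (hD _) (hd.const_mul _)
    (Measurable.ite ((hD _).inter hq) ((hd.max hr).const_mul _) measurable_const)

theorem measurable_stopCost (N : Network K) (hD : ∀ d, MeasurableSet {a | D a = d})
    (hq : MeasurableSet {a | q a}) : Measurable fun a => stopCost N (D a) (q a) := by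
  unfold stopCost
  exact Measurable.ite (hD _) measurable_const (Measurable.ite ((hD _).inter hq) measurable_const
    (Measurable.ite (hD _) measurable_const measurable_const))

end Measurability

/-- Net value, at price `lam`, of what follows the contention in a round. -/
def netValue (N : Network K) (lam : ℝ) (d : Decision) (q : Prop) (γ : ℝ) (p : ℝ × ℝ) : ℝ :=
  stopReward N d q γ p - lam * stopCost N d q

theorem abs_netValue_le (N : Network K) (lam : ℝ) (d : Decision) (q : Prop) (γ : ℝ) (p : ℝ × ℝ) :
    |netValue N lam d q γ p| ≤
      N.τd * (|rateD γ| + |rateR (relaySNR γ p)|) + |lam| * N.τd := by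
  have h1 : |lam * stopCost N d q| ≤ |lam| * N.τd := by
    rw [abs_mul, abs_of_nonneg (stopCost_nonneg N d q)]
    exact mul_le_mul_of_nonneg_left (stopCost_le N d q) (abs_nonneg _)
  have h2 := abs_stopReward_le N d q γ p
  exact (abs_sub _ _).trans (add_le_add h2 h1)

/-- Law of the SNRs of the two RSU links of pair `i`. -/
abbrev probeLaw (N : Network K) (i : Fin K) : Measure (ℝ × ℝ) :=
  (expMeasure (N.meanSR i)⁻¹).prod (expMeasure (N.meanRD i)⁻¹)

instance instIsProbabilityMeasureV2V (N : Network K) (i : Fin K) :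
    IsProbabilityMeasure (expMeasure (N.meanV2V i)⁻¹) :=
  isProbabilityMeasure_expMeasure (inv_pos.2 (N.meanV2V_pos i))

instance instIsProbabilityMeasureSR (N : Network K) (i : Fin K) :
    IsProbabilityMeasure (expMeasure (N.meanSR i)⁻¹) :=
  isProbabilityMeasure_expMeasure (inv_pos.2 (N.meanSR_pos i))

instance instIsProbabilityMeasureRD (N : Network K) (i : Fin K) :
    IsProbabilityMeasure (expMeasure (N.meanRD i)⁻¹) :=
  isProbabilityMeasure_expMeasure (inv_pos.2 (N.meanRD_pos i))

theorem map_min_probeLaw (N : Network K) (i : Fin K) :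
    (probeLaw N i).map (fun p => min p.1 p.2) = expMeasure (N.c i) := by
  rw [N.c_eq, map_min_expMeasure (inv_pos.2 (N.meanSR_pos i)) (inv_pos.2 (N.meanRD_pos i))]

theorem integrable_probe (N : Network K) (i : Fin K) {γ : ℝ} (hγ : 0 ≤ γ) (lam : ℝ) :
    Integrable (fun p => max (max (rateD γ) (rateR (relaySNR γ p))) lam) (probeLaw N i) := by
  have h := integrable_probeRate (N.c_pos i) hγ lam
  rw [← map_min_probeLaw N i] at h
  exact h.comp_measurable (by fun_prop)

theorem integral_probe (N : Network K) (i : Fin K) {γ : ℝ} (hγ : 0 ≤ γ) (lam : ℝ) :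
    ∫ p, (N.τd1 * max (max (rateD γ) (rateR (relaySNR γ p))) lam - lam * N.τd) ∂(probeLaw N i)
      = What N i γ lam := by
  rw [integral_sub ((integrable_probe N i hγ lam).const_mul _) (integrable_const _),
    integral_const_mul, What_eq N i hγ, probeRate, ← map_min_probeLaw N i, integral_map]
  · simp [relaySNR]
  · fun_prop
  · exact (((measurable_const.max (measurable_rateR.comp (by fun_prop))).max
      measurable_const)).aestronglyMeasurable

theorem netValue_transmit (N : Network K) (lam : ℝ) (q : Prop) (γ : ℝ) (p : ℝ × ℝ) :
    netValue N lam Decision.transmit q γ p = N.τd * rateD γ - lam * N.τd := by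
  simp [netValue, stopReward, stopCost]

theorem netValue_recontend (N : Network K) (lam : ℝ) (q : Prop) (γ : ℝ) (p : ℝ × ℝ) :
    netValue N lam Decision.recontend q γ p = 0 := by
  simp [netValue, stopReward, stopCost]

/-- Re-contending after a probe costs λ τ1, which is τd1 λ - λ τd with the sign reversed. So it
amounts to transmitting at rate λ, and the second decision is a choice between two rates. -/
theorem netValue_probe_le (N : Network K) (lam : ℝ) (q : Prop) (γ : ℝ) (p : ℝ × ℝ) :
    netValue N lam Decision.probe q γ p
      ≤ N.τd1 * max (max (rateD γ) (rateR (relaySNR γ p))) lam - lam * N.τd := by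
  have h1 := mul_le_mul_of_nonneg_left
    (le_max_left (max (rateD γ) (rateR (relaySNR γ p))) lam) N.τd1_pos.le
  have h2 := mul_le_mul_of_nonneg_left
    (le_max_right (max (rateD γ) (rateR (relaySNR γ p))) lam) N.τd1_pos.le
  have h3 := N.τd_eq
  by_cases hq : q
  · simp only [netValue, stopReward, stopCost, hq, and_self, if_true, reduceCtorEq, if_false]
    linarith
  · simp only [netValue, stopReward, stopCost, hq, and_false, if_true, reduceCtorEq, if_false]
    rw [h3]; linarith

theorem netValue_probe_hatSecond (N : Network K) (lam γ : ℝ) (p : ℝ × ℝ) :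
    netValue N lam Decision.probe (hatSecond lam γ (relaySNR γ p)) γ p
      = N.τd1 * max (max (rateD γ) (rateR (relaySNR γ p))) lam - lam * N.τd := by
  have h3 := N.τd_eq
  by_cases hq : hatSecond lam γ (relaySNR γ p)
  · simp only [netValue, stopReward, stopCost, hq, and_self, if_true, reduceCtorEq, if_false]
    rw [max_eq_left hq]
  · simp only [netValue, stopReward, stopCost, hq, and_false, if_true, reduceCtorEq, if_false]
    rw [max_eq_right (not_le.1 hq).le, h3]; ring

theorem integrable_rateR_relaySNR (N : Network K) (i : Fin K) {γ : ℝ} (hγ : 0 ≤ γ) :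
    Integrable (fun p => rateR (relaySNR γ p)) (probeLaw N i) := by
  have h := integrable_id_expMeasure (inv_pos.2 (N.meanSR_pos i))
  refine ((integrable_const γ).add (h.comp_fst (expMeasure (N.meanRD i)⁻¹))).mono'
    ((measurable_rateR.comp (measurable_relaySNR.comp
      (measurable_const.prodMk measurable_id))).aestronglyMeasurable) ?_
  have h1 : ∀ᵐ p ∂(probeLaw N i), 0 < p.1 := Measure.quasiMeasurePreserving_fst.ae
    (ae_pos_expMeasure (N.meanSR i)⁻¹)
  have h2 : ∀ᵐ p ∂(probeLaw N i), 0 < p.2 := Measure.quasiMeasurePreserving_snd.ae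
    (ae_pos_expMeasure (N.meanRD i)⁻¹)
  filter_upwards [h1, h2] with p hp1 hp2
  have h3 : 0 ≤ relaySNR γ p := add_nonneg hγ (le_min hp1.le hp2.le)
  rw [Real.norm_of_nonneg (rateR_nonneg h3)]
  refine (rateR_le_self h3).trans ?_
  exact add_le_add le_rfl (min_le_left _ _)

theorem integrable_netValue_probeLaw (N : Network K) (lam : ℝ) (i : Fin K) (d : Decision)
    {Q : ℝ × ℝ → Prop} (hQ : MeasurableSet {p | Q p}) {γ : ℝ} (hγ : 0 ≤ γ) :
    Integrable (fun p => netValue N lam d (Q p) γ p) (probeLaw N i) := by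
  have hD : ∀ d', MeasurableSet {_p : ℝ × ℝ | d = d'} := fun d' => MeasurableSet.const _
  have hB := (((integrable_const |rateD γ|).add
    (integrable_rateR_relaySNR N i hγ).abs).const_mul N.τd).add (integrable_const (|lam| * N.τd))
  refine hB.mono' ?_ (Eventually.of_forall fun p => abs_netValue_le N lam d (Q p) γ p)
  exact ((measurable_stopReward N hD hQ measurable_const measurable_id).sub
    ((measurable_stopCost N hD hQ).const_mul lam)).aestronglyMeasurable

/-- Each of the three decisions yields, or is bounded by, one of the three arguments of the maximum
in `stageValue`. -/
theorem integral_netValue_le (N : Network K) (lam : ℝ) (i : Fin K) (d : Decision)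
    {Q : ℝ × ℝ → Prop} (hQ : MeasurableSet {p | Q p}) {γ : ℝ} (hγ : 0 ≤ γ) :
    ∫ p, netValue N lam d (Q p) γ p ∂(probeLaw N i) ≤ stageValue N lam i γ := by
  rcases d with _ | _ | _
  · simp only [netValue_transmit]
    rw [integral_const, probReal_univ, one_smul]
    exact (le_max_left _ _).trans (le_max_left _ _)
  · simp only [netValue_recontend]
    simpa using stageValue_nonneg N lam i γ
  · refine (integral_mono (integrable_netValue_probeLaw N lam i _ hQ hγ)
      (((integrable_probe N i hγ lam).const_mul N.τd1).sub (integrable_const (lam * N.τd)))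
      fun p => netValue_probe_le N lam (Q p) γ p).trans ?_
    have := integral_probe N i hγ lam
    simp only [Pi.sub_apply] at this ⊢
    rw [this]
    exact (le_max_right _ _).trans (le_max_left _ _)

theorem integral_netValue_hat (N : Network K) (lam : ℝ) (i : Fin K) {γ : ℝ} (hγ : 0 ≤ γ) :
    ∫ p, netValue N lam (hatFirst N lam i γ) (hatSecond lam γ (relaySNR γ p)) γ p
      ∂(probeLaw N i) = stageValue N lam i γ := by
  unfold stageValue
  by_cases h1 : max (What N i γ lam) 0 ≤ N.τd * rateD γ - lam * N.τd
  · have hd : hatFirst N lam i γ = Decision.transmit := by unfold hatFirst; rw [if_pos h1]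
    obtain ⟨h2, h3⟩ := max_le_iff.1 h1
    simp only [hd, netValue_transmit]
    rw [max_eq_left h2, max_eq_left h3]
    simp
  · by_cases h2 : N.τd * rateD γ - lam * N.τd < 0 ∧ What N i γ lam < 0
    · have hd : hatFirst N lam i γ = Decision.recontend := by
        unfold hatFirst; rw [if_neg h1, if_pos h2]
      simp only [hd, netValue_recontend]
      rw [max_eq_right (max_le h2.1.le h2.2.le)]
      simp
    · have hd : hatFirst N lam i γ = Decision.probe := by
        unfold hatFirst; rw [if_neg h1, if_neg h2]
      simp only [hd, netValue_probe_hatSecond]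
      rw [integral_probe N i hγ lam]
      have h3 : N.τd * rateD γ - lam * N.τd ≤ What N i γ lam ∧ 0 ≤ What N i γ lam := by
        rw [max_le_iff, not_and_or, not_le, not_le] at h1
        rw [not_and_or, not_lt, not_lt] at h2
        rcases h1 with h1 | h1 <;> rcases h2 with h2 | h2 <;> constructor <;> linarith
      rw [max_eq_right h3.1, max_eq_left h3.2]

/-! ### One round -/

theorem ae_pos_snrLaw (N : Network K) (i : Fin K) :
    ∀ᵐ u ∂(snrLaw N i), 0 < u.1 ∧ 0 < u.2.1 ∧ 0 < u.2.2 := by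
  have h1 : ∀ᵐ u ∂(snrLaw N i), 0 < u.1 := Measure.quasiMeasurePreserving_fst.ae
    (ae_pos_expMeasure (N.meanV2V i)⁻¹)
  have h2 : ∀ᵐ p ∂(probeLaw N i), 0 < p.1 := Measure.quasiMeasurePreserving_fst.ae
    (ae_pos_expMeasure (N.meanSR i)⁻¹)
  have h3 : ∀ᵐ p ∂(probeLaw N i), 0 < p.2 := Measure.quasiMeasurePreserving_snd.ae
    (ae_pos_expMeasure (N.meanRD i)⁻¹)
  have h4 : ∀ᵐ u ∂(snrLaw N i), 0 < u.2.1 ∧ 0 < u.2.2 :=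
    Measure.quasiMeasurePreserving_snd.ae (h2.and h3)
  exact h1.and h4

/-- Bound on the data rates of the pair `i` in a round. -/
def rateBound (u : ℝ × ℝ × ℝ) : ℝ := |rateD u.1| + |rateR (relaySNR u.1 u.2)|

theorem rateBound_nonneg (u : ℝ × ℝ × ℝ) : 0 ≤ rateBound u := by unfold rateBound; positivity

theorem integrable_rateBound (N : Network K) (i : Fin K) :
    Integrable rateBound (snrLaw N i) := by
  have h1 := integrable_id_expMeasure (inv_pos.2 (N.meanV2V_pos i))
  have h2 := integrable_id_expMeasure (inv_pos.2 (N.meanSR_pos i))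
  have h3 : Integrable (fun u : ℝ × ℝ × ℝ => u.1) (snrLaw N i) :=
    h1.comp_fst (probeLaw N i)
  have h4 : Integrable (fun u : ℝ × ℝ × ℝ => u.2.1) (snrLaw N i) :=
    (h2.comp_fst (expMeasure (N.meanRD i)⁻¹)).comp_snd (expMeasure (N.meanV2V i)⁻¹)
  have hm : Measurable rateBound := by
    have := measurable_rateR.comp measurable_relaySNR
    exact ((measurable_rateD.comp measurable_fst).abs).add this.abs
  refine ((h3.const_mul 3).add h4).mono' hm.aestronglyMeasurable ?_
  filter_upwards [ae_pos_snrLaw N i] with u ⟨hu1, hu2, hu3⟩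
  have h5 : 0 ≤ relaySNR u.1 u.2 := add_nonneg hu1.le (le_min hu2.le hu3.le)
  rw [Real.norm_of_nonneg (rateBound_nonneg u), rateBound, abs_of_nonneg (rateD_nonneg hu1.le),
    abs_of_nonneg (rateR_nonneg h5)]
  have h6 := rateD_le_two_mul hu1.le
  have h7 : relaySNR u.1 u.2 ≤ u.1 + u.2.1 := add_le_add le_rfl (min_le_left _ _)
  have h8 := rateR_le_self h5
  simp only [Pi.add_apply]
  linarith

/-- Bound on the data rates of all pairs in a round. -/
def roundBound (r : Round K) : ℝ := ∑ i, rateBound (r.2 i)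

theorem rateBound_le_roundBound (r : Round K) (i : Fin K) : rateBound (r.2 i) ≤ roundBound r :=
  Finset.single_le_sum (f := fun i => rateBound (r.2 i)) (fun _ _ => rateBound_nonneg _)
    (Finset.mem_univ i)

theorem integrable_roundBound (N : Network K) : Integrable (roundBound (K := K)) (roundLaw N) := by
  have h : Integrable (fun x : Fin K → ℝ × ℝ × ℝ => ∑ i, rateBound (x i))
      (Measure.pi fun i => snrLaw N i) :=
    integrable_finsetSum _ fun i _ =>
      (measurePreserving_eval (fun i => snrLaw N i) i).integrable_comp_of_integrable
        (integrable_rateBound N i)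
  exact h.comp_snd _

theorem measurable_netValue (N : Network K) (lam : ℝ) {D : FirstObs K → Decision}
    {Q : FirstObs K → ℝ × ℝ → Prop} (hD : ∀ d, MeasurableSet {o | D o = d})
    (hQ : MeasurableSet {x : FirstObs K × (ℝ × ℝ) | Q x.1 x.2}) :
    Measurable fun x : FirstObs K × (ℝ × ℝ) => netValue N lam (D x.1) (Q x.1 x.2) x.1.2.2 x.2 := by
  have hD' : ∀ d, MeasurableSet {x : FirstObs K × (ℝ × ℝ) | D x.1 = d} :=
    fun d => measurable_fst (hD d)
  exact (measurable_stopReward N hD' hQ (by fun_prop) measurable_snd).sub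
    ((measurable_stopCost N hD' hQ).const_mul lam)

theorem integrable_netValue_snrLaw (N : Network K) (lam : ℝ) {D : FirstObs K → Decision}
    {Q : FirstObs K → ℝ × ℝ → Prop} (hD : ∀ d, MeasurableSet {o | D o = d})
    (hQ : MeasurableSet {x : FirstObs K × (ℝ × ℝ) | Q x.1 x.2}) (i : Fin K) (t : ℝ) :
    Integrable (fun u : ℝ × ℝ × ℝ =>
      netValue N lam (D (i, t, u.1)) (Q (i, t, u.1) u.2) u.1 u.2) (snrLaw N i) := by
  refine (((integrable_rateBound N i).const_mul N.τd).add
    (integrable_const (|lam| * N.τd))).mono' ?_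
    (Eventually.of_forall fun u => abs_netValue_le N lam _ _ _ _)
  exact ((measurable_netValue N lam hD hQ).comp (g := fun x => _)
    (f := fun u : ℝ × ℝ × ℝ => ((i, t, u.1), u.2)) (by fun_prop)).aestronglyMeasurable

/-- Fubini with the RSU links innermost, since the first decision may not depend on them. The bound
is uniform in the contention time `t`, so the joint law of winner and contention time is never
needed. -/
theorem integral_netValue_snrLaw_le (N : Network K) (lam : ℝ) {D : FirstObs K → Decision}
    {Q : FirstObs K → ℝ × ℝ → Prop} (hD : ∀ d, MeasurableSet {o | D o = d})
    (hQ : MeasurableSet {x : FirstObs K × (ℝ × ℝ) | Q x.1 x.2}) (i : Fin K) (t : ℝ) :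
    ∫ u, netValue N lam (D (i, t, u.1)) (Q (i, t, u.1) u.2) u.1 u.2 ∂(snrLaw N i)
      ≤ meanStageValue N lam i := by
  have hint := integrable_netValue_snrLaw N lam hD hQ i t
  unfold snrLaw at hint ⊢
  rw [integral_prod _ hint]
  refine integral_mono_ae hint.integral_prod_left
    (integrable_stageValue N (inv_pos.2 (N.meanV2V_pos i)) lam i) ?_
  filter_upwards [ae_pos_expMeasure _] with γ hγ
  exact integral_netValue_le N lam i _
    (measurable_prodMk_left (x := (i, t, γ)) hQ) hγ.le

theorem integral_netValue_snrLaw_eq (N : Network K) (lam : ℝ) {D : FirstObs K → Decision}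
    {Q : FirstObs K → ℝ × ℝ → Prop} (hD : ∀ d, MeasurableSet {o | D o = d})
    (hQ : MeasurableSet {x : FirstObs K × (ℝ × ℝ) | Q x.1 x.2}) (i : Fin K) (t : ℝ)
    (hD' : ∀ γ, 0 ≤ γ → D (i, t, γ) = hatFirst N lam i γ)
    (hQ' : ∀ γ p, 0 ≤ γ → 0 ≤ p.1 → 0 ≤ p.2 →
      (Q (i, t, γ) p ↔ hatSecond lam γ (relaySNR γ p))) :
    ∫ u, netValue N lam (D (i, t, u.1)) (Q (i, t, u.1) u.2) u.1 u.2 ∂(snrLaw N i)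
      = meanStageValue N lam i := by
  have hint := integrable_netValue_snrLaw N lam hD hQ i t
  unfold snrLaw at hint ⊢
  rw [integral_prod _ hint]
  refine integral_congr_ae ?_
  filter_upwards [ae_pos_expMeasure _] with γ hγ
  rw [← integral_netValue_hat N lam i hγ.le]
  refine integral_congr_ae ?_
  have h2 : ∀ᵐ p ∂(probeLaw N i), 0 < p.1 := Measure.quasiMeasurePreserving_fst.ae
    (ae_pos_expMeasure (N.meanSR i)⁻¹)
  have h3 : ∀ᵐ p ∂(probeLaw N i), 0 < p.2 := Measure.quasiMeasurePreserving_snd.ae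
    (ae_pos_expMeasure (N.meanRD i)⁻¹)
  filter_upwards [h2, h3] with p hp1 hp2
  simp only [hD' γ hγ.le, hQ' γ p hγ.le hp1.le hp2.le]

section Round

variable [NeZero K]

theorem measurable_winnerSNR :
    Measurable fun r : Round K => r.2 (winner r.1) := by
  have h : Measurable (fun p : Fin K × Round K => p.2.2 p.1) :=
    measurable_from_prod_countable_right fun i => (measurable_pi_apply i).comp measurable_snd
  exact h.comp ((measurable_winner.comp measurable_fst).prodMk measurable_id)

theorem measurable_firstObs (N : Network K) : Measurable (firstObs N) := by
  unfold firstObs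
  exact (measurable_winner.comp measurable_fst).prodMk
    (((measurable_contentionTime N).comp measurable_fst).prodMk
      (measurable_fst.comp measurable_winnerSNR))

theorem measurable_probeObs : Measurable (probeObs (K := K)) :=
  measurable_snd.comp measurable_winnerSNR

variable (N : Network K) (lam : ℝ) {D : FirstObs K → Decision} {Q : FirstObs K → ℝ × ℝ → Prop}

theorem abs_netValue_round_le (d : Decision) (q : Prop) (r : Round K) :
    |netValue N lam d q (firstObs N r).2.2 (probeObs r)|
      ≤ N.τd * roundBound r + |lam| * N.τd := by
  refine (abs_netValue_le N lam d q _ _).trans ?_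
  have := mul_le_mul_of_nonneg_left (rateBound_le_roundBound r (winner r.1)) N.τd_pos.le
  exact add_le_add this le_rfl

theorem integrable_netValue_round (hD : ∀ d, MeasurableSet {o | D o = d})
    (hQ : MeasurableSet {x : FirstObs K × (ℝ × ℝ) | Q x.1 x.2}) :
    Integrable (fun r => netValue N lam (D (firstObs N r)) (Q (firstObs N r) (probeObs r))
      (firstObs N r).2.2 (probeObs r)) (roundLaw N) := by
  refine (((integrable_roundBound N).const_mul N.τd).add
    (integrable_const (|lam| * N.τd))).mono' ?_
    (Eventually.of_forall fun r => abs_netValue_round_le N lam _ _ r)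
  exact ((measurable_netValue N lam hD hQ).comp
    ((measurable_firstObs N).prodMk measurable_probeObs)).aestronglyMeasurable

theorem integral_netValue_round (hD : ∀ d, MeasurableSet {o | D o = d})
    (hQ : MeasurableSet {x : FirstObs K × (ℝ × ℝ) | Q x.1 x.2}) :
    Integrable (fun s => ∫ u, netValue N lam (D (winner s, contentionTime N s, u.1))
        (Q (winner s, contentionTime N s, u.1) u.2) u.1 u.2 ∂(snrLaw N (winner s)))
      (contentionLaw N) ∧
    ∫ r, netValue N lam (D (firstObs N r)) (Q (firstObs N r) (probeObs r))
      (firstObs N r).2.2 (probeObs r) ∂(roundLaw N)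
    = ∫ s, ∫ u, netValue N lam (D (winner s, contentionTime N s, u.1))
        (Q (winner s, contentionTime N s, u.1) u.2) u.1 u.2 ∂(snrLaw N (winner s))
        ∂(contentionLaw N) := by
  have hint := integrable_netValue_round N lam hD hQ
  unfold roundLaw at hint ⊢
  -- Once the contention is fixed, the integrand depends on the SNRs only through the winner's
  -- coordinate, whose marginal is `snrLaw`.
  have hinner : ∀ s : ℕ → Fin K → Bool,
      ∫ x, netValue N lam (D (firstObs N (s, x))) (Q (firstObs N (s, x)) (probeObs (s, x)))
        (firstObs N (s, x)).2.2 (probeObs (s, x)) ∂(Measure.pi fun i => snrLaw N i)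
      = ∫ u, netValue N lam (D (winner s, contentionTime N s, u.1))
        (Q (winner s, contentionTime N s, u.1) u.2) u.1 u.2 ∂(snrLaw N (winner s)) := by
    intro s
    have hmp := measurePreserving_eval (fun i => snrLaw N i) (winner s)
    rw [← hmp.map_eq, integral_map hmp.measurable.aemeasurable]
    · rfl
    · rw [hmp.map_eq]
      exact (integrable_netValue_snrLaw N lam hD hQ _ _).aestronglyMeasurable
  have h1 := hint.integral_prod_left
  rw [integral_prod _ hint]
  simp only [hinner] at h1 ⊢
  exact ⟨h1, trivial⟩

theorem integrable_roundTime :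
    Integrable (fun r : Round K => (firstObs N r).2.1) (roundLaw N) :=
  (integrable_contentionTime N).comp_fst _

theorem integral_roundTime : ∫ r : Round K, (firstObs N r).2.1 ∂(roundLaw N) = N.τo := by
  rw [← integral_contentionTime N]
  have h := integral_fun_fst (μ := contentionLaw N) (ν := Measure.pi fun i => snrLaw N i)
    (contentionTime N)
  rw [probReal_univ, one_smul] at h
  exact h

theorem integral_round (hD : ∀ d, MeasurableSet {o | D o = d})
    (hQ : MeasurableSet {x : FirstObs K × (ℝ × ℝ) | Q x.1 x.2}) :
    ∫ r, (netValue N lam (D (firstObs N r)) (Q (firstObs N r) (probeObs r))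
      (firstObs N r).2.2 (probeObs r) - lam * (firstObs N r).2.1) ∂(roundLaw N)
    = ∫ s, ∫ u, netValue N lam (D (winner s, contentionTime N s, u.1))
        (Q (winner s, contentionTime N s, u.1) u.2) u.1 u.2 ∂(snrLaw N (winner s))
        ∂(contentionLaw N) - lam * N.τo := by
  rw [integral_sub (integrable_netValue_round N lam hD hQ)
    ((integrable_roundTime N).const_mul lam), integral_const_mul, integral_roundTime,
    (integral_netValue_round N lam hD hQ).2]

theorem integrable_winner (f : Fin K → ℝ) :
    Integrable (fun s => f (winner s)) (contentionLaw N) :=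
  (Integrable.of_finite (μ := (contentionLaw N).map winner) (f := f)).comp_measurable
    measurable_winner

theorem integral_round_le (hlam : 0 ≤ lam) (hD : ∀ d, MeasurableSet {o | D o = d})
    (hQ : MeasurableSet {x : FirstObs K × (ℝ × ℝ) | Q x.1 x.2}) :
    ∫ r, (netValue N lam (D (firstObs N r)) (Q (firstObs N r) (probeObs r))
      (firstObs N r).2.2 (probeObs r) - lam * (firstObs N r).2.1) ∂(roundLaw N)
    ≤ increment N lam := by
  rw [integral_round N lam hD hQ, increment_eq N hlam, ← integral_winner]
  refine sub_le_sub_right (integral_mono (integral_netValue_round N lam hD hQ).1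
    (integrable_winner N _) fun s => ?_) _
  exact integral_netValue_snrLaw_le N lam hD hQ _ _

theorem integral_round_eq (hlam : 0 ≤ lam) (hD : ∀ d, MeasurableSet {o | D o = d})
    (hQ : MeasurableSet {x : FirstObs K × (ℝ × ℝ) | Q x.1 x.2})
    (hD' : ∀ i t γ, 0 ≤ γ → D (i, t, γ) = hatFirst N lam i γ)
    (hQ' : ∀ i t γ p, 0 ≤ γ → 0 ≤ p.1 → 0 ≤ p.2 →
      (Q (i, t, γ) p ↔ hatSecond lam γ (relaySNR γ p))) :
    ∫ r, (netValue N lam (D (firstObs N r)) (Q (firstObs N r) (probeObs r))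
      (firstObs N r).2.2 (probeObs r) - lam * (firstObs N r).2.1) ∂(roundLaw N)
    = increment N lam := by
  rw [integral_round N lam hD hQ, increment_eq N hlam, ← integral_winner]
  congr 2
  ext s
  exact integral_netValue_snrLaw_eq N lam hD hQ _ _ (hD' _ _) (hQ' _ _)

end Round

theorem measurableSet_ite_eq {α β : Type*} [MeasurableSpace α] {p : α → Prop}
    [∀ a, Decidable (p a)] (hp : MeasurableSet {a | p a}) {f g : α → β} {d : β}
    (hf : MeasurableSet {a | f a = d}) (hg : MeasurableSet {a | g a = d}) :
    MeasurableSet {a | (if p a then f a else g a) = d} := by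
  have : {a | (if p a then f a else g a) = d} = {a | p a}.ite {a | f a = d} {a | g a = d} := by
    ext a
    by_cases h : p a <;> simp [Set.ite, h]
  rw [this]
  exact hp.ite hf hg

/-! ### Series of integrable functions -/

theorem integrable_of_hasSum {Ω : Type*} [MeasurableSpace Ω] {μ : Measure Ω} {φ : ℕ → Ω → ℝ}
    {Φ : Ω → ℝ} (hint : ∀ n, Integrable (φ n) μ) (hsum : Summable fun n => ∫ ω, ‖φ n ω‖ ∂μ)
    (hΦ : ∀ᵐ ω ∂μ, HasSum (fun n => φ n ω) (Φ ω)) :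
    Integrable Φ μ ∧ HasSum (fun n => ∫ ω, φ n ω ∂μ) (∫ ω, Φ ω ∂μ) := by
  constructor
  · refine ⟨aestronglyMeasurable_of_tendsto_ae atTop
      (fun n => (integrable_finsetSum (Finset.range n) fun i _ => hint i).aestronglyMeasurable)
      (hΦ.mono fun ω hω => hω.tendsto_sum_nat), ?_⟩
    have h1 : ∫⁻ ω, ∑' n, ‖φ n ω‖ₑ ∂μ < ⊤ := by
      rw [lintegral_tsum fun n => (hint n).aestronglyMeasurable.enorm]
      have h2 : ∀ n, ∫⁻ ω, ‖φ n ω‖ₑ ∂μ = ENNReal.ofReal (∫ ω, ‖φ n ω‖ ∂μ) := fun n =>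
        (ofReal_integral_norm_eq_lintegral_enorm (hint n)).symm
      simp only [h2]
      rw [← ENNReal.ofReal_tsum_of_nonneg (fun n => integral_nonneg fun ω => norm_nonneg _) hsum]
      exact ENNReal.ofReal_lt_top
    refine (lintegral_mono_ae ?_).trans_lt h1
    filter_upwards [hΦ] with ω hω
    rw [← hω.tsum_eq]
    exact enorm_tsum_le_tsum_enorm
  · have h := hasSum_integral_of_summable_integral_norm hint hsum
    rwa [integral_congr_ae (hΦ.mono fun ω hω => hω.tsum_eq)] at h

/-! ### Strategies along the rounds -/

/-- Provides the SNR region in which the strategy surely stops, hence almost sure termination. -/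
theorem hatFirst_eq_transmit (N : Network K) {lam : ℝ} (hlam : 0 ≤ lam) {i : Fin K} {γ : ℝ}
    (h1 : (2 : ℝ) ^ lam - 1 ≤ γ) (h2 : eta N lam i ≤ γ) :
    hatFirst N lam i γ = Decision.transmit := by
  have hγ : 0 ≤ γ := (sub_nonneg.2 (Real.one_le_rpow (by norm_num) hlam)).trans h1
  have h3 := mul_le_mul_of_nonneg_left ((le_rateD_iff (by linarith)).2 h1) N.τd_pos.le
  unfold hatFirst
  rw [if_pos (max_le (((eta_spec N lam i).1.2 γ hγ).1 h2) (by linarith))]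

namespace Strategy

/-- The decisions are measurable functions of the observations. -/
structure IsMeasurable (S : Strategy K) : Prop where
  first : ∀ n d, MeasurableSet {x : (Fin n → PastObs K) × FirstObs K | S.first n x.1 x.2 = d}
  second : ∀ n, MeasurableSet
    {x : (Fin n → PastObs K) × FirstObs K × (ℝ × ℝ) | S.second n x.1 x.2.1 x.2.2}

theorem IsMeasurable.measurableSet_first {S : Strategy K} (hS : S.IsMeasurable) (n : ℕ)
    (h : Fin n → PastObs K) (d : Decision) : MeasurableSet {o | S.first n h o = d} :=
  measurable_prodMk_left (x := h) (hS.first n d)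

theorem IsMeasurable.measurableSet_second {S : Strategy K} (hS : S.IsMeasurable) (n : ℕ)
    (h : Fin n → PastObs K) :
    MeasurableSet {x : FirstObs K × (ℝ × ℝ) | S.second n h x.1 x.2} :=
  measurable_prodMk_left (x := h) (hS.second n)

variable [NeZero K] (N : Network K) (S : Strategy K)

theorem Feasible.isMeasurable {N : Network K} {S : Strategy K} (h : S.Feasible N) :
    S.IsMeasurable := ⟨h.measurable_first, h.measurable_second⟩

/-- Strategies do not anticipate: the history is determined by strictly earlier rounds, so
resampling round `n` does not affect it. -/
theorem history_congr {ω ω' : ℕ → Round K} {n : ℕ} (h : ∀ m < n, ω m = ω' m) :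
    history N S ω n = history N S ω' n := by
  induction n with
  | zero => rfl
  | succ n ih =>
    have h1 := ih fun m hm => h m (hm.trans n.lt_succ_self)
    unfold history
    rw [h1, h n n.lt_succ_self]

theorem decision_congr {ω ω' : ℕ → Round K} {n : ℕ} (h : ∀ m ≤ n, ω m = ω' m) :
    decision N S ω n = decision N S ω' n := by
  unfold decision
  rw [history_congr N S fun m hm => h m hm.le, h n le_rfl]

theorem stopsAt_congr {ω ω' : ℕ → Round K} {n : ℕ} (h : ∀ m ≤ n, ω m = ω' m) :
    StopsAt N S ω n ↔ StopsAt N S ω' n := by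
  unfold StopsAt
  rw [decision_congr N S h, history_congr N S fun m hm => h m hm.le, h n le_rfl]

/-- The event that the strategy has not stopped before round `n`. -/
def alive (n : ℕ) : Set (ℕ → Round K) := {ω | ∀ m < n, ¬ StopsAt N S ω m}

theorem update_mem_alive_iff (n : ℕ) (ω : ℕ → Round K) (r : Round K) :
    Function.update ω n r ∈ alive N S n ↔ ω ∈ alive N S n := by
  refine forall₂_congr fun m hm => not_congr (stopsAt_congr N S fun l hl => ?_)
  exact Function.update_of_ne (hl.trans_lt hm).ne _ _

theorem history_update (n : ℕ) (ω : ℕ → Round K) (r : Round K) :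
    history N S (Function.update ω n r) n = history N S ω n :=
  history_congr N S fun _ hm => Function.update_of_ne hm.ne _ _

variable {S}

theorem measurable_history (hS : S.IsMeasurable) (n : ℕ) :
    Measurable fun ω => history N S ω n := by
  induction n with
  | zero => exact measurable_const
  | succ n ih =>
    have ho := (measurable_firstObs N).comp (measurable_pi_apply (X := fun _ : ℕ => Round K) n)
    have hp := (measurable_probeObs (K := K)).comp
      (measurable_pi_apply (X := fun _ : ℕ => Round K) n)
    refine measurable_pi_iff.2 fun j => ?_
    refine Fin.lastCases ?_ (fun j => ?_) j
    · simp only [history, Fin.snoc_last]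
      exact Measurable.ite ((ih.prodMk ho) (hS.first n Decision.probe))
        (ho.prodMk (measurable_const.prodMk hp)) (ho.prodMk measurable_const)
    · simp only [history, Fin.snoc_castSucc]
      exact (measurable_pi_apply j).comp ih

theorem measurableSet_decision (hS : S.IsMeasurable) (n : ℕ) (d : Decision) :
    MeasurableSet {ω | decision N S ω n = d} :=
  ((measurable_history N hS n).prodMk ((measurable_firstObs N).comp (measurable_pi_apply n)))
    (hS.first n d)

theorem measurableSet_second (hS : S.IsMeasurable) (n : ℕ) :
    MeasurableSet {ω : ℕ → Round K |
      S.second n (history N S ω n) (firstObs N (ω n)) (probeObs (ω n))} :=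
  ((measurable_history N hS n).prodMk
    (((measurable_firstObs N).comp (measurable_pi_apply n)).prodMk
      (measurable_probeObs.comp (measurable_pi_apply n)))) (hS.second n)

theorem measurableSet_stopsAt (hS : S.IsMeasurable) (n : ℕ) :
    MeasurableSet {ω | StopsAt N S ω n} :=
  (measurableSet_decision N hS n _).union
    ((measurableSet_decision N hS n _).inter (measurableSet_second N hS n))

theorem measurableSet_alive (hS : S.IsMeasurable) (n : ℕ) : MeasurableSet (alive N S n) := by
  have : alive N S n = ⋂ m ∈ Finset.range n, {ω | StopsAt N S ω m}ᶜ := by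
    ext ω; simp [alive]
  rw [this]
  exact Finset.measurableSet_biInter _ fun m _ => (measurableSet_stopsAt N hS m).compl

variable (S)

/-- The data transmitted in round `n`, if the strategy has not stopped earlier. -/
def roundReward (n : ℕ) (ω : ℕ → Round K) : ℝ :=
  stopReward N (decision N S ω n)
    (S.second n (history N S ω n) (firstObs N (ω n)) (probeObs (ω n)))
    (firstObs N (ω n)).2.2 (probeObs (ω n))

/-- The time spent in round `n`, if the strategy has not stopped earlier. -/
def roundCost (n : ℕ) (ω : ℕ → Round K) : ℝ :=
  (firstObs N (ω n)).2.1 + stopCost N (decision N S ω n)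
    (S.second n (history N S ω n) (firstObs N (ω n)) (probeObs (ω n)))

variable {S}

theorem measurable_roundReward (hS : S.IsMeasurable) (n : ℕ) :
    Measurable (roundReward N S n) :=
  measurable_stopReward N (measurableSet_decision N hS n) (measurableSet_second N hS n)
    (((measurable_snd.comp measurable_snd).comp (measurable_firstObs N)).comp
      (measurable_pi_apply n)) (measurable_probeObs.comp (measurable_pi_apply n))

theorem measurable_roundCost (hS : S.IsMeasurable) (n : ℕ) :
    Measurable (roundCost N S n) :=
  (((measurable_fst.comp measurable_snd).comp (measurable_firstObs N)).comp
      (measurable_pi_apply n)).add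
    (measurable_stopCost N (measurableSet_decision N hS n) (measurableSet_second N hS n))

variable (S)

theorem abs_roundReward_le (n : ℕ) (ω : ℕ → Round K) :
    |roundReward N S n ω| ≤ N.τd * roundBound (ω n) :=
  (abs_stopReward_le N _ _ _ _).trans
    (mul_le_mul_of_nonneg_left (rateBound_le_roundBound (ω n) (winner (ω n).1)) N.τd_pos.le)

theorem roundCost_nonneg (n : ℕ) (ω : ℕ → Round K) : 0 ≤ roundCost N S n ω :=
  add_nonneg (contentionTime_nonneg N _) (stopCost_nonneg N _ _)

theorem abs_roundCost_le (n : ℕ) (ω : ℕ → Round K) :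
    |roundCost N S n ω| ≤ (firstObs N (ω n)).2.1 + N.τd := by
  rw [abs_of_nonneg (roundCost_nonneg N S n ω)]
  exact add_le_add le_rfl (stopCost_le N _ _)

variable {S}

theorem stopRound_spec {ω : ℕ → Round K} (h : ∃ n, StopsAt N S ω n) :
    StopsAt N S ω (stopRound N S ω) ∧ ∀ m < stopRound N S ω, ¬ StopsAt N S ω m :=
  ⟨Nat.sInf_mem (s := {n | StopsAt N S ω n}) h, fun _ hm => Nat.notMem_of_lt_sInf hm⟩

theorem mem_alive_iff {ω : ℕ → Round K} (h : ∃ n, StopsAt N S ω n) (n : ℕ) :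
    ω ∈ alive N S n ↔ n ≤ stopRound N S ω := by
  obtain ⟨h1, h2⟩ := stopRound_spec N h
  exact ⟨fun hs => not_lt.1 fun hcon => hs _ hcon h1, fun hn m hm => h2 m (hm.trans_le hn)⟩

/-- Turns a sum up to the random last round, itself included, into a series over all rounds whose
terms can be integrated separately. -/
theorem hasSum_alive {ω : ℕ → Round K} (h : ∃ n, StopsAt N S ω n)
    (f : ℕ → (ℕ → Round K) → ℝ) :
    HasSum (fun n => (alive N S n).indicator (f n) ω)
      (∑ n ∈ Finset.range (stopRound N S ω + 1), f n ω) := by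
  have h1 : ∑ n ∈ Finset.range (stopRound N S ω + 1), f n ω
      = ∑ n ∈ Finset.range (stopRound N S ω + 1), (alive N S n).indicator (f n) ω := by
    refine Finset.sum_congr rfl fun n hn => ?_
    rw [Set.indicator_of_mem ((mem_alive_iff N h n).2 (Nat.lt_succ_iff.1 (Finset.mem_range.1 hn)))]
  rw [h1]
  refine hasSum_sum_of_ne_finset_zero fun n hn => ?_
  refine Set.indicator_of_notMem (fun hcon => hn ?_) _
  exact Finset.mem_range.2 (Nat.lt_succ_iff.2 ((mem_alive_iff N h n).1 hcon))

theorem sum_roundReward {ω : ℕ → Round K} (h : ∃ n, StopsAt N S ω n) :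
    ∑ n ∈ Finset.range (stopRound N S ω + 1), roundReward N S n ω = reward N S ω := by
  obtain ⟨h1, h2⟩ := stopRound_spec N h
  rw [Finset.sum_range_succ, Finset.sum_eq_zero, zero_add]
  · unfold roundReward stopReward reward
    rcases h1 with h1 | ⟨h1, h3⟩
    · simp only [h1, if_true]
    · simp only [h1, h3, reduceCtorEq, if_false, and_self, if_true]
  · intro n hn
    have h3 := h2 n (Finset.mem_range.1 hn)
    unfold StopsAt at h3
    rw [not_or] at h3
    unfold roundReward stopReward
    rw [if_neg h3.1, if_neg h3.2]

theorem sum_roundCost {ω : ℕ → Round K} (h : ∃ n, StopsAt N S ω n) :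
    ∑ n ∈ Finset.range (stopRound N S ω + 1), roundCost N S n ω = cost N S ω := by
  obtain ⟨h1, h2⟩ := stopRound_spec N h
  unfold roundCost cost
  rw [Finset.sum_add_distrib, Finset.sum_range_succ (fun n => stopCost N _ _), ← add_assoc]
  congr 1
  · congr 1
    -- Before the last round both stopping branches are excluded, leaving τ1 for a probing and 0
    -- otherwise.
    refine Finset.sum_congr rfl fun n hn => ?_
    have h3 := h2 n (Finset.mem_range.1 hn)
    unfold StopsAt at h3
    rw [not_or] at h3
    unfold stopCost
    rw [if_neg h3.1, if_neg h3.2]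
  · unfold stopCost
    rcases h1 with h1 | ⟨h1, h3⟩
    · rw [if_pos h1]
    · rw [if_neg (by rw [h1]; simp), if_pos ⟨h1, h3⟩]

/-! ### Wald's identity -/

section Wald

variable (hS : S.IsMeasurable)
include hS

theorem integral_alive_mul (n : ℕ) {G : Round K → ℝ} (hG : Integrable G (roundLaw N)) :
    Integrable (fun ω => (alive N S n).indicator (fun ω => G (ω n)) ω) (law N) ∧
    ∫ ω, (alive N S n).indicator (fun ω => G (ω n)) ω ∂(law N)
      = (law N).real (alive N S n) * ∫ r, G r ∂(roundLaw N) := by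
  have hA := measurableSet_alive N hS n
  have hev : Integrable (fun ω : ℕ → Round K => G (ω n)) (law N) :=
    (measurePreserving_eval_infinitePi (fun _ : ℕ => roundLaw N) n).integrable_comp_of_integrable hG
  have hint := hev.indicator hA
  refine ⟨hint, ?_⟩
  have hmp := measurePreserving_update_infinitePi (roundLaw N) n
  have h1 : ∫ ω, (alive N S n).indicator (fun ω => G (ω n)) ω ∂(law N)
      = ∫ p : (ℕ → Round K) × Round K, (alive N S n).indicator (1 : (ℕ → Round K) → ℝ) p.1 * G p.2
          ∂((law N).prod (roundLaw N)) := by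
    have h2 := hmp.map_eq
    change _ = law N at h2
    conv_lhs => rw [← h2]
    rw [integral_map hmp.measurable.aemeasurable (by rw [h2]; exact hint.aestronglyMeasurable)]
    refine integral_congr_ae (Eventually.of_forall fun p => ?_)
    by_cases hp : p.1 ∈ alive N S n
    · simp only [Set.indicator_of_mem hp,
        Set.indicator_of_mem ((update_mem_alive_iff N S n p.1 p.2).2 hp), Function.update_self,
        Pi.one_apply, one_mul]
    · simp only [Set.indicator_of_notMem hp, Set.indicator_of_notMem
        (fun h => hp ((update_mem_alive_iff N S n p.1 p.2).1 h)), zero_mul]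
  rw [h1, integral_prod_mul, integral_indicator_one hA]

/-- Conditioning on the past without conditional expectations: round `n` is resampled, survival and
history stay frozen, and the inner integral over the fresh round is at most `b` for every history.
-/
theorem integral_alive_le (n : ℕ) {F : (ℕ → Round K) → ℝ} {f : (Fin n → PastObs K) → Round K → ℝ}
    (hF : Integrable F (law N)) (hFf : ∀ ω, F ω = f (history N S ω n) (ω n)) {b : ℝ}
    (hb : ∀ h, ∫ r, f h r ∂(roundLaw N) ≤ b) :
    ∫ ω, (alive N S n).indicator F ω ∂(law N) ≤ (law N).real (alive N S n) * b := by
  have hA := measurableSet_alive N hS n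
  have hint := hF.indicator hA
  have hmp := measurePreserving_update_infinitePi (roundLaw N) n
  have h2 := hmp.map_eq
  change _ = law N at h2
  have hpt : ∀ p : (ℕ → Round K) × Round K,
      (alive N S n).indicator F (Function.update p.1 n p.2)
      = (alive N S n).indicator (fun ω => f (history N S ω n) p.2) p.1 := by
    intro p
    by_cases hp : p.1 ∈ alive N S n
    · rw [Set.indicator_of_mem hp,
        Set.indicator_of_mem ((update_mem_alive_iff N S n p.1 p.2).2 hp), hFf, history_update,
        Function.update_self]
    · rw [Set.indicator_of_notMem hp, Set.indicator_of_notMem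
        (fun h => hp ((update_mem_alive_iff N S n p.1 p.2).1 h))]
  have hint2 : Integrable (fun p : (ℕ → Round K) × Round K =>
      (alive N S n).indicator (fun ω => f (history N S ω n) p.2) p.1)
      ((law N).prod (roundLaw N)) := by
    have h3 := hmp.integrable_comp_of_integrable hint
    refine h3.congr (Eventually.of_forall fun p => hpt p)
  have h1 : ∫ ω, (alive N S n).indicator F ω ∂(law N)
      = ∫ ω, ∫ r, (alive N S n).indicator (fun ω => f (history N S ω n) r) ω ∂(roundLaw N)
          ∂(law N) := by
    conv_lhs => rw [← h2]
    rw [integral_map hmp.measurable.aemeasurable (by rw [h2]; exact hint.aestronglyMeasurable)]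
    simp only [hpt]
    exact integral_prod _ hint2
  have h4 : ∫ ω, (alive N S n).indicator (fun _ => b) ω ∂(law N)
      = (law N).real (alive N S n) * b := by
    rw [integral_indicator hA, setIntegral_const, smul_eq_mul]
  rw [h1, ← h4]
  refine integral_mono hint2.integral_prod_left ((integrable_const b).indicator hA) fun ω => ?_
  by_cases hω : ω ∈ alive N S n
  · simp only [Set.indicator_of_mem hω]; exact hb _
  · simp only [Set.indicator_of_notMem hω, integral_zero]; exact le_rfl

theorem integral_alive_eq (n : ℕ) {F : (ℕ → Round K) → ℝ} {f : (Fin n → PastObs K) → Round K → ℝ}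
    (hF : Integrable F (law N)) (hFf : ∀ ω, F ω = f (history N S ω n) (ω n)) {b : ℝ}
    (hb : ∀ h, ∫ r, f h r ∂(roundLaw N) = b) :
    ∫ ω, (alive N S n).indicator F ω ∂(law N) = (law N).real (alive N S n) * b := by
  refine le_antisymm (integral_alive_le N hS n hF hFf fun h => (hb h).le) ?_
  have h1 := integral_alive_le N hS n (F := -F) (f := fun h r => -f h r) (b := -b) hF.neg
    (fun ω => by rw [Pi.neg_apply, hFf]) (fun h => by rw [integral_neg, hb h])
  rw [Set.indicator_neg', mul_neg] at h1
  simp only [Pi.neg_apply, integral_neg] at h1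
  linarith

theorem integrable_roundReward (n : ℕ) : Integrable (roundReward N S n) (law N) :=
  ((measurePreserving_eval_infinitePi (fun _ : ℕ => roundLaw N) n).integrable_comp_of_integrable
    ((integrable_roundBound N).const_mul N.τd)).mono'
    (measurable_roundReward N hS n).aestronglyMeasurable
    (Eventually.of_forall (abs_roundReward_le N S n))

theorem integrable_roundCost (n : ℕ) : Integrable (roundCost N S n) (law N) :=
  ((measurePreserving_eval_infinitePi (fun _ : ℕ => roundLaw N) n).integrable_comp_of_integrable
    ((integrable_roundTime N).add (integrable_const N.τd))).mono'
    (measurable_roundCost N hS n).aestronglyMeasurable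
    (Eventually.of_forall (abs_roundCost_le N S n))

/-- Survival to round n is independent of that round, so the n-th term has mean absolute value at
most P(alive) E[G]. A finite expected number of rounds then permits integration term by term. -/
theorem wald (hsum : Summable fun n => (law N).real (alive N S n))
    {φ : ℕ → (ℕ → Round K) → ℝ} {Φ : (ℕ → Round K) → ℝ} {G : Round K → ℝ}
    (hφ : ∀ n, Integrable (φ n) (law N)) (hG : Integrable G (roundLaw N))
    (hle : ∀ n ω, |φ n ω| ≤ G (ω n))
    (hΦ : ∀ᵐ ω ∂(law N), HasSum (fun n => (alive N S n).indicator (φ n) ω) (Φ ω)) :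
    Integrable Φ (law N) ∧
      HasSum (fun n => ∫ ω, (alive N S n).indicator (φ n) ω ∂(law N)) (∫ ω, Φ ω ∂(law N)) := by
  refine integrable_of_hasSum (fun n => (hφ n).indicator (measurableSet_alive N hS n)) ?_ hΦ
  refine Summable.of_nonneg_of_le (fun n => integral_nonneg fun ω => norm_nonneg _)
    (fun n => ?_) (hsum.mul_right (∫ r, G r ∂(roundLaw N)))
  obtain ⟨h1, h2⟩ := integral_alive_mul N hS n hG
  rw [← h2]
  refine integral_mono ((hφ n).indicator (measurableSet_alive N hS n)).norm h1 fun ω => ?_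
  rw [norm_indicator_eq_indicator_norm]
  exact Set.indicator_le_indicator (hle n ω)

theorem wald_reward (hends : ∀ᵐ ω ∂(law N), ∃ n, StopsAt N S ω n)
    (hsum : Summable fun n => (law N).real (alive N S n)) :
    Integrable (reward N S) (law N) ∧
      HasSum (fun n => ∫ ω, (alive N S n).indicator (roundReward N S n) ω ∂(law N))
        (∫ ω, reward N S ω ∂(law N)) :=
  wald N hS hsum (integrable_roundReward N hS) ((integrable_roundBound N).const_mul N.τd)
    (abs_roundReward_le N S)
    (hends.mono fun _ hω => sum_roundReward N hω ▸ hasSum_alive N hω (roundReward N S))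

theorem wald_cost (hends : ∀ᵐ ω ∂(law N), ∃ n, StopsAt N S ω n)
    (hsum : Summable fun n => (law N).real (alive N S n)) :
    Integrable (cost N S) (law N) ∧
      HasSum (fun n => ∫ ω, (alive N S n).indicator (roundCost N S n) ω ∂(law N))
        (∫ ω, cost N S ω ∂(law N)) :=
  wald N hS hsum (integrable_roundCost N hS) ((integrable_roundTime N).add (integrable_const N.τd))
    (abs_roundCost_le N S)
    (hends.mono fun _ hω => sum_roundCost N hω ▸ hasSum_alive N hω (roundCost N S))

theorem hasSum_net (hends : ∀ᵐ ω ∂(law N), ∃ n, StopsAt N S ω n)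
    (hsum : Summable fun n => (law N).real (alive N S n)) (lam : ℝ) :
    HasSum (fun n => ∫ ω, (alive N S n).indicator
        (fun ω => roundReward N S n ω - lam * roundCost N S n ω) ω ∂(law N))
      (∫ ω, reward N S ω ∂(law N) - lam * ∫ ω, cost N S ω ∂(law N)) := by
  have h := (wald_reward N hS hends hsum).2.sub ((wald_cost N hS hends hsum).2.mul_left lam)
  have key : ∀ n, ∫ ω, (alive N S n).indicator
        (fun ω => roundReward N S n ω - lam * roundCost N S n ω) ω ∂(law N)
      = ∫ ω, (alive N S n).indicator (roundReward N S n) ω ∂(law N)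
        - lam * ∫ ω, (alive N S n).indicator (roundCost N S n) ω ∂(law N) := fun n => ?_
  · simp only [key]
    exact h
  rw [← integral_const_mul, ← integral_sub ((integrable_roundReward N hS n).indicator
    (measurableSet_alive N hS n)) (((integrable_roundCost N hS n).indicator
    (measurableSet_alive N hS n)).const_mul lam)]
  refine integral_congr_ae (Eventually.of_forall fun ω => ?_)
  by_cases hω : ω ∈ alive N S n
  · simp only [Set.indicator_of_mem hω]
  · simp only [Set.indicator_of_notMem hω, mul_zero, sub_zero]

theorem integrable_net (lam : ℝ) (n : ℕ) :
    Integrable (fun ω => roundReward N S n ω - lam * roundCost N S n ω) (law N) :=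
  (integrable_roundReward N hS n).sub ((integrable_roundCost N hS n).const_mul lam)

end Wald

/-! ### The maximal throughput -/

variable {N}

theorem net_eq (lam : ℝ) (n : ℕ) (ω : ℕ → Round K) :
    roundReward N S n ω - lam * roundCost N S n ω
      = netValue N lam (S.first n (history N S ω n) (firstObs N (ω n)))
          (S.second n (history N S ω n) (firstObs N (ω n)) (probeObs (ω n)))
          (firstObs N (ω n)).2.2 (probeObs (ω n)) - lam * (firstObs N (ω n)).2.1 := by
  unfold roundReward roundCost netValue decision
  ring

theorem le_cost (ω : ℕ → Round K) : N.τd ≤ cost N S ω := by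
  unfold cost
  refine le_add_of_nonneg_left (add_nonneg
    (Finset.sum_nonneg fun _ _ => contentionTime_nonneg N _) (Finset.sum_nonneg fun _ _ => ?_))
  split_ifs
  exacts [N.τ1_pos.le, le_rfl]

theorem integral_cost_pos (h : Integrable (cost N S) (law N)) : 0 < ∫ ω, cost N S ω ∂(law N) := by
  have h1 := integral_mono (integrable_const N.τd) h (fun ω => le_cost (S := S) ω)
  rw [integral_const, probReal_univ, one_smul] at h1
  exact N.τd_pos.trans_le h1

/-- Each round reached takes at least τ1 for its contention, so τ1 times the expected number of
rounds is at most the expected cost. -/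
theorem Feasible.summable_alive (h : S.Feasible N) :
    Summable fun n => (law N).real (alive N S n) := by
  have hS := h.isMeasurable
  have hτ := N.τ1_pos
  rw [← summable_mul_right_iff hτ.ne']
  refine summable_of_sum_range_le (c := ∫ ω, cost N S ω ∂(law N))
    (fun n => mul_nonneg measureReal_nonneg hτ.le) fun M => ?_
  have h1 : ∀ n, (law N).real (alive N S n) * N.τ1
      = ∫ ω, (alive N S n).indicator (fun _ => N.τ1) ω ∂(law N) := fun n => by
    rw [integral_indicator (measurableSet_alive N hS n), setIntegral_const, smul_eq_mul]
  have h2 : ∀ n, Integrable (fun ω => (alive N S n).indicator (fun _ => N.τ1) ω) (law N) :=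
    fun n => (integrable_const _).indicator (measurableSet_alive N hS n)
  simp only [h1]
  rw [← integral_finsetSum _ fun n _ => h2 n]
  refine integral_mono_ae (integrable_finsetSum _ fun n _ => h2 n) h.integrable_cost ?_
  filter_upwards [h.stops] with ω hω
  have h3 := hasSum_alive N hω fun _ _ => N.τ1
  rw [← sum_roundCost N hω]
  refine (sum_le_hasSum _ (fun n _ => Set.indicator_nonneg (fun _ _ => hτ.le) _) h3).trans ?_
  refine Finset.sum_le_sum fun n _ => ?_
  exact (τ1_le_contentionTime N _).trans (le_add_of_nonneg_right (stopCost_nonneg N _ _))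

theorem Feasible.integrable_reward (h : S.Feasible N) : Integrable (reward N S) (law N) :=
  (wald_reward N h.isMeasurable h.stops h.summable_alive).1

/-- At the root price every round reached has nonpositive mean net value, hence so has the whole
transmission. -/
theorem Feasible.throughput_le (h : S.Feasible N) {lam : ℝ} (hlam : 0 ≤ lam)
    (hroot : increment N lam = 0) : throughput N S ≤ lam := by
  have hS := h.isMeasurable
  have h1 := hasSum_net N hS h.stops h.summable_alive lam
  have h2 : ∫ ω, reward N S ω ∂(law N) - lam * ∫ ω, cost N S ω ∂(law N) ≤ 0 := by
    refine h1.nonpos fun n => ?_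
    have h3 := integral_alive_le N hS n (integrable_net N hS lam n) (net_eq lam n)
      fun hist => integral_round_le N lam hlam (hS.measurableSet_first n hist)
        (hS.measurableSet_second n hist)
    rwa [hroot, mul_zero] at h3
  unfold throughput
  rw [div_le_iff₀ (integral_cost_pos h.integrable_cost)]
  linarith

variable (N) in
/-- The decisions of `S` are those of the strategy built on the closed form at price `lam`, up to
null events. -/
structure AgreesWithHat (S : Strategy K) (lam : ℝ) : Prop where
  isMeasurable : S.IsMeasurable
  first : ∀ n h i t γ, 0 ≤ γ → S.first n h (i, t, γ) = hatFirst N lam i γ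
  second : ∀ n h i t γ p, 0 ≤ γ → 0 ≤ p.1 → 0 ≤ p.2 →
    (S.second n h (i, t, γ) p ↔ hatSecond lam γ (relaySNR γ p))

/-- The rounds in which the SNR of the winner exceeds `b`. -/
def winnerAbove (b : ℝ) : Set (Round K) := {r | b < (r.2 (winner r.1)).1}

theorem measurableSet_winnerAbove (b : ℝ) : MeasurableSet (winnerAbove (K := K) b) :=
  measurableSet_lt measurable_const (measurable_fst.comp measurable_winnerSNR)

variable (N) in
theorem winnerAbove_compl_lt_one {b : ℝ} (hb : 0 ≤ b) :
    roundLaw N (winnerAbove b)ᶜ < 1 := by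
  have h1 : 0 < roundLaw N (winnerAbove b) := by
    -- Asking all V2V SNRs to exceed `b` avoids knowing who wins and leaves a product set of
    -- positive measure.
    have hsub : (Set.univ : Set (ℕ → Fin K → Bool)) ×ˢ
        (Set.pi Set.univ fun _ : Fin K => Set.Ioi b ×ˢ (Set.univ : Set (ℝ × ℝ)))
        ⊆ winnerAbove b := by
      intro r hr
      exact (hr.2 (winner r.1) trivial).1
    refine lt_of_lt_of_le ?_ (measure_mono hsub)
    rw [roundLaw, Measure.prod_prod, measure_univ, one_mul, Measure.pi_pi]
    refine CanonicallyOrderedAdd.prod_pos.2 fun i _ => ?_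
    rw [snrLaw, Measure.prod_prod, measure_univ, mul_one,
      expMeasure_Ioi (inv_pos.2 (N.meanV2V_pos i)) hb]
    exact ENNReal.ofReal_pos.2 (Real.exp_pos _)
  rw [prob_compl_eq_one_sub (measurableSet_winnerAbove b)]
  exact ENNReal.sub_lt_self ENNReal.one_ne_top one_ne_zero h1.ne'

theorem AgreesWithHat.exists_measure_alive_le {lam : ℝ} (h : AgreesWithHat N S lam)
    (hlam : 0 ≤ lam) : ∃ ρ : ENNReal, ρ < 1 ∧ ∀ n, law N (alive N S n) ≤ ρ ^ n := by
  have hη : ∀ i, 0 ≤ eta N lam i := fun i => (eta_spec N lam i).1.1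
  have hg : 0 ≤ (2 : ℝ) ^ lam - 1 := sub_nonneg.2 (Real.one_le_rpow (by norm_num) hlam)
  have hsum : 0 ≤ ∑ i, eta N lam i := Finset.sum_nonneg fun i _ => hη i
  -- Chosen to dominate 2^λ - 1 and every η_i at once: a winner above `b` transmits immediately, so
  -- survival decays geometrically.
  set b := (2 : ℝ) ^ lam - 1 + ∑ i, eta N lam i
  have hb : 0 ≤ b := add_nonneg hg hsum
  refine ⟨_, winnerAbove_compl_lt_one N hb, fun n => ?_⟩
  induction n with
  | zero => simpa using prob_le_one
  | succ n ih =>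
    have hW := (measurableSet_winnerAbove (K := K) b).compl
    have hA := measurableSet_alive N h.isMeasurable n
    have hstep := lintegral_indicator_mul_eval (roundLaw N) hA
      (h := (winnerAbove b)ᶜ.indicator 1) (measurable_one.indicator hW) n
      (update_mem_alive_iff N S n)
    rw [lintegral_indicator_one hW] at hstep
    have hle : law N (alive N S (n + 1))
        ≤ ∫⁻ s, (alive N S n).indicator 1 s * (winnerAbove b)ᶜ.indicator 1 (s n) ∂(law N) := by
      rw [← lintegral_indicator_one (measurableSet_alive N h.isMeasurable (n + 1))]
      refine lintegral_mono fun ω => ?_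
      by_cases hω : ω ∈ alive N S (n + 1)
      · have h1 : ω ∈ alive N S n := fun m hm => hω m (hm.trans n.lt_succ_self)
        have h2 : ω n ∈ (winnerAbove b)ᶜ := by
          intro hcon
          have hcon : b < ((ω n).2 (winner (ω n).1)).1 := hcon
          have hi := Finset.single_le_sum (f := eta N lam) (fun i _ => hη i)
            (Finset.mem_univ (winner (ω n).1))
          refine hω n n.lt_succ_self (Or.inl ?_)
          refine (h.first n _ _ _ _ (hb.trans hcon.le)).trans (hatFirst_eq_transmit N hlam ?_ ?_)
          · exact (le_add_of_nonneg_right hsum).trans hcon.le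
          · exact (hi.trans (le_add_of_nonneg_left hg)).trans hcon.le
        simp only [Set.indicator_of_mem hω, Set.indicator_of_mem h1, Set.indicator_of_mem h2,
          Pi.one_apply, mul_one, le_refl]
      · simp only [Set.indicator_of_notMem hω, zero_le]
    refine hle.trans (hstep.le.trans ?_)
    rw [pow_succ]
    exact mul_le_mul_left ih _

theorem AgreesWithHat.feasible {lam : ℝ} (h : AgreesWithHat N S lam) (hlam : 0 ≤ lam) :
    S.Feasible N ∧ Summable fun n => (law N).real (alive N S n) := by
  obtain ⟨ρ, hρ, hle⟩ := h.exists_measure_alive_le hlam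
  have hρ' : ρ ≠ ⊤ := (hρ.trans ENNReal.one_lt_top).ne
  have hsum : Summable fun n => (law N).real (alive N S n) := by
    refine Summable.of_nonneg_of_le (fun n => measureReal_nonneg) (fun n => ?_)
      (summable_geometric_of_lt_one ENNReal.toReal_nonneg
        ((ENNReal.toReal_lt_toReal hρ' ENNReal.one_ne_top).2 hρ))
    rw [← ENNReal.toReal_pow]
    exact ENNReal.toReal_mono (ENNReal.pow_ne_top hρ') (hle n)
  have hends : ∀ᵐ ω ∂(law N), ∃ n, StopsAt N S ω n := by
    have h0 : law N {ω | ¬ ∃ n, StopsAt N S ω n} = 0 := by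
      refine le_antisymm (ge_of_tendsto' (ENNReal.tendsto_pow_atTop_nhds_zero_of_lt_one hρ)
        fun n => ?_) zero_le
      refine (measure_mono fun ω hω m _ hm => ?_).trans (hle n)
      exact hω ⟨m, hm⟩
    exact h0
  exact ⟨⟨h.isMeasurable.first, h.isMeasurable.second, hends,
    (wald_cost N h.isMeasurable hends hsum).1⟩, hsum⟩

/-- The greedy decisions make every term of the Wald series equal to P(alive) Δ(λ) = 0. -/
theorem AgreesWithHat.throughput_eq {lam : ℝ} (h : AgreesWithHat N S lam) (hlam : 0 ≤ lam)
    (hroot : increment N lam = 0) : throughput N S = lam := by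
  have hS := h.isMeasurable
  obtain ⟨hf, hsum⟩ := h.feasible hlam
  have h1 := hasSum_net N hS hf.stops hsum lam
  have h2 : ∀ n, ∫ ω, (alive N S n).indicator
      (fun ω => roundReward N S n ω - lam * roundCost N S n ω) ω ∂(law N) = 0 := by
    intro n
    have h3 := integral_alive_eq N hS n (integrable_net N hS lam n) (net_eq lam n)
      fun hist => integral_round_eq N lam hlam (hS.measurableSet_first n hist)
        (hS.measurableSet_second n hist) (h.first n hist) (h.second n hist)
    rwa [hroot, mul_zero] at h3
  simp only [h2] at h1
  have h4 := h1.unique hasSum_zero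
  have h5 := integral_cost_pos hf.integrable_cost
  unfold throughput
  rw [div_eq_iff h5.ne']
  linarith

end Strategy

/-! ### The two optimal strategies and the root price -/

open Strategy

theorem measurableSet_hatFirst (N : Network K) (lam : ℝ) (d : Decision) :
    MeasurableSet {o : FirstObs K | hatFirst N lam o.1 o.2.2 = d} := by
  have hW : Measurable fun o : FirstObs K => What N o.1 o.2.2 lam := by
    have : Measurable fun q : Fin K × (ℝ × ℝ) => What N q.1 q.2.2 lam :=
      measurable_from_prod_countable_right fun i => (measurable_What N i lam).comp measurable_snd
    exact this
  have hR : Measurable fun o : FirstObs K => N.τd * rateD o.2.2 - lam * N.τd :=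
    ((measurable_rateD.comp (by fun_prop)).const_mul _).sub_const _
  have hT : MeasurableSet {o : FirstObs K |
      max (What N o.1 o.2.2 lam) 0 ≤ N.τd * rateD o.2.2 - lam * N.τd} :=
    measurableSet_le (hW.max measurable_const) hR
  have hC : MeasurableSet {o : FirstObs K |
      N.τd * rateD o.2.2 - lam * N.τd < 0 ∧ What N o.1 o.2.2 lam < 0} :=
    (measurableSet_lt hR measurable_const).inter (measurableSet_lt hW measurable_const)
  unfold hatFirst
  exact measurableSet_ite_eq hT (MeasurableSet.const _)
    (measurableSet_ite_eq hC (MeasurableSet.const _) (MeasurableSet.const _))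

theorem measurableSet_ptdFirst (lam : ℝ) (ζ η : Fin K → ℝ) (d : Decision) :
    MeasurableSet {o : FirstObs K | ptdFirst lam (ζ o.1) (η o.1) o.2.2 = d} := by
  have hγ : Measurable fun o : FirstObs K => o.2.2 := by fun_prop
  have hζ : Measurable fun o : FirstObs K => ζ o.1 :=
    (measurable_of_countable ζ).comp measurable_fst
  have hη : Measurable fun o : FirstObs K => η o.1 :=
    (measurable_of_countable η).comp measurable_fst
  have h1 := measurableSet_le hη hγ
  have h2 := measurableSet_lt hγ hζ
  unfold ptdFirst
  have h3 : MeasurableSet {o : FirstObs K | η o.1 ≤ o.2.2 ∧ o.2.2 < ζ o.1} := h1.inter h2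
  exact measurableSet_ite_eq h3
    (measurableSet_ite_eq (measurableSet_le measurable_const hγ) (MeasurableSet.const _)
      (MeasurableSet.const _))
    (measurableSet_ite_eq h1 (MeasurableSet.const _)
      (measurableSet_ite_eq h2 (MeasurableSet.const _) (MeasurableSet.const _)))

theorem agreesWithHat_hatStrategy (N : Network K) (lam : ℝ) :
    AgreesWithHat N (hatStrategy N lam) lam where
  isMeasurable :=
    { first := fun n d => measurable_snd (measurableSet_hatFirst N lam d)
      second := fun n => by
        have hγ : Measurable fun x : (Fin n → PastObs K) × FirstObs K × (ℝ × ℝ) =>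
          x.2.1.2.2 := by fun_prop
        have hp : Measurable fun x : (Fin n → PastObs K) × FirstObs K × (ℝ × ℝ) => x.2.2 := by
          fun_prop
        exact measurableSet_le measurable_const ((measurable_rateD.comp hγ).max
          (measurable_rateR.comp (measurable_relaySNR.comp (hγ.prodMk hp)))) }
  first := fun _ _ _ _ _ _ => rfl
  second := fun _ _ _ _ _ _ _ _ _ => Iff.rfl

theorem agreesWithHat_ptdStrategy (N : Network K) (lam : ℝ) :
    AgreesWithHat N (ptdStrategy lam (zeta N lam) (eta N lam)) lam where
  isMeasurable :=
    { first := fun n d => measurable_snd (measurableSet_ptdFirst lam _ _ d)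
      second := fun n => by
        have hγ : Measurable fun x : (Fin n → PastObs K) × FirstObs K × (ℝ × ℝ) =>
          x.2.1.2.2 := by fun_prop
        have hp : Measurable fun x : (Fin n → PastObs K) × FirstObs K × (ℝ × ℝ) => x.2.2 := by
          fun_prop
        exact measurableSet_le measurable_const (hγ.max
          (((measurable_relaySNR.comp (hγ.prodMk hp)).const_add 1).sqrt.sub_const 1)) }
  first := fun _ _ i _ _ hγ => ptdFirst_eq_hatFirst N i lam hγ
  second := fun _ _ _ _ _ _ hγ h1 h2 =>
    ptdSecond_iff_hatSecond lam hγ (add_nonneg hγ (le_min h1 h2))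

variable [NeZero K] (N : Network K)

theorem isGreatest_throughput {lam : ℝ} (hlam : 0 ≤ lam) (hroot : increment N lam = 0) :
    IsGreatest {x | ∃ S : Strategy K, S.Feasible N ∧ x = S.throughput N} lam := by
  have h := agreesWithHat_hatStrategy N lam
  refine ⟨⟨_, (h.feasible hlam).1, (h.throughput_eq hlam hroot).symm⟩, ?_⟩
  rintro x ⟨S, hS, rfl⟩
  exact hS.throughput_le hlam hroot

/-- Any nonnegative root is the greatest throughput, so existence of a positive root suffices and
its uniqueness need not be shown separately. -/
theorem maxThroughput_spec : 0 < maxThroughput N ∧ increment N (maxThroughput N) = 0 := by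
  obtain ⟨lam, hlam, hroot⟩ := exists_increment_eq_zero N
  have : maxThroughput N = lam := (isGreatest_throughput N hlam.le hroot).csSup_eq
  rw [this]
  exact ⟨hlam, hroot⟩

end VANET

end

/-! ### The theorem -/

open VANET in
theorem theorem2 (K : ℕ) [NeZero K] (N : Network K) :
    -- the maximal average throughput is finite and positive
    (0 < maxThroughput N ∧
      ∀ S : Strategy K, S.Feasible N →
        Integrable (S.reward N) (law N) ∧ S.throughput N ≤ maxThroughput N) ∧
    -- the thresholds exist, are unique, and solve the equations that define them
    (∀ (lam : ℝ) (i : Fin K), 0 ≤ lam →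
      IsRecontendThreshold N i lam (zeta N lam i) ∧
      (∀ z, IsRecontendThreshold N i lam z → z = zeta N lam i) ∧
      (What N i 0 lam ≤ 0 → What N i (zeta N lam i) lam = 0) ∧
      (0 < What N i 0 lam → zeta N lam i = 0) ∧
      IsStopThreshold N i lam (eta N lam i) ∧
      (∀ h, IsStopThreshold N i lam h → h = eta N lam i) ∧
      What N i (eta N lam i) lam = N.τd * (rateD (eta N lam i) - lam)) ∧
    -- the threshold decisions are those of the strategy built on the closed form
    (∀ (i : Fin K) (γ γr : ℝ), 0 ≤ γ → γ ≤ γr →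
      ptdFirst (maxThroughput N) (zeta N (maxThroughput N) i) (eta N (maxThroughput N) i) γ
          = hatFirst N (maxThroughput N) i γ ∧
      (ptdSecond (maxThroughput N) γ γr ↔ hatSecond (maxThroughput N) γ γr)) ∧
    -- both strategies are feasible and attain the maximal average throughput
    ((ptdStrategy (maxThroughput N) (zeta N (maxThroughput N))
        (eta N (maxThroughput N))).Feasible N ∧
      (ptdStrategy (maxThroughput N) (zeta N (maxThroughput N))
        (eta N (maxThroughput N))).throughput N = maxThroughput N ∧
      (hatStrategy N (maxThroughput N)).Feasible N ∧
      (hatStrategy N (maxThroughput N)).throughput N = maxThroughput N) ∧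
    -- the iterative algorithm computes the maximal average throughput
    (∀ (ε : ℝ) (α : ℕ → ℝ), 0 < ε →
      (∀ l, ε ≤ α l ∧ α l ≤ (2 - ε) / (N.τo + N.τd)) →
      Tendsto (iterate N α) atTop (𝓝 (maxThroughput N)) ∧
      (∃ x, IsOutput N α ε x) ∧
      (∀ x, IsOutput N α ε x → |x - maxThroughput N| < ε / N.τo) ∧
      ((∀ l, α l ≤ 1 / (N.τo + N.τd)) → ∀ l, 0 ≤ increment N (iterate N α l))) := by
  obtain ⟨hpos, hroot⟩ := maxThroughput_spec N
  have hhat := agreesWithHat_hatStrategy N (maxThroughput N)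
  have hptd := agreesWithHat_ptdStrategy N (maxThroughput N)
  refine ⟨⟨hpos, fun S hS => ⟨hS.integrable_reward, hS.throughput_le hpos.le hroot⟩⟩,
    fun lam i _ => ?_, fun i γ γr hγ h => ⟨ptdFirst_eq_hatFirst N i _ hγ,
      ptdSecond_iff_hatSecond _ hγ (hγ.trans h)⟩,
    ⟨(hptd.feasible hpos.le).1, hptd.throughput_eq hpos.le hroot, (hhat.feasible hpos.le).1,
      hhat.throughput_eq hpos.le hroot⟩, fun ε α hε hα => algorithm_spec N hpos hroot hε hα⟩
  obtain ⟨h1, h2, h3⟩ := zeta_spec N lam i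
  obtain ⟨h4, h5⟩ := eta_spec N lam i
  exact ⟨h1, fun z hz => hz.unique h1, h2, h3, h4, fun h hh => hh.unique h4, h5⟩
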